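/- **Proposition (Clifford universality of 3F defect theory).** *The defect theory.* The 3-fermion theory **3F** has the anyons $1,\psi_0,\psi_1,\psi_2$ with $\mathbb Z_2\times\mathbb Z_2$ fusion rules, trivial $F$-symbols and exchange phases $R^{ab}=1$ if $b=a+1$ (mod 3) and $R^{ab}=-1$ otherwise $(a,b\in\{0,1,2\})$; so every $\psi_a$ is a fermion and distinct fermions have monodromy $-1$. $S_3$ acts by permuting the fermions. For a 2-cycle $g\in S_3$ let $\mathcal T_g$ ($=\mathcal T_g^+$) be its twist defect and $\psi_{f(g)}$ the fermion fixed by $g$, so that $\mathcal T_g\times\mathcal T_g=1+\psi_{f(g)}$. For a configuration $\mathcal T_{c_1},\dots,\mathcal T_{c_N}$ of such twists on a line, with domain walls running straight down, let $\gamma_k$ be the operator of the string that carries $\psi_{f(c_k)}$ from the $k$-th twist straight up to a common reference point: $\gamma_k^2=1$ and $\gamma_j\gamma_k=R^{f(c_j)f(c_k)}\gamma_k\gamma_j$ for $j<k$. States are the (density) elements of the algebra generated by the $\gamma_k$. With $\sqrt{1}=1$, $\sqrt{-1}=i$ put $Q_{jk}=\sqrt{R^{f(c_j)f(c_k)}}\,\gamma_j\gamma_k$.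 The elementary processes are: * *Braiding.* An exchange of the neighbouring twists $k,k+1$ changes their types from $(g,h)$ to $(h,hgh^{-1})$. The new string operators are given by the old ones: $\gamma'_k=\gamma_{k+1}$, and $\gamma'_{k+1}=-\gamma_k$ if $g=h$, $\gamma'_{k+1}=Q_{k,k+1}$ if $g\ne h$; the others are unchanged. The inverse exchange changes the types to $(ghg^{-1},g)$, with $\gamma'_{k+1}=\gamma_k$ and $\gamma'_k=-\gamma_{k+1}$ if $g=h$, $\gamma'_k=Q_{k,k+1}$ if $g\neq h$. * *Nucleation* of a pair of neighbouring twists $k,k+1$ of equal type out of the vacuum, i.e. with $Q_{k,k+1}=+1$. * *Fusion* of a pair of neighbouring twists of equal type $g$; the outcome is $1$ (projection on $Q_{k,k+1}=+1$) or $\psi_{f(g)}$ (projection on $Q_{k,k+1}=-1$), and the pair disappears (a fermion that results is carried away downwards). *Encoded qubits.* A $g$-encoded qubit consists of four consecutive twists $\mathcal T_g^{(1)},\dots,\mathcal T_g^{(4)}$ of trivial total charge ($-\gamma_1\gamma_2\gamma_3\gamma_4=1$), with logical operators $\overline Z=i\gamma_1\gamma_2$ and $\overline X=i\gamma_1\gamma_3$;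 the computational basis is the charge of $\mathcal T_g^{(1)}\times\mathcal T_g^{(2)}$. An operation on $n$ qubits, each encoded in this way, is *implemented by braiding and fusion* if some finite procedure of the elementary processes, each step of which may depend on earlier fusion outcomes, takes the encoding of each state exactly to the encoding of its image; for a measurement, the measurement outcome is read off from the fusion outcomes. *Statement.* Let $g\neq h$ be 2-cycles in $S_3$. Consider any number $n$ of qubits, each of which is $g$-encoded or $h$-encoded, in any order and including the case that all have the same type. Then every Clifford operation on them can be implemented by braiding and fusion in which only twists $\mathcal T_g$ and $\mathcal T_h$ are nucleated, namely: 1. each Clifford unitary $U$ on $n$ qubits, i.e. each unitary that normalizes the $n$-qubit Pauli group, as the channel $A\mapsto UAU^\dagger$; 2. the preparation of an additional $g$- or $h$-encoded qubit, at any place among the other qubits and with the state of these unaffected, in the $+1$ or $-1$ eigenstate of $X$, $Y$ or $Z$; 3. the measurement of $X$, $Y$ or $Z$ on any one of the qubits, after which this qubit is discarded: with outcome $\pm1$ and the eigenprojection $\Pi_\pm$ of that qubit, the others are left in the unnormalized state $\operatorname{tr}_j(\Pi_\pm A)$. -/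

import Mathlib

/-!
Twist defects of the 3-fermion anyon theory: string operators, braiding and fusion of twists,
the four-twist qubit encodings, and Clifford operations on qubits.
-/

noncomputable section

namespace ThreeFermion

/-! ### The anyon theory and its 2-cycle twists -/

/-- The three fermion species `r, g, b` (as `0, 1, 2`); together with the vacuum `1` they form the
3-fermion theory, with fusion group `ℤ₂ × ℤ₂`. The symmetry group is `S₃ = Equiv.Perm Fermion`. -/
abbrev Fermion := Fin 3

/-- The exchange phases `R^{ab}` of the 3-fermion theory. The `F`-symbols are trivial in this gauge
and `R` is a bicharacter of the fusion group. -/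
def R (a b : Fermion) : ℂ := if b = a + 1 then 1 else -1

/-- All three species are fermions: the topological spins are `-1`. -/
theorem R_self (a : Fermion) : R a a = -1 := by
  fin_cases a <;> simp [R]

/-- The monodromy is the `S`-matrix entry: trivial for equal species, `-1` for distinct ones. -/
theorem R_mul_R (a b : Fermion) : R a b * R b a = if a = b then 1 else -1 := by
  fin_cases a <;> fin_cases b <;> simp [R, Fin.ext_iff]

/-- `R` is compatible with `ψ_b × ψ_d = ψ_e` for `b, d, e` distinct. -/
theorem R_fusion (a b d e : Fermion) (h₁ : b ≠ d) (h₂ : b ≠ e) (h₃ : d ≠ e) :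
    R a b * R a d = R a e ∧ R b a * R d a = R e a := by
  fin_cases a <;> fin_cases b <;> fin_cases d <;> fin_cases e <;>
    simp_all [R, Fin.ext_iff]

/-- The principal square root of `R^{ab}`. -/
def sqrtR (a b : Fermion) : ℂ := if b = a + 1 then 1 else Complex.I

theorem sqrtR_sq (a b : Fermion) : sqrtR a b ^ 2 = R a b := by
  unfold sqrtR R; split_ifs <;> simp

/-- The 2-cycles of `S₃`. The element `g` labels the twist defect `𝒯_g = 𝒯_g⁺`. -/
abbrev TwoCycle := {g : Equiv.Perm Fermion // g.IsSwap}

/-- The species fixed by a 2-cycle `g` (the sum has exactly one term): `ψ_{fixed g}` is the fermion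
that condenses on the twist `𝒯_g`, and `𝒯_g × 𝒯_g = 1 + ψ_{fixed g}`. -/
def fixed (g : TwoCycle) : Fermion := ∑ a with g.1 a = a, a

/-- `g h g⁻¹`: the label of a twist `𝒯_h` that has been carried through the domain wall of `𝒯_g`. -/
def conj (g h : TwoCycle) : TwoCycle :=
  ⟨g.1 * h.1 * g.1⁻¹, by
    obtain ⟨g, hg⟩ := g
    obtain ⟨_, x, y, hxy, rfl⟩ := h
    exact ⟨g x, g y, fun h => hxy (g.injective h), by
      ext z; simp [Equiv.swap_apply_def, Equiv.Perm.mul_apply,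
        Equiv.symm_apply_eq]; split_ifs <;> simp⟩⟩

/-- A configuration of `N` twists, at positions `0, …, N - 1` from left to right on a line in the
plane. The domain wall of each twist runs straight down. -/
abbrev Config (N : ℕ) := Fin N → TwoCycle

/-! ### String operators and states

For a twist configuration `c`, let `γ_k` be the operator of the string that emits a fermion
`ψ_{fixed (c k)}` from the twist at `k` and carries it straight up to a common reference point.
These strings satisfy `γ_k² = 1` and, for `j < k`, `γ_j γ_k = R^{ab} γ_k γ_j`, where
`a = fixed (c j)` and `b = fixed (c k)` are the fermions they carry. For twists of a single type
they are Majorana operators. -/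

/-- Operators on `(ℂ²)^{⊗ N}`. -/
abbrev Op (N : ℕ) := Matrix (Fin N → Bool) (Fin N → Bool) ℂ

/-- The string operator `γ_k` of the configuration `c`, in the regular representation of the string
algebra: the basis vector `y` stands for the ordered product of the `γ_j` with `y j = true`. -/
def stringOp {N : ℕ} (c : Config N) (k : Fin N) : Op N :=
  Matrix.of fun x y =>
    if x = Function.update y k (!y k) then
      ∏ j with j < k ∧ y j = true, R (fixed (c j)) (fixed (c k))
    else 0

/-- The ordered product of the operators `A k` with `x k = true`. -/
def word {K M : ℕ} (A : Fin K → Op M) (x : Fin K → Bool) : Op M :=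
  (List.ofFn fun k => if x k then A k else 1).prod

/-- A state is given by the expectation values of the products of string operators.
`transport A B ρ` is the state in the algebra generated by the strings `B` in which every product
of strings `B k` has the expectation value of the corresponding product of the `A k` in `ρ`. -/
def transport {K M L : ℕ} (A : Fin K → Op M) (B : Fin K → Op L) (ρ : Op M) : Op L :=
  ((2 : ℂ) ^ K)⁻¹ • ∑ x : Fin K → Bool, Matrix.trace ((word A x).conjTranspose * ρ) • word B x

/-- The normalized product `√R · γ_i γ_j`: for the strings from two twists `i < j`, the self-adjoint
operator of the string joining them and, if they carry different fermions, fused to one string that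
leads to the reference point. -/
def pairOp {N : ℕ} (c : Config N) (i j : Fin N) : Op N :=
  sqrtR (fixed (c i)) (fixed (c j)) • (stringOp c i * stringOp c j)

/-! ### Braiding -/

/-- Twist labels after an exchange of the twists at `i` and `i + 1`. For `s = true` the twist at
`i + 1` moves left above the other one, which passes through its domain wall; for `s = false`
the inverse braid is applied. -/
def exchangeConfig {N : ℕ} (c : Config N) (i : ℕ) (hi : i + 1 < N) (s : Bool) : Config N :=
  let l : Fin N := ⟨i, by omega⟩
  let r : Fin N := ⟨i + 1, hi⟩
  fun k =>
    if k = l then (if s then c r else conj (c l) (c r))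
    else if k = r then (if s then conj (c r) (c l) else c l)
    else c k

/-- The straight strings of the configuration after the exchange, pulled back to the
configuration before it. One of the two exchanged strings stays straight. The other one is pulled
across the other twist: if the two twists have the same type it acquires a sign, and otherwise it
becomes the fusion of both strings. -/
def exchangeString {N : ℕ} (c : Config N) (i : ℕ) (hi : i + 1 < N) (s : Bool) (k : Fin N) : Op N :=
  let l : Fin N := ⟨i, by omega⟩
  let r : Fin N := ⟨i + 1, hi⟩
  if k = l then
    (if s then stringOp c r else if c l = c r then -stringOp c r else pairOp c l r)
  else if k = r then
    (if s then (if c l = c r then -stringOp c l else pairOp c l r) else stringOp c l)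
  else stringOp c k

/-- The effect of an exchange of the twists at `i` and `i + 1` on states. -/
def exchangeMap {N : ℕ} (c : Config N) (i : ℕ) (hi : i + 1 < N) (s : Bool) (ρ : Op N) : Op N :=
  transport (exchangeString c i hi s) (stringOp (exchangeConfig c i hi s)) ρ

/-! ### Nucleation and fusion of pairs -/

/-- The projection onto total charge `1` (`q = false`) or `ψ_{fixed g}` (`q = true`) of two twists
of the same type `g` at positions `i < j`. -/
def chargeProj {N : ℕ} (c : Config N) (i j : Fin N) (q : Bool) : Op N :=
  (1 / 2 : ℂ) • (1 + (if q then (-1 : ℂ) else 1) • pairOp c i j)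

/-- The positions other than `i` and `i + 1`. -/
def skip {N : ℕ} (i : Fin (N + 1)) (k : Fin N) : Fin (N + 2) :=
  i.castSucc.succAbove (i.succAbove k)

/-- Insert two twists of type `g`, at the positions `i` and `i + 1`. -/
def insertPair {N : ℕ} (c : Config N) (i : Fin (N + 1)) (g : TwoCycle) : Config (N + 2) :=
  i.castSucc.insertNth g (i.insertNth g c)

/-- Remove the twists at the positions `i` and `i + 1`. -/
def removePair {N : ℕ} (c : Config (N + 2)) (i : Fin (N + 1)) : Config N :=
  fun k => c (skip i k)

/-- Nucleation of a pair of twists of type `g` out of the vacuum. -/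
def nucleateMap {N : ℕ} (c : Config N) (i : Fin (N + 1)) (g : TwoCycle) (ρ : Op N) : Op (N + 2) :=
  (1 / 2 : ℂ) •
    (chargeProj (insertPair c i g) i.castSucc i.succ false *
      transport (stringOp c) (fun k => stringOp (insertPair c i g) (skip i k)) ρ)

/-- Fusion of two neighbouring twists of the same type with outcome `1` (`q = false`) or
`ψ` (`q = true`): unnormalized state of the remaining twists, whose trace is the probability of the
outcome. In the second case the resulting fermion is carried away straight down. -/
def fuseMap {N : ℕ} (c : Config (N + 2)) (i : Fin (N + 1)) (q : Bool) (ρ : Op (N + 2)) : Op N :=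
  transport (fun k => stringOp c (skip i k)) (stringOp (removePair c i))
    (chargeProj c i.castSucc i.succ q * ρ * chargeProj c i.castSucc i.succ q)

/-- Finite adaptive procedures of braiding and fusion, from a given configuration to the
configuration `d`: exchange neighbouring twists, nucleate pairs of twists with types in `S`, and
fuse neighbouring twists of equal type, where the further steps may depend on the outcome. -/
inductive Protocol (S : Set TwoCycle) {M : ℕ} (d : Config M) : {N : ℕ} → Config N → Type
  | done : Protocol S d d
  | exchange {N : ℕ} {c : Config N} (i : ℕ) (hi : i + 1 < N) (s : Bool)
      (next : Protocol S d (exchangeConfig c i hi s)) : Protocol S d c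
  | nucleate {N : ℕ} {c : Config N} (i : Fin (N + 1)) (g : TwoCycle) (hg : g ∈ S)
      (next : Protocol S d (insertPair c i g)) : Protocol S d c
  | fuse {N : ℕ} {c : Config (N + 2)} (i : Fin (N + 1)) (hi : c i.castSucc = c i.succ)
      (next : Bool → Protocol S d (removePair c i)) : Protocol S d c

/-- The branches of a protocol on a given input state: the record of fusion outcomes, and the
resulting unnormalized state (whose trace is the probability of the branch). -/
def Protocol.run {S : Set TwoCycle} {M : ℕ} {d : Config M} :
    {N : ℕ} → {c : Config N} → Protocol S d c → Op N → List (List Bool × Op M)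
  | _, _, .done, ρ => [([], ρ)]
  | _, c, .exchange i hi s next, ρ => next.run (exchangeMap c i hi s ρ)
  | _, c, .nucleate i g _ next, ρ => next.run (nucleateMap c i g ρ)
  | _, c, .fuse i _ next, ρ =>
      ((next false).run (fuseMap c i false ρ)).map (fun b => (false :: b.1, b.2)) ++
        ((next true).run (fuseMap c i true ρ)).map (fun b => (true :: b.1, b.2))

/-! ### Encoded qubits -/

/-- The operators on `n` qubits. -/
abbrev QubitOp (n : ℕ) := Matrix (Fin n → Bool) (Fin n → Bool) ℂ

/-- The position of the `k`-th twist (`k = 0, 1, 2, 3`) of the `j`-th qubit. -/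
def pos {n : ℕ} (j : Fin n) (k : Fin 4) : Fin (4 * n) := ⟨4 * j + k, by omega⟩

/-- `n` qubits, the `j`-th one encoded in four twists of type `τ j`. -/
def blocks {n : ℕ} (τ : Fin n → TwoCycle) : Config (4 * n) := fun k => τ ⟨k / 4, by omega⟩

/-- The projection onto the encoded state `|0…0⟩`: in every block the first two twists have
trivial total charge, and so do the last two. -/
def zeroProj {n : ℕ} (τ : Fin n → TwoCycle) : Op (4 * n) :=
  (List.ofFn fun j => chargeProj (blocks τ) (pos j 0) (pos j 1) false *
    chargeProj (blocks τ) (pos j 2) (pos j 3) false).prod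

/-- The logical Pauli operators `X^a = ∏_j X_j^{a_j}`; `X_j = i γ₁ γ₃` transfers a fermion between
the first and the third twist of the block. -/
def logicalX {n : ℕ} (τ : Fin n → TwoCycle) (a : Fin n → Bool) : Op (4 * n) :=
  (List.ofFn fun j => if a j then pairOp (blocks τ) (pos j 0) (pos j 2) else 1).prod

/-- The state of the twists that encodes `A`: the matrix unit `|a⟩⟨b|` is encoded as
`X^a |0…0⟩⟨0…0| X^b`. In every block the total charge is trivial, and the value of the qubit is the
charge of the first two twists. Normalized so that traces agree. -/
def encode {n : ℕ} (τ : Fin n → TwoCycle) (A : QubitOp n) : Op (4 * n) :=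
  ((4 : ℂ) ^ n)⁻¹ • ∑ a, ∑ b, A a b • (logicalX τ a * zeroProj τ * (logicalX τ b).conjTranspose)

/-- The protocol `P` takes `n` qubits, encoded with the types `τ`, to `m` qubits, encoded with the
types `σ`, and implements the instrument `E` on them: the measurement outcome `ω` is read
off from the record of fusion outcomes, and the state is mapped to the unnormalized state `E ω A`.
If `Ω` has a single element, this says that the channel `E` is implemented. -/
def Protocol.Implements {S : Set TwoCycle} {n m : ℕ} {τ : Fin n → TwoCycle} {σ : Fin m → TwoCycle}
    {Ω : Type} [DecidableEq Ω] (P : Protocol S (blocks σ) (blocks τ)) (readout : List Bool → Ω)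
    (E : Ω → QubitOp n → QubitOp m) : Prop :=
  ∀ (ω : Ω) (A : QubitOp n),
    ((P.run (encode τ A)).map fun b => if readout b.1 = ω then b.2 else 0).sum
      = encode σ (E ω A)

/-- The instrument `E` on encoded qubits can be implemented by braiding and fusion of twists, where
twists are nucleated with types in `S` only. -/
def Implementable (S : Set TwoCycle) {n m : ℕ} (τ : Fin n → TwoCycle) (σ : Fin m → TwoCycle)
    {Ω : Type} [DecidableEq Ω] (E : Ω → QubitOp n → QubitOp m) : Prop :=
  ∃ (P : Protocol S (blocks σ) (blocks τ)) (readout : List Bool → Ω), P.Implements readout E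

/-! ### Clifford operations -/

/-- The operator `X^a Z^b` on `n` qubits. -/
def pauliXZ {n : ℕ} (a b : Fin n → Bool) : QubitOp n :=
  Matrix.of fun x y =>
    if x = (fun j => xor (a j) (y j)) then ∏ j with b j = true ∧ y j = true, (-1 : ℂ) else 0

/-- Membership in the Pauli group on `n` qubits. -/
def IsPauli {n : ℕ} (P : QubitOp n) : Prop :=
  ∃ (k : ℕ) (a b : Fin n → Bool), P = Complex.I ^ k • pauliXZ a b

/-- The Clifford unitaries: those that normalize the Pauli group. -/
def IsClifford {n : ℕ} (U : QubitOp n) : Prop :=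
  U ∈ Matrix.unitaryGroup (Fin n → Bool) ℂ ∧
    ∀ P : QubitOp n, IsPauli P ↔ IsPauli (U * P * U.conjTranspose)

/-- The single-qubit Pauli observables. -/
inductive Axis
  | X | Y | Z

/-- The Pauli matrices, in the basis `false = |0⟩`, `true = |1⟩`. -/
def Axis.pauli : Axis → Matrix Bool Bool ℂ
  | .X => Matrix.of fun x y => if x = y then 0 else 1
  | .Y => Matrix.of fun x y => if x = y then 0 else if x then Complex.I else -Complex.I
  | .Z => Matrix.of fun x y => if x = y then (if x then -1 else 1) else 0

/-- The projection onto the eigenvalue `1` (`q = false`) or `-1` (`q = true`). -/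
def Axis.proj (p : Axis) (q : Bool) : Matrix Bool Bool ℂ :=
  (1 / 2 : ℂ) • (1 + (if q then (-1 : ℂ) else 1) • p.pauli)

/-- Preparation of a new qubit `j` in the eigenstate of `p` with the sign `q`. -/
def prepare {n : ℕ} (j : Fin (n + 1)) (p : Axis) (q : Bool) (A : QubitOp n) : QubitOp (n + 1) :=
  Matrix.of fun x y => p.proj q (x j) (y j) * A (j.removeNth x) (j.removeNth y)

/-- Measurement of `p` on the qubit `j`, with the outcome `q`; the measured qubit is discarded. -/
def measure {n : ℕ} (j : Fin (n + 1)) (p : Axis) (q : Bool) (A : QubitOp (n + 1)) : QubitOp n :=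
  Matrix.of fun x y => ∑ s, ∑ t, p.proj q s t * A (j.insertNth t x) (j.insertNth s y)

end ThreeFermion

end

noncomputable section

namespace ThreeFermion

open Matrix

/-! ### Words in string operators and the regular representation -/

/-! The Clifford group is generated, up to phases, by the quarter turns `exp(-iπP/4)` with `P` a
Pauli involution. Every logical Pauli operator is a product of strings whose fermions fuse to the
vacuum. So the core claim is that `exp(-iπw/4)` can be implemented for every involution `w` that is
a multiple of such a neutral product (`degreeRotatable_of_neutral`); preparation and measurement
then only have to be done in the computational basis.

A product of strings is determined up to a scalar by the set of strings in it, a vector over `𝔽₂`.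
An exchange acts on the string algebra as an algebra isomorphism (`exchangeMap_ev`) and on these
vectors as an invertible linear map, so a rotation is implementable if it is implementable after an
exchange (`DegreeRotatable.of_exchange`). It is also implementable if it is implementable next to a
pair nucleated from the vacuum: the rotation does not touch the charge of the pair, so the pair
fuses back to the vacuum with certainty (`DegreeRotatable.of_insertTwo`). The base case is a product
of two neighbouring strings of equal type, where the rotation is the exchange itself
(`DegreeRotatable.pair`).

Exchanges move strings to the left and merge neighbouring strings of different types into one. What
can get stuck is an initial run of strings of one type. If it is longer than two, a pair of twists
of another type is nucleated and used to shorten it (`exists_reduction`). This is where the second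
type is indispensable to the argument: it gives the products of four and more strings, and hence the
entangling gates, even if all qubits have the same type.

On encoded states, a logical Pauli operator acts as the corresponding Pauli matrix
(`encode_pauliXZ_mul`), so these rotations become quarter turns on qubits (`channel_rotate`).
Generation of the Clifford group is an elimination: quarter turns move the images of `X_k` and `Z_k`
back to `X_k` and `Z_k`, qubit by qubit, and what remains commutes with all Pauli operators and is a
scalar (`exists_gate_of_isClifford`). Nucleating two pairs prepares `|0⟩` (`channel_prepare_zero`),
fusing the two pairs of a block measures `Z` (`readBlock_encode`), and quarter turns supply the
other axes. -/

/-- Pointwise sum of bit vectors. -/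
def vxor {N : ℕ} (v w : Fin N → Bool) : Fin N → Bool := fun j => xor (v j) (w j)

/-- The bit vector with a single entry `true`. -/
def single {N : ℕ} (k : Fin N) : Fin N → Bool := fun j => decide (j = k)

/-- Flip one bit. -/
def toggle {N : ℕ} (k : Fin N) (x : Fin N → Bool) : Fin N → Bool := Function.update x k (!x k)

theorem toggle_toggle {N : ℕ} (k : Fin N) (x : Fin N → Bool) : toggle k (toggle k x) = x := by
  simp [toggle]

theorem toggle_eq_vxor {N : ℕ} (k : Fin N) (x : Fin N → Bool) :
    toggle k x = vxor (single k) x := by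
  ext j
  by_cases h : j = k
  · subst h; simp [toggle, vxor, single]
  · simp [toggle, vxor, single, h]

theorem vxor_self {N : ℕ} (v : Fin N → Bool) : vxor v v = fun _ => false := by
  ext; simp [vxor]

theorem vxor_assoc {N : ℕ} (u v w : Fin N → Bool) : vxor (vxor u v) w = vxor u (vxor v w) := by
  ext; simp [vxor]

theorem vxor_comm {N : ℕ} (u v : Fin N → Bool) : vxor u v = vxor v u := by
  ext; simp [vxor, Bool.xor_comm]

theorem false_vxor {N : ℕ} (v : Fin N → Bool) : vxor (fun _ => false) v = v := by
  ext; simp [vxor]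

theorem vxor_false {N : ℕ} (v : Fin N → Bool) : vxor v (fun _ => false) = v := by
  ext; simp [vxor]

theorem vxor_cancel_left {N : ℕ} (u v : Fin N → Bool) : vxor u (vxor u v) = v := by
  rw [← vxor_assoc, vxor_self, false_vxor]

theorem R_sq (a b : Fermion) : R a b * R a b = 1 := by
  unfold R; split_ifs <;> simp

theorem word_succ {K M : ℕ} (A : Fin (K + 1) → Op M) (x : Fin (K + 1) → Bool) :
    word A x = (if x 0 then A 0 else 1) * word (fun k => A k.succ) (fun k => x k.succ) := by
  simp [word, List.ofFn_succ]

theorem word_false {K M : ℕ} (A : Fin K → Op M) : word A (fun _ => false) = 1 := by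
  simp [word, List.ofFn_const]

/-- Moving `A k` past the earlier factors of the ordered product costs one sign each; at its own
place it is then inserted, or cancels against the copy already there. The signs are kept abstract so
that the induction can drop the first string. -/
theorem mul_word_of_signs {M K : ℕ} (ε : Fin K → Fin K → ℂ) (hε : ∀ j k, ε j k * ε j k = 1)
    (A : Fin K → Op M) (sq : ∀ k, A k * A k = 1)
    (comm : ∀ j k, j < k → A j * A k = ε j k • (A k * A j)) (k : Fin K) (x : Fin K → Bool) :
    A k * word A x = (∏ j with j < k ∧ x j = true, ε j k) • word A (toggle k x) := by
  induction K with
  | zero => exact k.elim0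
  | succ K ih =>
    rw [word_succ, word_succ A (toggle k x)]
    refine Fin.cases ?_ (fun k => ?_) k
    · have h1 : (fun k : Fin K => toggle 0 x k.succ) = fun k => x k.succ := by
        ext j; simp [toggle, Function.update, Fin.succ_ne_zero]
      have h2 : (toggle 0 x) 0 = !x 0 := by simp [toggle]
      rw [h1, h2]
      cases hx : x 0
      · simp
      · simp [← mul_assoc, sq]
    · have h1 : (fun j : Fin K => toggle k.succ x j.succ) = toggle k (fun j => x j.succ) := by
        ext j; simp [toggle, Function.update]
      have h2 : (toggle k.succ x) 0 = x 0 := by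
        simp [toggle, Function.update, (Fin.succ_ne_zero k).symm]
      rw [h1, h2]
      have ih' := ih (fun j k => ε j.succ k.succ) (fun _ _ => hε _ _) (fun j => A j.succ)
        (fun _ => sq _) (fun j k hjk => comm _ _ (Fin.succ_lt_succ_iff.2 hjk)) k
        (fun j => x j.succ)
      have hprod : (∏ j with j < k.succ ∧ x j = true, ε j k.succ)
          = (if x 0 then ε 0 k.succ else 1) *
            ∏ j : Fin K with j < k ∧ x j.succ = true, ε j.succ k.succ := by
        rw [Finset.prod_filter, Finset.prod_filter, Fin.prod_univ_succ]
        simp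
      rw [hprod]
      cases hx : x 0
      · simp [ih']
      · have h3 : A k.succ * A 0 = ε 0 k.succ • (A 0 * A k.succ) := by
          rw [comm 0 k.succ (Fin.succ_pos k), smul_smul, hε, one_smul]
        simp only [if_true]
        rw [← mul_assoc, h3, smul_mul_assoc, mul_assoc, ih', mul_smul_comm, smul_smul]

/-- The relations of the string operators of the configuration `c`. -/
structure StringRel {K M : ℕ} (c : Config K) (A : Fin K → Op M) : Prop where
  sq : ∀ k, A k * A k = 1
  comm : ∀ j k, j < k → A j * A k = R (fixed (c j)) (fixed (c k)) • (A k * A j)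

/-- The sign in the product of the `k`-th string with an ordered product of strings. -/
def stringSign {N : ℕ} (c : Config N) (k : Fin N) (y : Fin N → Bool) : ℂ :=
  ∏ j with j < k ∧ y j = true, R (fixed (c j)) (fixed (c k))

theorem StringRel.mul_word {K M : ℕ} {c : Config K} {A : Fin K → Op M} (h : StringRel c A)
    (k : Fin K) (x : Fin K → Bool) : A k * word A x = stringSign c k x • word A (toggle k x) :=
  mul_word_of_signs (fun j k => R (fixed (c j)) (fixed (c k))) (fun _ _ => R_sq _ _) A h.sq h.comm
    k x

theorem stringOp_apply {N : ℕ} (c : Config N) (k : Fin N) (x y : Fin N → Bool) :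
    stringOp c k x y = if x = toggle k y then stringSign c k y else 0 := rfl

theorem eq_toggle_iff {N : ℕ} (k : Fin N) (x y : Fin N → Bool) : x = toggle k y ↔ y = toggle k x :=
  ⟨fun h => by rw [h, toggle_toggle], fun h => by rw [h, toggle_toggle]⟩

theorem stringOp_mulVec {N : ℕ} (c : Config N) (k : Fin N) (f : (Fin N → Bool) → ℂ)
    (x : Fin N → Bool) :
    (stringOp c k *ᵥ f) x = stringSign c k (toggle k x) * f (toggle k x) := by
  simp only [Matrix.mulVec, dotProduct, stringOp_apply, eq_toggle_iff k x]
  rw [Finset.sum_eq_single (toggle k x)]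
  · simp
  · intro b _ hb; simp [hb]
  · simp

/-- Evaluation of noncommutative polynomials in the strings. -/
def ev {K M : ℕ} (A : Fin K → Op M) : FreeAlgebra ℂ (Fin K) →ₐ[ℂ] Op M := FreeAlgebra.lift ℂ A

@[simp] theorem ev_ι {K M : ℕ} (A : Fin K → Op M) (k : Fin K) :
    ev A (FreeAlgebra.ι ℂ k) = A k := by
  simp [ev]

/-- By `StringRel.mul_word`, `f ↦ ∑ f x • word A x` intertwines the regular representation with left
multiplication by the strings `A`: on generators both sides carry the same signed shift. -/
theorem StringRel.ev_mul_sum {K M : ℕ} {c : Config K} {A : Fin K → Op M} (h : StringRel c A)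
    (p : FreeAlgebra ℂ (Fin K)) (f : (Fin K → Bool) → ℂ) :
    ev A p * ∑ x, f x • word A x = ∑ x, (ev (stringOp c) p *ᵥ f) x • word A x := by
  induction p using FreeAlgebra.induction generalizing f with
  | grade0 r =>
    simp [Algebra.algebraMap_eq_smul_one, Finset.smul_sum, Matrix.smul_mulVec, smul_smul]
  | grade1 k =>
    simp only [ev_ι, Finset.mul_sum, mul_smul_comm, h.mul_word, stringOp_mulVec]
    -- Flipping the bit `k` is an involution, so it can serve to reindex the sum over words.
    refine Fintype.sum_equiv (Function.Involutive.toPerm (toggle k) (toggle_toggle k)) _ _ ?_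
    intro x
    change _ = (stringSign c k (toggle k (toggle k x)) * f (toggle k (toggle k x))) •
      word A (toggle k x)
    rw [toggle_toggle, smul_smul, mul_comm]
  | mul p q hp hq => rw [map_mul, mul_assoc, hq, hp, map_mul, Matrix.mulVec_mulVec]
  | add p q hp hq =>
    simp only [map_add, add_mul, hp, hq, Matrix.add_mulVec, Pi.add_apply, add_smul,
      Finset.sum_add_distrib]

/-- Apply the intertwining to the basis vector of the empty word. The coefficients depend only on
the relations and not on the family `A`, which makes the regular representation universal. -/
theorem StringRel.ev_eq_sum {K M : ℕ} {c : Config K} {A : Fin K → Op M} (h : StringRel c A)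
    (p : FreeAlgebra ℂ (Fin K)) :
    ev A p = ∑ x, ev (stringOp c) p x (fun _ => false) • word A x := by
  have := h.ev_mul_sum p (Pi.single (fun _ => false) 1)
  rw [Finset.sum_eq_single (fun _ => false)] at this
  · simpa [word_false] using this
  · intro b _ hb; simp [hb]
  · simp

/-- The ordered product of strings as a polynomial. -/
def freeWord {K : ℕ} (x : Fin K → Bool) : FreeAlgebra ℂ (Fin K) :=
  (List.ofFn fun k => if x k then FreeAlgebra.ι ℂ k else 1).prod

theorem ev_freeWord {K M : ℕ} (A : Fin K → Op M) (x : Fin K → Bool) :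
    ev A (freeWord x) = word A x := by
  rw [freeWord, map_list_prod, List.map_ofFn, word]
  congr 2; ext1 k; simp only [Function.comp]; split_ifs <;> simp

/-! ### Transport of states -/

theorem transport_add {K M L : ℕ} (A : Fin K → Op M) (B : Fin K → Op L) (ρ σ : Op M) :
    transport A B (ρ + σ) = transport A B ρ + transport A B σ := by
  simp [transport, mul_add, add_smul, Finset.sum_add_distrib]

theorem transport_smul {K M L : ℕ} (A : Fin K → Op M) (B : Fin K → Op L) (z : ℂ) (ρ : Op M) :
    transport A B (z • ρ) = z • transport A B ρ := by
  simp only [transport, mul_smul_comm, Matrix.trace_smul, Finset.smul_sum, smul_smul, smul_eq_mul]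
  exact Finset.sum_congr rfl fun _ _ => by congr 1; ring

/-- Both evaluations have the same coefficients in words, and orthogonality lets the traces in
`transport` pick out one coefficient each. `E` is `1` for exchanges and nucleation and a charge
projection for fusion. -/
theorem transport_mul_ev {K M L : ℕ} {c : Config K} {A : Fin K → Op M} {B : Fin K → Op L}
    (hA : StringRel c A) (hB : StringRel c B) (E : Op M) (t : ℂ)
    (horth : ∀ x y, Matrix.trace ((word A x)ᴴ * (E * word A y)) = if x = y then t else 0)
    (p : FreeAlgebra ℂ (Fin K)) :
    transport A B (E * ev A p) = (((2 : ℂ) ^ K)⁻¹ * t) • ev B p := by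
  rw [hA.ev_eq_sum p, hB.ev_eq_sum p, transport]
  simp only [Finset.mul_sum, mul_smul_comm, Matrix.trace_sum, Matrix.trace_smul, horth,
    smul_eq_mul, mul_ite, mul_zero, Finset.sum_ite_eq, Finset.mem_univ, if_true, Finset.smul_sum,
    smul_smul]
  exact Finset.sum_congr rfl fun _ _ => by congr 1; ring

/-! ### The grading by bit vectors -/

/-- `W` shifts the bit vectors of the regular representation by `v`. -/
def Shift {N : ℕ} (v : Fin N → Bool) (W : Op N) : Prop := ∀ a b, W a b ≠ 0 → a = vxor v b

theorem Shift.one {N : ℕ} : Shift (fun _ => false) (1 : Op N) := by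
  intro a b h
  rw [false_vxor]
  by_contra hab
  exact h (Matrix.one_apply_ne hab)

theorem Shift.smul {N : ℕ} {v : Fin N → Bool} {W : Op N} (h : Shift v W) (z : ℂ) :
    Shift v (z • W) := fun a b hab => h a b fun h0 => hab (by simp [h0])

theorem Shift.neg {N : ℕ} {v : Fin N → Bool} {W : Op N} (h : Shift v W) : Shift v (-W) :=
  fun a b hab => h a b fun h0 => hab (by simp [h0])

theorem Shift.mul {N : ℕ} {v w : Fin N → Bool} {V W : Op N} (hV : Shift v V) (hW : Shift w W) :
    Shift (vxor v w) (V * W) := by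
  intro a b hab
  rw [Matrix.mul_apply] at hab
  obtain ⟨d, -, hd⟩ := Finset.exists_ne_zero_of_sum_ne_zero hab
  rw [hV a d (left_ne_zero_of_mul hd), hW d b (right_ne_zero_of_mul hd), vxor_assoc]

theorem Shift.conjTranspose {N : ℕ} {v : Fin N → Bool} {W : Op N} (h : Shift v W) :
    Shift v Wᴴ := by
  intro a b hab
  rw [h b a (by simpa using hab), vxor_cancel_left]

theorem Shift.trace {N : ℕ} {v : Fin N → Bool} {W : Op N} (h : Shift v W)
    (hv : v ≠ fun _ => false) : W.trace = 0 := by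
  refine Finset.sum_eq_zero fun a _ => ?_
  by_contra hne
  apply hv
  have := h a a hne
  rw [← vxor_false v, ← vxor_self a, ← vxor_assoc, ← this]

theorem Shift.stringOp {N : ℕ} (c : Config N) (k : Fin N) : Shift (single k) (stringOp c k) := by
  intro a b hab
  rw [stringOp_apply] at hab
  rw [← toggle_eq_vxor]
  by_contra h
  simp [h] at hab

/-- Degrees add under multiplication, so the degree of a word is the image of its bit vector under
the `𝔽₂`-linear map `y` that sends basis vectors to the degrees of the strings. -/
theorem Shift.word {N K : ℕ} {A : Fin K → Op N} (y : (Fin K → Bool) → (Fin N → Bool))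
    (hy0 : y (fun _ => false) = fun _ => false) (hy : ∀ u v, y (vxor u v) = vxor (y u) (y v))
    (hA : ∀ k, Shift (y (single k)) (A k)) (x : Fin K → Bool) : Shift (y x) (word A x) := by
  -- The induction runs over lists of positions with `x` masked to the list, because `y` takes whole
  -- bit vectors and cannot be restricted to a tail.
  suffices H : ∀ l : List (Fin K), l.Nodup →
      Shift (y fun k => x k && decide (k ∈ l)) (l.map fun k => if x k then A k else 1).prod by
    have := H (List.finRange K) (List.nodup_finRange K)
    simpa [ThreeFermion.word, List.ofFn_eq_map] using this
  intro l hl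
  induction l with
  | nil => simpa [hy0] using Shift.one
  | cons a l ih =>
    rw [List.nodup_cons] at hl
    rw [List.map_cons, List.prod_cons]
    by_cases hx : x a = true
    · have : (fun k => x k && decide (k ∈ a :: l))
          = vxor (single a) (fun k => x k && decide (k ∈ l)) := by
        ext k
        by_cases hk : k = a
        · subst hk; simp [vxor, single, hx, hl.1]
        · simp [vxor, single, hk]
      rw [this, hy, if_pos hx]
      exact (hA a).mul (ih hl.2)
    · have : (fun k => x k && decide (k ∈ a :: l)) = fun k => x k && decide (k ∈ l) := by
        ext k
        by_cases hk : k = a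
        · subst hk; simp [hx]
        · simp [hk]
      rw [this, if_neg hx, one_mul]
      exact ih hl.2

/-! ### The string operators of a configuration -/

theorem stringSign_toggle_of_le {N : ℕ} (c : Config N) {k l : Fin N} (h : k ≤ l)
    (x : Fin N → Bool) : stringSign c k (toggle l x) = stringSign c k x := by
  unfold stringSign
  congr 1
  ext j
  simp only [Finset.mem_filter, Finset.mem_univ, true_and]
  refine and_congr_right fun hj => ?_
  rw [toggle, Function.update_of_ne (hj.trans_le h).ne]

theorem stringSign_sq {N : ℕ} (c : Config N) (k : Fin N) (x : Fin N → Bool) :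
    stringSign c k x * stringSign c k x = 1 := by
  rw [stringSign, ← Finset.prod_mul_distrib]
  exact Finset.prod_eq_one fun _ _ => R_sq _ _

theorem stringSign_toggle_of_lt {N : ℕ} (c : Config N) {j k : Fin N} (h : j < k)
    (x : Fin N → Bool) :
    stringSign c k (toggle j x) = R (fixed (c j)) (fixed (c k)) * stringSign c k x := by
  simp only [stringSign, Finset.prod_filter]
  rw [← Finset.mul_prod_erase _ _ (Finset.mem_univ j),
    ← Finset.mul_prod_erase Finset.univ (fun a => if a < k ∧ x a = true then _ else _)
      (Finset.mem_univ j), ← mul_assoc]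
  congr 1
  · cases hx : x j <;> simp [toggle, h, hx, R_sq]
  · refine Finset.prod_congr rfl fun a ha => ?_
    rw [toggle, Function.update_of_ne (Finset.ne_of_mem_erase ha)]

theorem toggle_comm {N : ℕ} (j k : Fin N) (x : Fin N → Bool) :
    toggle j (toggle k x) = toggle k (toggle j x) := by
  simp only [toggle_eq_vxor, ← vxor_assoc, vxor_comm (single j)]

theorem Op.ext_mulVec {N : ℕ} {V W : Op N} (h : ∀ f, V *ᵥ f = W *ᵥ f) : V = W :=
  Matrix.mulVec_injective (funext h)

/-- The sign of `γ_k` only looks at bits to the left of `k`. For `j < k`, flipping `k` therefore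
leaves the sign of `γ_j` alone, while flipping `j` changes the sign of `γ_k` by the commutation
phase. -/
theorem stringRel_stringOp {N : ℕ} (c : Config N) : StringRel c (stringOp c) where
  sq k := by
    refine Op.ext_mulVec fun f => funext fun x => ?_
    rw [← Matrix.mulVec_mulVec, stringOp_mulVec, stringOp_mulVec, toggle_toggle, ← mul_assoc,
      stringSign_toggle_of_le c le_rfl, stringSign_sq, one_mul, Matrix.one_mulVec]
  comm j k hjk := by
    refine Op.ext_mulVec fun f => funext fun x => ?_
    rw [Matrix.smul_mulVec, Pi.smul_apply, ← Matrix.mulVec_mulVec, stringOp_mulVec,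
      stringOp_mulVec, ← Matrix.mulVec_mulVec, stringOp_mulVec, stringOp_mulVec,
      toggle_comm k j, stringSign_toggle_of_lt c hjk (toggle k x), smul_eq_mul,
      show stringSign c j (toggle j (toggle k x)) = stringSign c j (toggle j x) by
        rw [toggle_comm, stringSign_toggle_of_le c hjk.le]]
    ring

theorem R_star (a b : Fermion) : star (R a b) = R a b := by
  unfold R; split_ifs <;> simp

theorem stringSign_star {N : ℕ} (c : Config N) (k : Fin N) (x : Fin N → Bool) :
    star (stringSign c k x) = stringSign c k x := by
  rw [stringSign, star_prod]
  exact Finset.prod_congr rfl fun _ _ => R_star _ _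

theorem stringOp_conjTranspose {N : ℕ} (c : Config N) (k : Fin N) :
    (stringOp c k)ᴴ = stringOp c k := by
  ext x y
  rw [Matrix.conjTranspose_apply, stringOp_apply, stringOp_apply]
  by_cases h : x = toggle k y
  · rw [if_pos h, if_pos ((eq_toggle_iff k x y).1 h), stringSign_star, h,
      stringSign_toggle_of_le c le_rfl]
  · rw [if_neg h, if_neg fun h' => h ((eq_toggle_iff k x y).2 h'), star_zero]

theorem word_conjTranspose_mul_word {K N : ℕ} {A : Fin K → Op N} (h : ∀ k, (A k)ᴴ * A k = 1)
    (x : Fin K → Bool) : (word A x)ᴴ * word A x = 1 := by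
  have : word A x ∈ Matrix.unitaryGroup (Fin N → Bool) ℂ := by
    refine list_prod_mem fun W hW => ?_
    obtain ⟨k, rfl⟩ := List.mem_ofFn.1 hW
    split_ifs
    · exact (Matrix.mem_unitaryGroup_iff').2 (h k)
    · exact one_mem _
  exact (Matrix.mem_unitaryGroup_iff').1 this

theorem trace_one_op {N : ℕ} : Matrix.trace (1 : Op N) = 2 ^ N := by
  simp [Matrix.trace_one]

/-- Orthogonality of the words in a family of strings that is linearly independent over `𝔽₂`. -/
theorem trace_word_mul_word {K N : ℕ} {A : Fin K → Op N} (h : ∀ k, (A k)ᴴ * A k = 1)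
    (y : (Fin K → Bool) → (Fin N → Bool)) (hy : ∀ x, Shift (y x) (word A x))
    (hinj : Function.Injective y) (x x' : Fin K → Bool) :
    Matrix.trace ((word A x)ᴴ * word A x') = if x = x' then 2 ^ N else 0 := by
  split_ifs with hx
  · rw [← hx, word_conjTranspose_mul_word h, trace_one_op]
  · refine ((hy x).conjTranspose.mul (hy x')).trace fun h0 => hx (hinj ?_)
    rw [← vxor_cancel_left (y x) (y x'), h0, vxor_false]

theorem shift_word_stringOp {N : ℕ} (c : Config N) (x : Fin N → Bool) :
    Shift x (word (stringOp c) x) :=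
  Shift.word id rfl (fun _ _ => rfl) (fun k => Shift.stringOp c k) x

theorem stringOp_unitary {N : ℕ} (c : Config N) (k : Fin N) :
    (stringOp c k)ᴴ * stringOp c k = 1 := by
  rw [stringOp_conjTranspose, (stringRel_stringOp c).sq]

/-- A homogeneous element of the string algebra is a multiple of a word. -/
theorem exists_smul_word_of_shift {N : ℕ} {c : Config N} {p : FreeAlgebra ℂ (Fin N)}
    {v : Fin N → Bool} (h : Shift v (ev (stringOp c) p)) :
    ∃ z : ℂ, ev (stringOp c) p = z • word (stringOp c) v := by
  refine ⟨_, ((stringRel_stringOp c).ev_eq_sum p).trans (Finset.sum_eq_single v ?_ ?_)⟩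
  · intro x _ hx
    by_contra hne
    apply hx
    have := h x (fun _ => false) (fun h0 => hne (by rw [h0, zero_smul]))
    rwa [vxor_false] at this
  · simp

/-! ### Labels of twists -/

theorem fixed_eq_iff (g h : TwoCycle) : fixed g = fixed h ↔ g = h := by
  obtain ⟨_, a, b, hab, rfl⟩ := g
  obtain ⟨_, x, y, hxy, rfl⟩ := h
  refine Iff.trans ?_ Subtype.mk_eq_mk.symm
  simp only [fixed]
  revert a b x y
  decide

/-- Conjugating one transposition of `S₃` by another one gives the third, whose fixed fermion is the
fusion of the other two. -/
theorem fixed_conj_ne (g h : TwoCycle) (hgh : g ≠ h) :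
    fixed (conj g h) ≠ fixed g ∧ fixed (conj g h) ≠ fixed h := by
  obtain ⟨_, a, b, hab, rfl⟩ := g
  obtain ⟨_, x, y, hxy, rfl⟩ := h
  replace hgh : Equiv.swap a b ≠ Equiv.swap x y := fun e => hgh (Subtype.ext e)
  simp only [fixed, conj]
  revert a b x y
  decide

theorem conj_self (g : TwoCycle) : conj g g = g := Subtype.ext (by simp [conj])

theorem conj_conj (g h : TwoCycle) : conj g (conj g h) = h := by
  obtain ⟨_, a, b, hab, rfl⟩ := g
  refine Subtype.ext ?_
  simp [conj, mul_assoc]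

theorem conj_ne_right {g h : TwoCycle} (hgh : g ≠ h) : conj g h ≠ h := fun e =>
  (fixed_conj_ne g h hgh).2 (by rw [e])

theorem conj_ne_left {g h : TwoCycle} (hgh : g ≠ h) : conj g h ≠ g := fun e =>
  (fixed_conj_ne g h hgh).1 (by rw [e])

/-- Three distinct elements of `ℤ/3` are in ascending or descending cyclic order, and `R` only sees
which of the two it is. This yields the commutation phase between an unchanged string and the fused
string after an exchange. -/
theorem R_rotate {a b e : Fermion} (h₁ : a ≠ b) (h₂ : a ≠ e) (h₃ : b ≠ e) :
    R b e = R a b ∧ R e a = R a b := by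
  fin_cases a <;> fin_cases b <;> fin_cases e <;> simp_all [R, Fin.ext_iff]

theorem sqrtR_rotate {a b e : Fermion} (h₁ : a ≠ b) (h₂ : a ≠ e) (h₃ : b ≠ e) :
    sqrtR b e = sqrtR a b ∧ sqrtR e a = sqrtR a b := by
  fin_cases a <;> fin_cases b <;> fin_cases e <;> simp_all [sqrtR, Fin.ext_iff]

theorem sqrtR_mul_self (a b : Fermion) : sqrtR a b * sqrtR a b = R a b := by
  rw [← sq, sqrtR_sq]

theorem sqrtR_mul_sqrtR_mul_R (a b : Fermion) : sqrtR a b * (sqrtR a b * R a b) = 1 := by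
  rw [← mul_assoc, sqrtR_mul_self, R_sq]

theorem star_sqrtR_mul (a b : Fermion) : star (sqrtR a b) * sqrtR a b = 1 := by
  unfold sqrtR; split_ifs <;> simp

/-! ### Pairs of strings -/

section Pair
variable {N : ℕ} {c : Config N}

theorem stringOp_comm {j k : Fin N} (h : j < k) :
    stringOp c j * stringOp c k = R (fixed (c j)) (fixed (c k)) • (stringOp c k * stringOp c j) :=
  (stringRel_stringOp c).comm j k h

theorem stringOp_comm' {j k : Fin N} (h : j < k) :
    stringOp c k * stringOp c j = R (fixed (c j)) (fixed (c k)) • (stringOp c j * stringOp c k) := by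
  rw [stringOp_comm h, smul_smul, R_sq, one_smul]

theorem stringOp_sq (k : Fin N) : stringOp c k * stringOp c k = 1 := (stringRel_stringOp c).sq k

theorem stringOp_sq_left (k : Fin N) (W : Op N) : stringOp c k * (stringOp c k * W) = W := by
  rw [← mul_assoc, stringOp_sq, one_mul]

theorem stringOp_comm_left {j k : Fin N} (h : j < k) (W : Op N) :
    stringOp c k * (stringOp c j * W) =
      R (fixed (c j)) (fixed (c k)) • (stringOp c j * (stringOp c k * W)) := by
  rw [← mul_assoc, stringOp_comm' h, smul_mul_assoc, mul_assoc]

theorem pairOp_sq {i j : Fin N} (h : i < j) : pairOp c i j * pairOp c i j = 1 := by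
  simp only [pairOp, smul_mul_assoc, mul_smul_comm, smul_smul, mul_assoc, stringOp_comm_left h,
    stringOp_sq_left, stringOp_sq]
  rw [sqrtR_mul_sqrtR_mul_R, one_smul]

theorem pairOp_unitary {i j : Fin N} : (pairOp c i j)ᴴ * pairOp c i j = 1 := by
  simp only [pairOp, Matrix.conjTranspose_smul, Matrix.conjTranspose_mul, stringOp_conjTranspose,
    smul_mul_assoc, mul_smul_comm, smul_smul, mul_assoc, stringOp_sq_left, stringOp_sq]
  rw [mul_comm, star_sqrtR_mul, one_smul]

theorem pairOp_conjTranspose {i j : Fin N} (h : i < j) : (pairOp c i j)ᴴ = pairOp c i j :=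
  calc (pairOp c i j)ᴴ = (pairOp c i j)ᴴ * (pairOp c i j * pairOp c i j) := by
        rw [pairOp_sq h, mul_one]
    _ = pairOp c i j := by rw [← mul_assoc, pairOp_unitary, one_mul]

theorem shift_pairOp {i j : Fin N} : Shift (vxor (single i) (single j)) (pairOp c i j) :=
  ((Shift.stringOp c i).mul (Shift.stringOp c j)).smul _

/-- The phases of the two strings multiply. They cancel if the strings have equal type; otherwise
`R_fusion` makes the product the phase of the third fermion. -/
theorem stringOp_pairOp_of_lt {m i j : Fin N} (hi : m < i) (hj : m < j) :
    stringOp c m * pairOp c i j = (R (fixed (c m)) (fixed (c i)) * R (fixed (c m)) (fixed (c j))) •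
      (pairOp c i j * stringOp c m) := by
  simp only [pairOp, smul_mul_assoc, mul_smul_comm, mul_assoc, stringOp_comm' hj,
    stringOp_comm_left hi, smul_smul]
  congr 1
  linear_combination (-sqrtR (fixed (c i)) (fixed (c j))) * R_sq (fixed (c m)) (fixed (c i))
    - sqrtR (fixed (c i)) (fixed (c j)) * R (fixed (c m)) (fixed (c i)) *
      R (fixed (c m)) (fixed (c i)) * R_sq (fixed (c m)) (fixed (c j))

theorem pairOp_stringOp_of_lt {m i j : Fin N} (hi : i < m) (hj : j < m) :
    pairOp c i j * stringOp c m = (R (fixed (c i)) (fixed (c m)) * R (fixed (c j)) (fixed (c m))) •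
      (stringOp c m * pairOp c i j) := by
  simp only [pairOp, smul_mul_assoc, mul_smul_comm, mul_assoc, stringOp_comm' hj,
    stringOp_comm_left hi, smul_smul]
  congr 1
  linear_combination (-sqrtR (fixed (c i)) (fixed (c j))) * R_sq (fixed (c i)) (fixed (c m))
    - sqrtR (fixed (c i)) (fixed (c j)) * R (fixed (c i)) (fixed (c m)) *
      R (fixed (c i)) (fixed (c m)) * R_sq (fixed (c j)) (fixed (c m))

theorem stringOp_right_pairOp {i j : Fin N} (h : i < j) :
    stringOp c j * pairOp c i j = R (fixed (c i)) (fixed (c j)) • (pairOp c i j * stringOp c j) := by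
  simp only [pairOp, smul_mul_assoc, mul_smul_comm, mul_assoc, stringOp_comm_left h, smul_smul,
    stringOp_sq, mul_comm]

theorem pairOp_stringOp_left {i j : Fin N} (h : i < j) :
    pairOp c i j * stringOp c i = R (fixed (c i)) (fixed (c j)) • (stringOp c i * pairOp c i j) := by
  simp only [pairOp, smul_mul_assoc, mul_smul_comm, mul_assoc, stringOp_comm' h, smul_smul,
    mul_comm]

end Pair

/-! ### Exchanges -/

section Exchange
variable {N : ℕ}

/-- The left one of the two exchanged positions. -/
def leftPos (i : ℕ) (hi : i + 1 < N) : Fin N := ⟨i, by omega⟩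

/-- The right one of the two exchanged positions. -/
def rightPos (i : ℕ) (hi : i + 1 < N) : Fin N := ⟨i + 1, hi⟩

variable (c : Config N) (i : ℕ) (hi : i + 1 < N) (s : Bool)

theorem leftPos_lt_rightPos {i : ℕ} {hi : i + 1 < N} : leftPos i hi < rightPos i hi := by
  simp [leftPos, rightPos, Fin.lt_def]

theorem rightPos_ne_leftPos {i : ℕ} {hi : i + 1 < N} : rightPos i hi ≠ leftPos i hi := leftPos_lt_rightPos.ne'

theorem lt_leftPos_or {i : ℕ} {hi : i + 1 < N} {k : Fin N} (hl : k ≠ leftPos i hi) (hr : k ≠ rightPos i hi) :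
    (k < leftPos i hi ∧ k < rightPos i hi) ∨ (leftPos i hi < k ∧ rightPos i hi < k) := by
  simp only [leftPos, rightPos, Fin.lt_def, Ne, Fin.ext_iff] at *
  omega

theorem exchangeConfig_apply (k : Fin N) : exchangeConfig c i hi s k =
    if k = leftPos i hi then
      (if s then c (rightPos i hi) else conj (c (leftPos i hi)) (c (rightPos i hi)))
    else if k = rightPos i hi then
      (if s then conj (c (rightPos i hi)) (c (leftPos i hi)) else c (leftPos i hi))
    else c k := rfl

theorem exchangeString_apply (k : Fin N) : exchangeString c i hi s k =
    if k = leftPos i hi then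
      (if s then stringOp c (rightPos i hi) else if c (leftPos i hi) = c (rightPos i hi) then
        -stringOp c (rightPos i hi) else pairOp c (leftPos i hi) (rightPos i hi))
    else if k = rightPos i hi then
      (if s then (if c (leftPos i hi) = c (rightPos i hi) then -stringOp c (leftPos i hi)
        else pairOp c (leftPos i hi) (rightPos i hi)) else stringOp c (leftPos i hi))
    else stringOp c k := rfl

theorem exchangeConfig_exchangeConfig :
    exchangeConfig (exchangeConfig c i hi s) i hi (!s) = c := by
  ext1 k
  have := rightPos_ne_leftPos (i := i) (hi := hi)
  cases s <;> simp only [exchangeConfig_apply, this, if_true, if_false, Bool.not_true,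
    Bool.not_false, Bool.false_eq_true, conj_conj] <;> split_ifs <;> simp_all

/-- Sufficient conditions for the relations of the strings after an exchange. -/
theorem stringRel_of_exchange {c c' : Config N} {A : Fin N → Op N}
    (hc : ∀ k, k ≠ leftPos i hi → k ≠ rightPos i hi → c' k = c k ∧ A k = stringOp c k)
    (hsq : ∀ k, A k * A k = 1)
    (hlr : A (leftPos i hi) * A (rightPos i hi) = R (fixed (c' (leftPos i hi)))
      (fixed (c' (rightPos i hi))) • (A (rightPos i hi) * A (leftPos i hi)))
    (hlt : ∀ k, k = leftPos i hi ∨ k = rightPos i hi → ∀ m, m < leftPos i hi → m < rightPos i hi →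
      stringOp c m * A k = R (fixed (c m)) (fixed (c' k)) • (A k * stringOp c m))
    (hgt : ∀ k, k = leftPos i hi ∨ k = rightPos i hi → ∀ m, leftPos i hi < m → rightPos i hi < m →
      A k * stringOp c m = R (fixed (c' k)) (fixed (c m)) • (stringOp c m * A k)) :
    StringRel c' A where
  sq := hsq
  comm j k hjk := by
    by_cases hj : j = leftPos i hi ∨ j = rightPos i hi
    · by_cases hk : k = leftPos i hi ∨ k = rightPos i hi
      · have hlr' := leftPos_lt_rightPos (i := i) (hi := hi)
        rcases hj with rfl | rfl <;> rcases hk with rfl | rfl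
        · exact absurd hjk (lt_irrefl _)
        · exact hlr
        · exact absurd hjk hlr'.asymm
        · exact absurd hjk (lt_irrefl _)
      · rw [not_or] at hk
        rw [(hc k hk.1 hk.2).1, (hc k hk.1 hk.2).2]
        rcases lt_leftPos_or hk.1 hk.2 with h | h
        · rcases hj with rfl | rfl
          · exact absurd hjk h.1.asymm
          · exact absurd hjk h.2.asymm
        · exact hgt j hj k h.1 h.2
    · rw [not_or] at hj
      rw [(hc j hj.1 hj.2).1, (hc j hj.1 hj.2).2]
      by_cases hk : k = leftPos i hi ∨ k = rightPos i hi
      · rcases lt_leftPos_or hj.1 hj.2 with h | h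
        · exact hlt k hk j h.1 h.2
        · rcases hk with rfl | rfl
          · exact absurd hjk h.1.asymm
          · exact absurd hjk h.2.asymm
      · rw [not_or] at hk
        rw [(hc k hk.1 hk.2).1, (hc k hk.1 hk.2).2]
        exact stringOp_comm hjk

/-- For equal types the strings are swapped up to sign and still anticommute. For different types
the fused string carries the fermion of the conjugated label: `R_fusion` gives its phases with
outside strings, and `R_rotate` its phase with the string that stayed straight. -/
theorem stringRel_exchange : StringRel (exchangeConfig c i hi s) (exchangeString c i hi s) := by
  have hrl := rightPos_ne_leftPos (i := i) (hi := hi)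
  have hlr := leftPos_lt_rightPos (i := i) (hi := hi)
  by_cases heq : c (leftPos i hi) = c (rightPos i hi)
  · cases s
    · refine stringRel_of_exchange i hi (c := c) ?_ ?_ ?_ ?_ ?_
      · intro k hl hr; simp [exchangeConfig_apply, exchangeString_apply, hl, hr]
      · intro k; rw [exchangeString_apply]; split_ifs <;> simp_all [stringOp_sq]
      · simp [exchangeConfig_apply, exchangeString_apply, heq, conj_self, hrl, stringOp_comm' hlr]
      · rintro k (rfl | rfl) m h1 h2
        · simp [exchangeConfig_apply, exchangeString_apply, heq, conj_self, stringOp_comm h2]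
        · simp [exchangeConfig_apply, exchangeString_apply, heq, hrl, stringOp_comm h1]
      · rintro k (rfl | rfl) m h1 h2
        · simp [exchangeConfig_apply, exchangeString_apply, heq, conj_self, stringOp_comm h2]
        · simp [exchangeConfig_apply, exchangeString_apply, heq, hrl, stringOp_comm h1]
    · refine stringRel_of_exchange i hi (c := c) ?_ ?_ ?_ ?_ ?_
      · intro k hl hr; simp [exchangeConfig_apply, exchangeString_apply, hl, hr]
      · intro k; rw [exchangeString_apply]; split_ifs <;> simp_all [stringOp_sq]
      · simp [exchangeConfig_apply, exchangeString_apply, heq, conj_self, hrl, stringOp_comm' hlr]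
      · rintro k (rfl | rfl) m h1 h2
        · simp [exchangeConfig_apply, exchangeString_apply, stringOp_comm h2]
        · simp [exchangeConfig_apply, exchangeString_apply, heq, hrl, conj_self, stringOp_comm h1]
      · rintro k (rfl | rfl) m h1 h2
        · simp [exchangeConfig_apply, exchangeString_apply, stringOp_comm h2]
        · simp [exchangeConfig_apply, exchangeString_apply, heq, hrl, conj_self, stringOp_comm h1]
  · have hf : fixed (c (leftPos i hi)) ≠ fixed (c (rightPos i hi)) := by
      rwa [Ne, fixed_eq_iff]
    cases s
    · obtain ⟨h1, h2⟩ := fixed_conj_ne _ _ heq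
      refine stringRel_of_exchange i hi (c := c) ?_ ?_ ?_ ?_ ?_
      · intro k hl hr; simp [exchangeConfig_apply, exchangeString_apply, hl, hr]
      · intro k; rw [exchangeString_apply]; split_ifs <;> simp_all [stringOp_sq, pairOp_sq hlr]
      · simp [exchangeConfig_apply, exchangeString_apply, heq, hrl, pairOp_stringOp_left hlr,
          (R_rotate hf h1.symm h2.symm).2]
      · rintro k (rfl | rfl) m h3 h4
        · simp [exchangeConfig_apply, exchangeString_apply, heq, stringOp_pairOp_of_lt h3 h4,
            R_fusion _ _ _ _ hf h1.symm h2.symm]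
        · simp [exchangeConfig_apply, exchangeString_apply, hrl, stringOp_comm h3]
      · rintro k (rfl | rfl) m h3 h4
        · simp [exchangeConfig_apply, exchangeString_apply, heq, pairOp_stringOp_of_lt h3 h4,
            R_fusion _ _ _ _ hf h1.symm h2.symm]
        · simp [exchangeConfig_apply, exchangeString_apply, hrl, stringOp_comm h3]
    · obtain ⟨h1, h2⟩ := fixed_conj_ne _ _ (Ne.symm heq)
      refine stringRel_of_exchange i hi (c := c) ?_ ?_ ?_ ?_ ?_
      · intro k hl hr; simp [exchangeConfig_apply, exchangeString_apply, hl, hr]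
      · intro k; rw [exchangeString_apply]; split_ifs <;> simp_all [stringOp_sq, pairOp_sq hlr]
      · simp [exchangeConfig_apply, exchangeString_apply, heq, hrl, stringOp_right_pairOp hlr,
          (R_rotate hf h2.symm h1.symm).1]
      · rintro k (rfl | rfl) m h3 h4
        · simp [exchangeConfig_apply, exchangeString_apply, stringOp_comm h4]
        · simp [exchangeConfig_apply, exchangeString_apply, hrl, heq, stringOp_pairOp_of_lt h3 h4,
            R_fusion _ _ _ _ hf h2.symm h1.symm]
      · rintro k (rfl | rfl) m h3 h4
        · simp [exchangeConfig_apply, exchangeString_apply, stringOp_comm h4]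
        · simp [exchangeConfig_apply, exchangeString_apply, hrl, heq, pairOp_stringOp_of_lt h3 h4,
            R_fusion _ _ _ _ hf h2.symm h1.symm]

/-- The bit vector, before the exchange, of a word in the strings after the exchange. -/
def exchangeBits (x : Fin N → Bool) : Fin N → Bool := fun k =>
  let d := decide (c (leftPos i hi) ≠ c (rightPos i hi))
  if k = leftPos i hi then
    (if s then x (rightPos i hi) else xor (x (rightPos i hi)) (d && x (leftPos i hi)))
  else if k = rightPos i hi then
    (if s then xor (x (leftPos i hi)) (d && x (rightPos i hi)) else x (leftPos i hi))
  else x k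

theorem shift_exchangeString (k : Fin N) :
    Shift (exchangeBits c i hi s (single k)) (exchangeString c i hi s k) := by
  have hrl := rightPos_ne_leftPos (i := i) (hi := hi)
  have key : ∀ {v w : Fin N → Bool} {W : Op N}, Shift v W → v = w → Shift w W :=
    fun h e => e ▸ h
  rw [exchangeString_apply]
  split_ifs with h1 h2 h3 h4 h5 h6
  · refine key (Shift.stringOp c _) (funext fun j => ?_)
    by_cases hjl : j = leftPos i hi <;> by_cases hjr : j = rightPos i hi <;>
      simp_all [exchangeBits, single]
  · refine key (Shift.stringOp c _).neg (funext fun j => ?_)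
    by_cases hjl : j = leftPos i hi <;> by_cases hjr : j = rightPos i hi <;>
      simp_all [exchangeBits, single]
  · refine key shift_pairOp (funext fun j => ?_)
    by_cases hjl : j = leftPos i hi <;> by_cases hjr : j = rightPos i hi <;>
      simp_all [exchangeBits, single, vxor]
  · refine key (Shift.stringOp c _).neg (funext fun j => ?_)
    by_cases hjl : j = leftPos i hi <;> by_cases hjr : j = rightPos i hi <;>
      simp_all [exchangeBits, single, hrl.symm]
  · refine key shift_pairOp (funext fun j => ?_)
    by_cases hjl : j = leftPos i hi <;> by_cases hjr : j = rightPos i hi <;>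
      simp_all [exchangeBits, single, vxor, hrl.symm]
  · refine key (Shift.stringOp c _) (funext fun j => ?_)
    by_cases hjl : j = leftPos i hi <;> by_cases hjr : j = rightPos i hi <;>
      simp_all [exchangeBits, single, hrl.symm]
  · refine key (Shift.stringOp c _) (funext fun j => ?_)
    by_cases hjl : j = leftPos i hi <;> by_cases hjr : j = rightPos i hi <;>
      simp_all [exchangeBits, single, Ne.symm h1, Ne.symm h4]

theorem shift_word_exchangeString (x : Fin N → Bool) :
    Shift (exchangeBits c i hi s x) (word (exchangeString c i hi s) x) := by
  refine Shift.word (exchangeBits c i hi s) ?_ ?_ (shift_exchangeString c i hi s) x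
  · ext j; simp [exchangeBits]
  · intro u v
    ext j
    simp only [exchangeBits, vxor]
    generalize decide (c (leftPos i hi) ≠ c (rightPos i hi)) = d
    generalize u (leftPos i hi) = a, u (rightPos i hi) = b, v (leftPos i hi) = a',
      v (rightPos i hi) = b'
    split_ifs <;> first | rfl | (revert d a b a' b'; decide)

/-- On the two exchanged bits the map is a swap, for different types combined with a transvection.
Its injectivity makes the words in the new strings orthogonal, as the transport of states requires.
-/
theorem exchangeBits_injective : Function.Injective (exchangeBits c i hi s) := by
  intro x y h
  have hrl := rightPos_ne_leftPos (i := i) (hi := hi)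
  have hl := congrFun h (leftPos i hi)
  have hr := congrFun h (rightPos i hi)
  simp only [exchangeBits, hrl, if_true, if_false] at hl hr
  have hlr : x (leftPos i hi) = y (leftPos i hi) ∧ x (rightPos i hi) = y (rightPos i hi) := by
    clear h
    revert hl hr
    generalize decide (c (leftPos i hi) ≠ c (rightPos i hi)) = d
    generalize x (leftPos i hi) = a, x (rightPos i hi) = b, y (leftPos i hi) = a',
      y (rightPos i hi) = b'
    revert d a b a' b' s
    decide
  ext j
  by_cases hjl : j = leftPos i hi
  · rw [hjl, hlr.1]
  by_cases hjr : j = rightPos i hi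
  · rw [hjr, hlr.2]
  simpa [exchangeBits, hjl, hjr] using congrFun h j

theorem exchangeString_unitary (k : Fin N) :
    (exchangeString c i hi s k)ᴴ * exchangeString c i hi s k = 1 := by
  rw [exchangeString_apply]
  split_ifs <;> simp [stringOp_unitary, pairOp_unitary]

/-- The strings after an exchange as polynomials in the strings before it. -/
def exchangePoly (k : Fin N) : FreeAlgebra ℂ (Fin N) :=
  let l := FreeAlgebra.ι ℂ (leftPos i hi)
  let r := FreeAlgebra.ι ℂ (rightPos i hi)
  let q := sqrtR (fixed (c (leftPos i hi))) (fixed (c (rightPos i hi))) • (l * r)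
  if k = leftPos i hi then
    (if s then r else if c (leftPos i hi) = c (rightPos i hi) then -r else q)
  else if k = rightPos i hi then
    (if s then (if c (leftPos i hi) = c (rightPos i hi) then -l else q) else l)
  else FreeAlgebra.ι ℂ k

theorem ev_exchangePoly (k : Fin N) :
    ev (stringOp c) (exchangePoly c i hi s k) = exchangeString c i hi s k := by
  rw [exchangeString_apply, exchangePoly]
  split_ifs <;> simp [pairOp]

/-- The opposite braid undoes the exchange. For different types, the two square roots of `R` that
accumulate are equal by `sqrtR_rotate` and cancel against the reordering phase. -/
theorem ev_exchangePoly_exchangeConfig (k : Fin N) :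
    ev (exchangeString c i hi s) (exchangePoly (exchangeConfig c i hi s) i hi (!s) k)
      = stringOp c k := by
  have hrl := rightPos_ne_leftPos (i := i) (hi := hi)
  have hlr := leftPos_lt_rightPos (i := i) (hi := hi)
  by_cases hl : k = leftPos i hi
  · subst hl
    by_cases heq : c (leftPos i hi) = c (rightPos i hi)
    · cases s <;> simp [exchangePoly, exchangeString_apply, exchangeConfig_apply, hrl, heq,
        conj_self]
    · have hf : fixed (c (leftPos i hi)) ≠ fixed (c (rightPos i hi)) := by
        rwa [Ne, fixed_eq_iff]
      obtain ⟨h1, h2⟩ := fixed_conj_ne _ _ (Ne.symm heq)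
      cases s
      · simp [exchangePoly, exchangeString_apply, hrl]
      · simp [exchangePoly, exchangeString_apply, exchangeConfig_apply, hrl, heq,
          (conj_ne_left (Ne.symm heq)).symm, (sqrtR_rotate hf h2.symm h1.symm).1, pairOp, smul_smul,
          sqrtR_mul_sqrtR_mul_R, stringOp_comm_left hlr, stringOp_sq]
  by_cases hr : k = rightPos i hi
  · subst hr
    by_cases heq : c (leftPos i hi) = c (rightPos i hi)
    · cases s <;> simp [exchangePoly, exchangeString_apply, exchangeConfig_apply, hrl, heq,
        conj_self]
    · have hf : fixed (c (leftPos i hi)) ≠ fixed (c (rightPos i hi)) := by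
        rwa [Ne, fixed_eq_iff]
      obtain ⟨h1, h2⟩ := fixed_conj_ne _ _ heq
      cases s
      · simp [exchangePoly, exchangeString_apply, exchangeConfig_apply, hrl, heq,
          conj_ne_left heq, (sqrtR_rotate hf h1.symm h2.symm).2, pairOp, smul_smul,
          sqrtR_mul_sqrtR_mul_R, stringOp_comm' hlr, stringOp_sq_left, mul_assoc]
      · simp [exchangePoly, exchangeString_apply, hrl]
  simp [exchangePoly, exchangeString_apply, hl, hr]

theorem ev_lift {K L M : ℕ} (A : Fin L → Op M) (f : Fin K → FreeAlgebra ℂ (Fin L))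
    (p : FreeAlgebra ℂ (Fin K)) :
    ev A (FreeAlgebra.lift ℂ f p) = ev (fun k => ev A (f k)) p := by
  have : (ev A).comp (FreeAlgebra.lift ℂ f) = ev (fun k => ev A (f k)) := by
    ext k; simp
  exact DFunLike.congr_fun this p

/-- Each old string is a polynomial in the new ones, and orthogonality of words lets transport carry
over this polynomial unchanged. Exchanges thus act as substitution homomorphisms, and later
arguments no longer need the expectation values. -/
theorem exchangeMap_ev (p : FreeAlgebra ℂ (Fin N)) :
    exchangeMap c i hi s (ev (stringOp c) p) = ev (stringOp (exchangeConfig c i hi s))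
      (FreeAlgebra.lift ℂ (exchangePoly (exchangeConfig c i hi s) i hi (!s)) p) := by
  have h : ev (stringOp c) p = 1 * ev (exchangeString c i hi s)
      (FreeAlgebra.lift ℂ (exchangePoly (exchangeConfig c i hi s) i hi (!s)) p) := by
    rw [ev_lift, one_mul]
    simp only [ev_exchangePoly_exchangeConfig]
  rw [exchangeMap, h, transport_mul_ev (stringRel_exchange c i hi s)
    (stringRel_stringOp _) 1 (2 ^ N)]
  · simp
  · intro x y
    rw [one_mul]
    exact trace_word_mul_word (exchangeString_unitary c i hi s) _
      (shift_word_exchangeString c i hi s) (exchangeBits_injective c i hi s) x y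

end Exchange

/-- An identity verified in the regular representation holds for every family with the same
relations, since the expansion in words is the same. -/
theorem StringRel.ev_congr {K M : ℕ} {c : Config K} {A : Fin K → Op M} (h : StringRel c A)
    {p q : FreeAlgebra ℂ (Fin K)} (hpq : ev (stringOp c) p = ev (stringOp c) q) :
    ev A p = ev A q := by
  rw [h.ev_eq_sum, h.ev_eq_sum q, hpq]

/-! ### Insertion and removal of pairs -/

section Skip
variable {N : ℕ} (i : Fin (N + 1))

theorem skip_val (k : Fin N) : (skip i k : ℕ) = if (k : ℕ) < i then (k : ℕ) else k + 2 := by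
  simp only [skip, Fin.succAbove, Fin.lt_def, Fin.val_castSucc]
  split_ifs <;> simp_all <;> omega

theorem skip_strictMono : StrictMono (skip i) := by
  intro j k h
  rw [Fin.lt_def, skip_val, skip_val]
  rw [Fin.lt_def] at h
  split_ifs <;> omega

theorem castSucc_lt_succ' : i.castSucc < i.succ := by simp

theorem skip_lt_or (k : Fin N) :
    (skip i k < i.castSucc ∧ skip i k < i.succ) ∨ (i.castSucc < skip i k ∧ i.succ < skip i k) := by
  simp only [Fin.lt_def, skip_val, Fin.val_castSucc, Fin.val_succ]
  split_ifs <;> omega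

theorem skip_ne_castSucc (k : Fin N) : skip i k ≠ i.castSucc := by
  rcases skip_lt_or i k with h | h
  · exact h.1.ne
  · exact h.1.ne'

theorem skip_ne_succ (k : Fin N) : skip i k ≠ i.succ := by
  rcases skip_lt_or i k with h | h
  · exact h.2.ne
  · exact h.2.ne'

theorem eq_skip_or (j : Fin (N + 2)) : j = i.castSucc ∨ j = i.succ ∨ ∃ k, j = skip i k := by
  rcases Fin.eq_self_or_eq_succAbove i.castSucc j with h | ⟨j, rfl⟩
  · exact Or.inl h
  · rcases Fin.eq_self_or_eq_succAbove i j with rfl | ⟨k, rfl⟩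
    · right; left; simp
    · right; right; exact ⟨k, rfl⟩

variable {α : Type*}

/-- Insert two equal entries at the positions `i` and `i + 1`. -/
def insertTwo (x : Fin N → α) (a : α) : Fin (N + 2) → α :=
  i.castSucc.insertNth (α := fun _ => α) a (i.insertNth (α := fun _ => α) a x)

theorem insertTwo_castSucc (x : Fin N → α) (a : α) : insertTwo i x a i.castSucc = a := by
  simp [insertTwo]

theorem insertTwo_succ (x : Fin N → α) (a : α) : insertTwo i x a i.succ = a := by
  have : i.succ = i.castSucc.succAbove i := by simp
  rw [insertTwo, this, Fin.insertNth_apply_succAbove, Fin.insertNth_apply_same]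

theorem insertTwo_skip (x : Fin N → α) (a : α) (k : Fin N) : insertTwo i x a (skip i k) = x k := by
  simp [insertTwo, skip]

theorem insertPair_eq (c : Config N) (g : TwoCycle) : insertPair c i g = insertTwo i c g := rfl

theorem removePair_insertPair (c : Config N) (g : TwoCycle) :
    removePair (insertPair c i g) i = c := by
  ext1 k; exact insertTwo_skip i c g k

theorem insertPair_removePair (d : Config (N + 2)) (h : d i.castSucc = d i.succ) :
    insertPair (removePair d i) i (d i.castSucc) = d := by
  ext1 j
  rw [insertPair_eq]
  rcases eq_skip_or i j with rfl | rfl | ⟨k, rfl⟩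
  · rw [insertTwo_castSucc]
  · rw [insertTwo_succ, h]
  · rw [insertTwo_skip, removePair]

theorem prod_insertTwo {β : Type*} [CommMonoid β] (f : Fin (N + 2) → β) :
    ∏ j, f j = f i.castSucc * (f i.succ * ∏ k, f (skip i k)) := by
  rw [Fin.prod_univ_succAbove f i.castSucc, Fin.prod_univ_succAbove _ i]
  simp [skip]

/-- The polynomial algebra of all strings except for those at `i` and `i + 1`. -/
def skipPoly : FreeAlgebra ℂ (Fin N) →ₐ[ℂ] FreeAlgebra ℂ (Fin (N + 2)) :=
  FreeAlgebra.lift ℂ fun k => FreeAlgebra.ι ℂ (skip i k)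

theorem ev_skipPoly {M : ℕ} (A : Fin (N + 2) → Op M) (p : FreeAlgebra ℂ (Fin N)) :
    ev A (skipPoly i p) = ev (fun k => A (skip i k)) p := by
  rw [skipPoly, ev_lift]; simp

variable (d : Config (N + 2))

theorem stringRel_skip : StringRel (removePair d i) (fun k => stringOp d (skip i k)) where
  sq _ := stringOp_sq _
  comm _ _ h := stringOp_comm (skip_strictMono i h)

theorem ev_skipPoly_congr {p q : FreeAlgebra ℂ (Fin N)}
    (h : ev (stringOp (removePair d i)) p = ev (stringOp (removePair d i)) q) :
    ev (stringOp d) (skipPoly i p) = ev (stringOp d) (skipPoly i q) := by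
  rw [ev_skipPoly, ev_skipPoly]
  exact (stringRel_skip i d).ev_congr h

theorem shift_word_skip (x : Fin N → Bool) :
    Shift (insertTwo i x false) (word (fun k => stringOp d (skip i k)) x) := by
  refine Shift.word (fun x => insertTwo i x false) ?_ ?_ (fun k => ?_) x
  · ext j
    rcases eq_skip_or i j with rfl | rfl | ⟨k, rfl⟩ <;>
      simp [insertTwo_castSucc, insertTwo_succ, insertTwo_skip]
  · intro u v
    ext j
    rcases eq_skip_or i j with rfl | rfl | ⟨k, rfl⟩ <;>
      simp [insertTwo_castSucc, insertTwo_succ, insertTwo_skip, vxor]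
  · have : insertTwo i (single k) false = single (skip i k) := by
      ext j
      rcases eq_skip_or i j with rfl | rfl | ⟨l, rfl⟩
      · simp [insertTwo_castSucc, single, (skip_ne_castSucc i k).symm]
      · simp [insertTwo_succ, single, (skip_ne_succ i k).symm]
      · simp [insertTwo_skip, single, (skip_strictMono i).injective.eq_iff]
    rw [this]
    exact Shift.stringOp d _

theorem insertTwo_injective (a : α) :
    Function.Injective fun x : Fin N → α => insertTwo i x a := by
  intro x y h
  ext k
  simpa [insertTwo_skip] using congrFun h (skip i k)

/-- The pair operator has a non-zero bit at `i` that no word in the remaining strings can cancel, so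
only the summand `1 / 2` of the projection has a trace: half of `2 ^ (N + 2)`. -/
theorem trace_skip_chargeProj (q : Bool) (x y : Fin N → Bool) :
    Matrix.trace ((word (fun k => stringOp d (skip i k)) x)ᴴ *
      (chargeProj d i.castSucc i.succ q * word (fun k => stringOp d (skip i k)) y))
      = if x = y then 2 ^ (N + 1) else 0 := by
  have h0 : Matrix.trace ((word (fun k => stringOp d (skip i k)) x)ᴴ *
      (pairOp d i.castSucc i.succ * word (fun k => stringOp d (skip i k)) y)) = 0 := by
    refine ((shift_word_skip i d x).conjTranspose.mul
      (shift_pairOp.mul (shift_word_skip i d y))).trace fun h => ?_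
    have := congrFun h i.castSucc
    simp [vxor, insertTwo_castSucc, single] at this
    exact (castSucc_lt_succ' i).ne this
  have h1 := trace_word_mul_word (fun k => stringOp_unitary d (skip i k)) _
    (shift_word_skip i d) (insertTwo_injective i false) x y
  simp only [chargeProj, smul_mul_assoc, add_mul, one_mul, mul_smul_comm, mul_add,
    Matrix.trace_smul, Matrix.trace_add, h0, h1]
  split_ifs <;> simp <;> ring

variable {d}

theorem stringOp_skip_comm_pairOp (h : d i.castSucc = d i.succ) (k : Fin N) :
    Commute (pairOp d i.castSucc i.succ) (stringOp d (skip i k)) := by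
  rcases skip_lt_or i k with hk | hk
  · have := stringOp_pairOp_of_lt (c := d) hk.1 hk.2
    rw [h, R_sq, one_smul] at this
    exact this.symm
  · have := pairOp_stringOp_of_lt (c := d) hk.1 hk.2
    rw [h, R_sq, one_smul] at this
    exact this

theorem ev_skipPoly_comm {W : Op (N + 2)} (hW : ∀ k, Commute W (stringOp d (skip i k)))
    (p : FreeAlgebra ℂ (Fin N)) : Commute W (ev (stringOp d) (skipPoly i p)) := by
  rw [ev_skipPoly]
  induction p using FreeAlgebra.induction with
  | grade0 r => rw [AlgHom.commutes]; exact (Algebra.commutes r W).symm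
  | grade1 k => simpa using hW k
  | mul p q hp hq => rw [map_mul]; exact hp.mul_right hq
  | add p q hp hq => rw [map_add]; exact hp.add_right hq

theorem commute_chargeProj {M : ℕ} {c : Config M} {j k : Fin M} {W : Op M}
    (h : Commute (pairOp c j k) W) (q : Bool) : Commute (chargeProj c j k q) W :=
  ((Commute.one_left W).add_left (h.smul_left _)).smul_left _

theorem chargeProj_mul_chargeProj {M : ℕ} {c : Config M} {j k : Fin M} (h : j < k) (q q' : Bool) :
    chargeProj c j k q * chargeProj c j k q' = if q = q' then chargeProj c j k q else 0 := by
  have := pairOp_sq (c := c) h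
  cases q <;> cases q' <;>
    simp only [chargeProj, add_mul, mul_add, one_mul, mul_one, smul_mul_assoc,
      mul_smul_comm, this, if_true, if_false, Bool.false_eq_true, reduceCtorEq] <;>
    module

theorem chargeProj_comm_skip (h : d i.castSucc = d i.succ) (q : Bool)
    (p : FreeAlgebra ℂ (Fin N)) :
    Commute (chargeProj d i.castSucc i.succ q) (ev (stringOp d) (skipPoly i p)) :=
  ev_skipPoly_comm i (fun k => commute_chargeProj (stringOp_skip_comm_pairOp i h k) q) p

/-- The projection commutes with the remaining strings and is orthogonal to that of the other
charge. The factor `2` is the ratio of the trace `2 ^ (N + 1)` to the normalization `2 ^ N`; it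
compensates the `1 / 2` of nucleation. -/
theorem fuseMap_chargeProj (h : d i.castSucc = d i.succ) (q q' : Bool)
    (p : FreeAlgebra ℂ (Fin N)) :
    fuseMap d i q (chargeProj d i.castSucc i.succ q' * ev (stringOp d) (skipPoly i p))
      = if q = q' then (2 : ℂ) • ev (stringOp (removePair d i)) p else 0 := by
  have h1 : chargeProj d i.castSucc i.succ q *
      (chargeProj d i.castSucc i.succ q' * ev (stringOp d) (skipPoly i p)) *
      chargeProj d i.castSucc i.succ q = if q = q' then chargeProj d i.castSucc i.succ q *
        ev (fun k => stringOp d (skip i k)) p else 0 := by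
    rw [mul_assoc, mul_assoc, ← (chargeProj_comm_skip i h q p).eq, ← mul_assoc, ← mul_assoc,
      chargeProj_mul_chargeProj (castSucc_lt_succ' i)]
    split_ifs with hq
    · rw [chargeProj_mul_chargeProj (castSucc_lt_succ' i), if_pos rfl, ev_skipPoly]
    · rw [zero_mul, zero_mul]
  rw [fuseMap, h1]
  split_ifs with hq
  · rw [transport_mul_ev (stringRel_skip i d) (stringRel_stringOp _) _ (2 ^ (N + 1))
      (trace_skip_chargeProj i d q)]
    congr 1
    field_simp
    ring
  · simp [transport]

theorem nucleateMap_ev {c : Config N} {g : TwoCycle} (hd : insertPair c i g = d)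
    (p : FreeAlgebra ℂ (Fin N)) :
    nucleateMap c i g (ev (stringOp c) p) = (1 / 2 : ℂ) •
      (chargeProj d i.castSucc i.succ false * ev (stringOp d) (skipPoly i p)) := by
  subst hd
  have h : StringRel c fun k => stringOp (insertPair c i g) (skip i k) := by
    have := stringRel_skip i (insertPair c i g)
    rwa [removePair_insertPair] at this
  rw [nucleateMap, ev_skipPoly, ← one_mul (ev (stringOp c) p),
    transport_mul_ev (stringRel_stringOp c) h 1 (2 ^ N)]
  · simp
  · intro x y
    rw [one_mul]
    exact trace_word_mul_word (stringOp_unitary c) id (shift_word_stringOp c) (fun _ _ h => h) x y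

end Skip

/-! ### Protocols -/

theorem exchangeMap_add {N : ℕ} (c : Config N) (i : ℕ) (hi : i + 1 < N) (s : Bool) (ρ σ : Op N) :
    exchangeMap c i hi s (ρ + σ) = exchangeMap c i hi s ρ + exchangeMap c i hi s σ :=
  transport_add _ _ _ _

theorem nucleateMap_add {N : ℕ} (c : Config N) (i : Fin (N + 1)) (g : TwoCycle) (ρ σ : Op N) :
    nucleateMap c i g (ρ + σ) = nucleateMap c i g ρ + nucleateMap c i g σ := by
  simp [nucleateMap, transport_add, mul_add]

theorem fuseMap_add {N : ℕ} (c : Config (N + 2)) (i : Fin (N + 1)) (q : Bool) (ρ σ : Op (N + 2)) :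
    fuseMap c i q (ρ + σ) = fuseMap c i q ρ + fuseMap c i q σ := by
  simp [fuseMap, transport_add, mul_add, add_mul]

theorem fuseMap_smul {N : ℕ} (c : Config (N + 2)) (i : Fin (N + 1)) (q : Bool) (z : ℂ)
    (ρ : Op (N + 2)) : fuseMap c i q (z • ρ) = z • fuseMap c i q ρ := by
  simp [fuseMap, transport_smul]

namespace Protocol
variable {S : Set TwoCycle}

/-- Run two protocols one after the other. -/
def bind {L M : ℕ} {e : Config L} {d : Config M} :
    {N : ℕ} → {c : Config N} → Protocol S d c → Protocol S e d → Protocol S e c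
  | _, _, .done, Q => Q
  | _, _, .exchange i hi s next, Q => .exchange i hi s (next.bind Q)
  | _, _, .nucleate i g hg next, Q => .nucleate i g hg (next.bind Q)
  | _, _, .fuse i hi next, Q => .fuse i hi fun q => (next q).bind Q

theorem run_bind {L M N : ℕ} {e : Config L} {d : Config M} {c : Config N} (P : Protocol S d c)
    (Q : Protocol S e d) (ρ : Op N) : (P.bind Q).run ρ =
      (P.run ρ).flatMap fun b => (Q.run b.2).map fun b' => (b.1 ++ b'.1, b'.2) := by
  induction P with
  | done => simp [bind, run]
  | exchange i hi s next ih => simp [bind, run, ih]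
  | nucleate i g hg next ih => simp [bind, run, ih]
  | fuse i hi next ih =>
    simp [bind, run, ih, List.flatMap_map, List.map_flatMap, Function.comp_def]

/-- The sum of the unnormalized states over all branches of a protocol. -/
def total {M N : ℕ} {d : Config M} {c : Config N} (P : Protocol S d c) (ρ : Op N) : Op M :=
  ((P.run ρ).map Prod.snd).sum

theorem total_done {M : ℕ} {d : Config M} (ρ : Op M) : (done : Protocol S d d).total ρ = ρ := by
  simp [total, run]

theorem total_fuse {M N : ℕ} {d : Config M} {c : Config (N + 2)} (i : Fin (N + 1))
    (hi : c i.castSucc = c i.succ) (next : Bool → Protocol S d (removePair c i)) (ρ : Op (N + 2)) :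
    (fuse i hi next).total ρ = (next false).total (fuseMap c i false ρ) +
      (next true).total (fuseMap c i true ρ) := by
  simp [total, run, Function.comp_def]

theorem total_add {M N : ℕ} {d : Config M} {c : Config N} (P : Protocol S d c) (ρ σ : Op N) :
    P.total (ρ + σ) = P.total ρ + P.total σ := by
  induction P with
  | done => simp [total_done]
  | exchange i hi s next ih =>
    exact (congrArg next.total (exchangeMap_add _ _ _ _ _ _)).trans (ih _ _)
  | nucleate i g hg next ih =>
    exact (congrArg next.total (nucleateMap_add _ _ _ _ _)).trans (ih _ _)
  | fuse i hi next ih =>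
    rw [total_fuse, total_fuse, total_fuse, fuseMap_add, fuseMap_add, ih, ih]
    abel

/-- By additivity the second protocol may be applied to the sum over the branches of the first, so
intermediate outcomes can be forgotten. -/
theorem total_bind {L M N : ℕ} {e : Config L} {d : Config M} {c : Config N} (P : Protocol S d c)
    (Q : Protocol S e d) (ρ : Op N) : (P.bind Q).total ρ = Q.total (P.total ρ) := by
  induction P with
  | done => rw [total_done]; rfl
  | exchange i hi s next ih => exact ih _
  | nucleate i g hg next ih => exact ih _
  | fuse i hi next ih =>
    rw [total_fuse, total_add, ← ih, ← ih]
    exact total_fuse i hi _ ρ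

end Protocol

/-! ### Rotations generated by strings -/

/-- Conjugation with `exp(-iπw/4)`, for `w² = 1`. -/
def rotate {A : Type*} [Ring A] [Algebra ℂ A] (w p : A) : A :=
  (1 / 2 : ℂ) • ((1 - Complex.I • w) * p * (1 + Complex.I • w))

theorem map_rotate {A B : Type*} [Ring A] [Algebra ℂ A] [Ring B] [Algebra ℂ B] (f : A →ₐ[ℂ] B)
    (w p : A) : f (rotate w p) = rotate (f w) (f p) := by
  simp [rotate]

/-- The rotation generated by `w` can be implemented on the twists `c`. -/
def Rotatable (S : Set TwoCycle) {N : ℕ} (c : Config N) (w : FreeAlgebra ℂ (Fin N)) : Prop :=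
  ∃ P : Protocol S c c, ∀ p,
    P.total (ev (stringOp c) p) = rotate (ev (stringOp c) w) (ev (stringOp c) p)

/-- The rotations generated by the involutions in the degree `x` can be implemented. -/
def DegreeRotatable (S : Set TwoCycle) {N : ℕ} (c : Config N) (x : Fin N → Bool) : Prop :=
  ∀ w, Shift x (ev (stringOp c) w) → ev (stringOp c) w * ev (stringOp c) w = 1 → Rotatable S c w

variable {S : Set TwoCycle}

theorem exists_exchange {N : ℕ} {c c' : Config N} {i : ℕ} {hi : i + 1 < N} {s : Bool}
    (h : exchangeConfig c i hi s = c') : ∃ P : Protocol S c' c, ∀ p, P.total (ev (stringOp c) p) =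
      ev (stringOp c') (FreeAlgebra.lift ℂ (exchangePoly c' i hi (!s)) p) := by
  subst h
  refine ⟨.exchange i hi s .done, fun p => ?_⟩
  rw [← exchangeMap_ev]
  exact Protocol.total_done _

theorem exists_nucleate {N : ℕ} {d : Config (N + 2)} {i : Fin (N + 1)}
    (h : d i.castSucc = d i.succ) (hS : d i.castSucc ∈ S) :
    ∃ P : Protocol S d (removePair d i), ∀ p, P.total (ev (stringOp (removePair d i)) p) =
      (1 / 2 : ℂ) • (chargeProj d i.castSucc i.succ false * ev (stringOp d) (skipPoly i p)) := by
  have H : ∀ c g, g ∈ S → insertPair c i g = d → ∃ P : Protocol S d c, ∀ p,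
      P.total (ev (stringOp c) p) =
      (1 / 2 : ℂ) • (chargeProj d i.castSucc i.succ false * ev (stringOp d) (skipPoly i p)) := by
    intro c g hg hd
    subst hd
    exact ⟨.nucleate i g hg .done, fun p => by
      rw [← nucleateMap_ev i rfl]; exact Protocol.total_done _⟩
  exact H _ _ hS (insertPair_removePair i d h)

theorem ev_exchange_cancel {N : ℕ} (c : Config N) (i : ℕ) (hi : i + 1 < N) (s : Bool)
    (p : FreeAlgebra ℂ (Fin N)) :
    ev (stringOp c) (FreeAlgebra.lift ℂ (exchangePoly c i hi s)
      (FreeAlgebra.lift ℂ (exchangePoly (exchangeConfig c i hi s) i hi (!s)) p))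
      = ev (stringOp c) p := by
  rw [ev_lift, show (fun k => ev (stringOp c) (exchangePoly c i hi s k)) = exchangeString c i hi s
    from funext (ev_exchangePoly c i hi s), ev_lift]
  simp only [ev_exchangePoly_exchangeConfig]

theorem ev_exchange_cancel' {N : ℕ} (c : Config N) (i : ℕ) (hi : i + 1 < N) (s : Bool)
    (p : FreeAlgebra ℂ (Fin N)) :
    ev (stringOp (exchangeConfig c i hi s))
      (FreeAlgebra.lift ℂ (exchangePoly (exchangeConfig c i hi s) i hi (!s))
        (FreeAlgebra.lift ℂ (exchangePoly c i hi s) p))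
      = ev (stringOp (exchangeConfig c i hi s)) p := by
  have := ev_exchange_cancel (exchangeConfig c i hi s) i hi (!s) p
  rwa [exchangeConfig_exchangeConfig, Bool.not_not] at this

theorem ev_exchange_congr {N : ℕ} (c : Config N) (i : ℕ) (hi : i + 1 < N) (s : Bool)
    {p q : FreeAlgebra ℂ (Fin N)} (h : ev (stringOp c) p = ev (stringOp c) q) :
    ev (stringOp (exchangeConfig c i hi s))
      (FreeAlgebra.lift ℂ (exchangePoly (exchangeConfig c i hi s) i hi (!s)) p) =
    ev (stringOp (exchangeConfig c i hi s))
      (FreeAlgebra.lift ℂ (exchangePoly (exchangeConfig c i hi s) i hi (!s)) q) := by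
  rw [← exchangeMap_ev, ← exchangeMap_ev, h]

/-- Exchange, rotate, exchange back: since the exchange is an algebra homomorphism, it carries the
rotation generated by `w` to the one generated by the image of `w`. -/
theorem Rotatable.of_exchange {N : ℕ} {c : Config N} {i : ℕ} {hi : i + 1 < N}
    {w : FreeAlgebra ℂ (Fin N)} (h : Rotatable S (exchangeConfig c i hi true)
      (FreeAlgebra.lift ℂ (exchangePoly (exchangeConfig c i hi true) i hi false) w)) :
    Rotatable S c w := by
  obtain ⟨P, hP⟩ := h
  obtain ⟨P₁, h₁⟩ := exists_exchange (S := S) (c := c) (i := i) (hi := hi) (s := true) rfl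
  obtain ⟨P₂, h₂⟩ := exists_exchange (S := S) (exchangeConfig_exchangeConfig c i hi true)
  refine ⟨P₁.bind (P.bind P₂), fun p => ?_⟩
  rw [Protocol.total_bind, Protocol.total_bind, h₁, hP]
  simp only [Bool.not_true]
  rw [← map_rotate, ← map_rotate, h₂]
  exact ((ev_exchange_cancel c i hi true (rotate w p))).trans (map_rotate _ _ _)

/-- Homogeneous unitary elements of the string algebra of the same degree are proportional. -/
theorem exists_smul_of_shift {N : ℕ} {c : Config N} {x : Fin N → Bool}
    {p q : FreeAlgebra ℂ (Fin N)} (hp : Shift x (ev (stringOp c) p))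
    (hq : Shift x (ev (stringOp c) q)) (hq1 : (ev (stringOp c) q)ᴴ * ev (stringOp c) q = 1) :
    ∃ z : ℂ, ev (stringOp c) p = z • ev (stringOp c) q := by
  obtain ⟨z, hz⟩ := exists_smul_word_of_shift hp
  obtain ⟨z', hz'⟩ := exists_smul_word_of_shift hq
  have h0 : z' ≠ 0 := by
    rintro rfl
    rw [hz', zero_smul, mul_zero] at hq1
    exact zero_ne_one hq1
  exact ⟨z / z', by rw [hz', smul_smul, div_mul_cancel₀ _ h0, hz]⟩

/-- Homogeneous parts of the string algebra are one-dimensional, so `w` is a multiple of the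
exchanged word of `x`, and its image is the same multiple of the word of `x` itself. -/
theorem DegreeRotatable.of_exchange {N : ℕ} {c : Config N} {i : ℕ} {hi : i + 1 < N}
    {x : Fin N → Bool} (h : DegreeRotatable S (exchangeConfig c i hi true) x) :
    DegreeRotatable S c (exchangeBits c i hi true x) := by
  intro w hw hw1
  refine Rotatable.of_exchange (h _ ?_ ?_)
  · have hA : ev (stringOp c) (FreeAlgebra.lift ℂ (exchangePoly c i hi true) (freeWord x))
        = word (exchangeString c i hi true) x := by
      rw [ev_lift, ← ev_freeWord]
      simp only [ev_exchangePoly]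
    obtain ⟨z, hz⟩ := exists_smul_of_shift hw (hA ▸ shift_word_exchangeString c i hi true x)
      (hA ▸ word_conjTranspose_mul_word (exchangeString_unitary c i hi true) x)
    rw [← map_smul] at hz
    have := ev_exchange_congr c i hi true hz
    rw [map_smul, map_smul, ev_exchange_cancel', ev_freeWord] at this
    exact this ▸ (shift_word_stringOp _ x).smul z
  · rw [← map_mul] at hw1
    rw [← map_mul, ← map_mul]
    have := ev_exchange_congr c i hi true (hw1.trans (map_one _).symm)
    simpa using this

/-- A scalar involution generates only a phase, which conjugation does not see; doing nothing is
enough. -/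
theorem DegreeRotatable.zero {N : ℕ} (c : Config N) : DegreeRotatable S c fun _ => false := by
  intro w hw hw1
  refine ⟨.done, fun p => ?_⟩
  obtain ⟨z, hz⟩ := exists_smul_word_of_shift hw
  rw [word_false] at hz
  rw [hz, smul_mul_smul_comm, one_mul] at hw1
  rw [Protocol.total_done, rotate, hz]
  calc ev (stringOp c) p = (1 / 2 : ℂ) • (ev (stringOp c) p + (z * z) • (1 : Op N) *
        ev (stringOp c) p) := by rw [hw1, one_mul, ← two_smul ℂ, smul_smul]; norm_num
    _ = _ := by
      simp only [sub_mul, mul_add, one_mul, mul_one, smul_mul_assoc, mul_smul_comm, smul_smul]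
      rw [show ∀ a : Op N, (1 / 2 : ℂ) • (a + (z * z) • a)
        = (1 / 2 : ℂ) • (a - (Complex.I * z) • a + ((Complex.I * z) • a -
          (Complex.I * z * (Complex.I * z)) • a)) from fun a => by
          rw [show Complex.I * z * (Complex.I * z) = -(z * z) by
            linear_combination z * z * Complex.I_mul_I]
          module]
      congr 2
      module

/-- The extra pair is nucleated, the rotation is performed in its presence, and the pair is fused.
As the generator commutes with the charge of the pair, the outcome `ψ` has the zero state, and no
correction is needed. -/
theorem DegreeRotatable.of_insertTwo {N : ℕ} {c : Config N} {x : Fin N → Bool} (i : Fin (N + 1))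
    {g : TwoCycle} (hg : g ∈ S)
    (h : DegreeRotatable S (insertPair c i g) (insertTwo i x false)) : DegreeRotatable S c x := by
  obtain ⟨d, hd⟩ : ∃ d, insertPair c i g = d := ⟨_, rfl⟩
  have hc : removePair d i = c := by rw [← hd, removePair_insertPair]
  have hl : d i.castSucc = g := by rw [← hd]; exact insertTwo_castSucc i c g
  have hr : d i.succ = g := by rw [← hd]; exact insertTwo_succ i c g
  have heq : d i.castSucc = d i.succ := hl.trans hr.symm
  rw [hd] at h
  clear hd hr
  subst hc
  intro w hw hw1
  obtain ⟨P, hP⟩ := h (skipPoly i w)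
    (by
      obtain ⟨z, hz⟩ := exists_smul_word_of_shift hw
      rw [← ev_freeWord, ← map_smul] at hz
      have := ev_skipPoly_congr i d hz
      rw [map_smul, map_smul, ev_skipPoly i _ (freeWord x), ev_freeWord] at this
      exact this ▸ (shift_word_skip i d x).smul z)
    (by
      rw [← map_mul, ← map_one (ev (stringOp (removePair d i)))] at hw1
      rw [← map_mul, ← map_mul, ev_skipPoly_congr i d hw1, map_one, map_one])
  obtain ⟨P₁, h₁⟩ := exists_nucleate (S := S) heq (hl ▸ hg)
  refine ⟨P₁.bind (P.bind (.fuse i heq fun _ => .done)), fun p => ?_⟩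
  have hcomm := chargeProj_comm_skip i heq false w
  -- The projection has to be written as a polynomial in the strings, because the rotation protocol
  -- is only known to act correctly on the string algebra.
  have hform : chargeProj d i.castSucc i.succ false = ev (stringOp d) ((1 / 2 : ℂ) •
      (1 + sqrtR (fixed (d i.castSucc)) (fixed (d i.succ)) •
        (FreeAlgebra.ι ℂ i.castSucc * FreeAlgebra.ι ℂ i.succ))) := by
    simp [chargeProj, pairOp]
  have hrot : rotate (ev (stringOp d) (skipPoly i w)) ((1 / 2 : ℂ) •
      (chargeProj d i.castSucc i.succ false * ev (stringOp d) (skipPoly i p))) =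
      (1 / 2 : ℂ) • (chargeProj d i.castSucc i.succ false *
        ev (stringOp d) (skipPoly i (rotate w p))) := by
    rw [map_rotate, map_rotate, rotate, rotate, mul_smul_comm, mul_smul_comm, smul_mul_assoc]
    congr 2
    simp only [← mul_assoc]
    congr 2
    exact (((Commute.one_right _).sub_right (hcomm.smul_right _)).symm).eq
  rw [Protocol.total_bind, Protocol.total_bind, h₁, hform, ← map_mul, ← map_smul, hP, map_smul,
    map_mul, ← hform, hrot, Protocol.total_fuse, Protocol.total_done, Protocol.total_done,
    fuseMap_smul, fuseMap_smul, fuseMap_chargeProj i heq, fuseMap_chargeProj i heq, map_rotate]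
  simp [smul_smul]

/-- Exchanging two Majorana strings is conjugation with `(1 ± γ_l γ_r)/√2`, the quarter turn about
their product. -/
theorem DegreeRotatable.pair {N : ℕ} {c : Config N} {i : ℕ} {hi : i + 1 < N}
    (h : c (leftPos i hi) = c (rightPos i hi)) :
    DegreeRotatable S c (vxor (single (leftPos i hi)) (single (rightPos i hi))) := by
  intro w hw hw1
  have hlr := leftPos_lt_rightPos (i := i) (hi := hi)
  have hrl := rightPos_ne_leftPos (i := i) (hi := hi)
  set l := leftPos i hi with hl
  set r := rightPos i hi with hr
  obtain ⟨z, hz⟩ := exists_smul_of_shift (q := FreeAlgebra.ι ℂ l * FreeAlgebra.ι ℂ r) hw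
    (by simpa using (Shift.stringOp c l).mul (Shift.stringOp c r))
    (by simp [stringOp_conjTranspose, mul_assoc, stringOp_sq_left, stringOp_sq])
  simp only [map_mul, ev_ι] at hz
  have hanti : stringOp c r * stringOp c l = -(stringOp c l * stringOp c r) := by
    rw [stringOp_comm' hlr, h, R_self, neg_one_smul]
  have hanti' : ∀ W : Op N, stringOp c r * (stringOp c l * W) =
      -(stringOp c l * (stringOp c r * W)) := fun W => by
    rw [← mul_assoc, hanti, neg_mul, mul_assoc]
  -- The product of two anticommuting involutions squares to `-1`, so an involution proportional to
  -- it has the coefficient `±i`.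
  have hzz : z * z = -1 := by
    rw [hz] at hw1
    simp only [smul_mul_smul_comm, mul_assoc, hanti', mul_neg, stringOp_sq_left, stringOp_sq] at hw1
    have := congrFun (congrFun hw1 fun _ => false) fun _ => false
    simp at this
    linear_combination -this
  -- The sign of the generator selects the handedness of the braid.
  obtain ⟨s, hs⟩ : ∃ s : Bool, -(Complex.I * z) = if s then 1 else -1 := by
    have : (-(Complex.I * z) - 1) * (-(Complex.I * z) + 1) = 0 := by
      linear_combination z * z * Complex.I_mul_I - hzz
    rcases mul_eq_zero.1 this with h1 | h1
    · exact ⟨true, by simpa using sub_eq_zero.1 h1⟩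
    · exact ⟨false, by simpa using eq_neg_of_add_eq_zero_left h1⟩
  have hc : exchangeConfig c i hi s = c := by
    ext1 k
    rw [exchangeConfig_apply, ← hl, ← hr]
    split_ifs with h1 h2 h3 h4 <;> simp_all [conj_self]
  obtain ⟨P, hP⟩ := exists_exchange (S := S) hc
  refine ⟨P, fun p => ?_⟩
  have hU : (1 : Op N) - Complex.I • ev (stringOp c) w =
      1 + (if s then 1 else -1 : ℂ) • (stringOp c l * stringOp c r) := by
    rw [hz, ← hs, smul_smul, neg_smul, sub_eq_add_neg]
  -- It suffices to check on generators that `1 - iw` intertwines the identity with the exchange;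
  -- dividing by it turns this into the conjugation.
  have key : ∀ p, (1 - Complex.I • ev (stringOp c) w) * ev (stringOp c) p =
      ev (stringOp c) (FreeAlgebra.lift ℂ (exchangePoly c i hi (!s)) p) *
        (1 - Complex.I • ev (stringOp c) w) := by
    intro p
    rw [hU]
    induction p using FreeAlgebra.induction with
    | grade0 a =>
      simp only [AlgHom.commutes]
      exact (Algebra.commutes a _).symm
    | grade1 k =>
      rw [ev_ι, FreeAlgebra.lift_ι_apply, ev_exchangePoly, exchangeString_apply, ← hl, ← hr]
      by_cases hkl : k = l
      · subst hkl
        cases s <;> simp [h, add_mul, mul_add, mul_assoc, hanti, hanti', stringOp_sq_left,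
          stringOp_sq]
        all_goals abel
      by_cases hkr : k = r
      · rw [hkr]
        cases s <;> simp [h, hrl, add_mul, mul_add, mul_assoc, stringOp_sq_left,
          stringOp_sq]
        all_goals abel
      rw [if_neg hkl, if_neg hkr]
      have : Commute (stringOp c l * stringOp c r) (stringOp c k) := by
        have hp : Commute (pairOp c l r) (stringOp c k) := by
          rcases lt_leftPos_or hkl hkr with hk | hk
          · have := stringOp_pairOp_of_lt (c := c) hk.1 hk.2
            rw [← hl, ← hr, h, R_sq, one_smul] at this
            exact this.symm
          · have := pairOp_stringOp_of_lt (c := c) hk.1 hk.2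
            rw [← hl, ← hr, h, R_sq, one_smul] at this
            exact this
        have h2 : stringOp c l * stringOp c r =
            star (sqrtR (fixed (c l)) (fixed (c r))) • pairOp c l r := by
          rw [pairOp, smul_smul, star_sqrtR_mul, one_smul]
        rw [h2]
        exact hp.smul_left _
      exact (((Commute.one_left _).add_left (this.smul_left _))).eq
    | mul p q hp hq =>
      rw [map_mul, ← mul_assoc, hp, mul_assoc, hq, map_mul, map_mul, mul_assoc]
    | add p q hp hq => rw [map_add, mul_add, hp, hq, map_add, map_add, add_mul]
  rw [hP, rotate, key, mul_assoc, show (1 - Complex.I • ev (stringOp c) w) *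
    (1 + Complex.I • ev (stringOp c) w) = (2 : ℂ) • 1 from ?_, mul_smul_comm, mul_one, smul_smul]
  · norm_num
  · simp only [sub_mul, mul_add, one_mul, mul_one, smul_mul_assoc, mul_smul_comm, hw1]
    linear_combination (norm := module) (-Complex.I_mul_I) • (1 : Op N)

/-! ### Reduction of neutral strings to pairs of neighbours -/

/-- The fermions carried by the strings with `x k = true` fuse to the vacuum. -/
def Neutral {N : ℕ} (c : Config N) (x : Fin N → Bool) : Prop :=
  ∀ b, ∏ k, (if x k then R (fixed (c k)) b else 1) = 1

theorem Neutral.vxor {N : ℕ} {c : Config N} {x y : Fin N → Bool} (hx : Neutral c x)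
    (hy : Neutral c y) : Neutral c (vxor x y) := by
  intro b
  refine Eq.trans ?_ ((congrArg₂ (· * ·) (hx b) (hy b)).trans (mul_one 1))
  simp only [← Finset.prod_mul_distrib]
  refine Finset.prod_congr rfl fun k _ => ?_
  unfold ThreeFermion.vxor
  cases x k <;> cases y k <;> simp [R_sq]

theorem neutral_false {N : ℕ} (c : Config N) : Neutral c fun _ => false := by
  intro b; simp

theorem neutral_pair {N : ℕ} {c : Config N} {j k : Fin N} (h : c j = c k) :
    Neutral c (vxor (single j) (single k)) := by
  intro b
  by_cases hjk : j = k
  · subst hjk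
    rw [vxor_self]
    exact neutral_false c b
  rw [← Finset.mul_prod_erase _ _ (Finset.mem_univ j),
    ← Finset.mul_prod_erase _ _ (Finset.mem_erase.2 ⟨Ne.symm hjk, Finset.mem_univ k⟩),
    Finset.prod_eq_one]
  · simp [vxor, single, hjk, Ne.symm hjk, h, R_sq]
  · intro m hm
    simp only [Finset.mem_erase, Finset.mem_univ, and_true] at hm
    simp [vxor, single, hm.1, hm.2]

/-- A single fermion is detected by its own exchange phase `-1`. -/
theorem not_neutral_single {N : ℕ} (c : Config N) (k : Fin N) : ¬ Neutral c (single k) := by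
  intro h
  have := h (fixed (c k))
  rw [Finset.prod_eq_single k (fun m _ hm => by simp [single, hm]) (by simp)] at this
  simp only [single, decide_true, if_true, R_self] at this
  norm_num at this

theorem Neutral.insertTwo {N : ℕ} {c : Config N} {x : Fin N → Bool} (hx : Neutral c x)
    (i : Fin (N + 1)) (g : TwoCycle) : Neutral (insertPair c i g) (insertTwo i x false) := by
  intro b
  rw [prod_insertTwo i]
  simpa [insertPair_eq, insertTwo_castSucc, insertTwo_succ, insertTwo_skip] using hx b

/-- The bit vector, after the exchange, of a word in the strings before the exchange. -/
def exchangeBitsInv {N : ℕ} (c : Config N) (i : ℕ) (hi : i + 1 < N) (x : Fin N → Bool) :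
    Fin N → Bool := fun k =>
  if k = leftPos i hi then
    xor (x (rightPos i hi))
      (decide (c (leftPos i hi) ≠ c (rightPos i hi)) && x (leftPos i hi))
  else if k = rightPos i hi then x (leftPos i hi)
  else x k

theorem exchangeBits_exchangeBitsInv {N : ℕ} (c : Config N) (i : ℕ) (hi : i + 1 < N)
    (x : Fin N → Bool) : exchangeBits c i hi true (exchangeBitsInv c i hi x) = x := by
  have hrl := rightPos_ne_leftPos (i := i) (hi := hi)
  ext k
  by_cases hl : k = leftPos i hi
  · simp [exchangeBits, exchangeBitsInv, hl, hrl]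
  by_cases hr : k = rightPos i hi
  · simp [exchangeBits, exchangeBitsInv, hr, hrl]
  simp [exchangeBits, exchangeBitsInv, hl, hr]

@[to_additive]
theorem mul_prod_of_eq_off_pair {ι β : Type*} [Fintype ι] [DecidableEq ι] [CommMonoid β] {l r : ι}
    (hlr : r ≠ l) {f f' : ι → β} (h : ∀ k, k ≠ l → k ≠ r → f' k = f k) :
    (∏ k, f' k) * (f l * f r) = (∏ k, f k) * (f' l * f' r) := by
  have key : ∀ f : ι → β, ∏ k, f k = f l * (f r * ∏ k ∈ (Finset.univ.erase l).erase r, f k) := by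
    intro f
    rw [← Finset.mul_prod_erase _ _ (Finset.mem_univ l),
      ← Finset.mul_prod_erase _ _ (Finset.mem_erase.2 ⟨hlr, Finset.mem_univ r⟩)]
  rw [key f, key f', Finset.prod_congr rfl fun k hk => ?_]
  · ac_rfl
  · simp only [Finset.mem_erase, Finset.mem_univ, and_true] at hk
    exact h k hk.2 hk.1

variable {S : Set TwoCycle}

/-- This collects all that the reduction needs to know about an exchange. Neutrality survives
because a merged string carries the fusion of its two fermions. The last clause, for arbitrary `f`,
controls both the number of strings and the sum of their positions; it is stated without subtraction
since it lives in `ℕ`. -/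
theorem exists_exchange_step {N : ℕ} {c : Config N} {x : Fin N → Bool} (hx : Neutral c x) (i : ℕ)
    (hi : i + 1 < N) : ∃ (c' : Config N) (x' : Fin N → Bool),
      (DegreeRotatable S c' x' → DegreeRotatable S c x) ∧ Neutral c' x' ∧
      c' (leftPos i hi) = c (rightPos i hi) ∧
      c' (rightPos i hi) = conj (c (rightPos i hi)) (c (leftPos i hi)) ∧
      x' (leftPos i hi) = xor (x (rightPos i hi))
        (decide (c (leftPos i hi) ≠ c (rightPos i hi)) && x (leftPos i hi)) ∧
      x' (rightPos i hi) = x (leftPos i hi) ∧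
      (∀ k, k ≠ leftPos i hi → k ≠ rightPos i hi → c' k = c k ∧ x' k = x k) ∧
      ∀ f : Fin N → ℕ, (∑ k, if x' k then f k else 0) +
        ((if x (leftPos i hi) then f (leftPos i hi) else 0) +
          if x (rightPos i hi) then f (rightPos i hi) else 0) =
        (∑ k, if x k then f k else 0) +
        ((if x' (leftPos i hi) then f (leftPos i hi) else 0) +
          if x' (rightPos i hi) then f (rightPos i hi) else 0) := by
  have hrl := rightPos_ne_leftPos (i := i) (hi := hi)
  have hoff : ∀ k, k ≠ leftPos i hi → k ≠ rightPos i hi →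
      exchangeConfig c i hi true k = c k ∧ exchangeBitsInv c i hi x k = x k := by
    intro k hl hr
    simp [exchangeConfig_apply, exchangeBitsInv, hl, hr]
  refine ⟨exchangeConfig c i hi true, exchangeBitsInv c i hi x, fun h => ?_, fun b => ?_, ?_, ?_,
    ?_, ?_, hoff, fun f => ?_⟩
  · have := h.of_exchange
    rwa [exchangeBits_exchangeBitsInv] at this
  · have key := mul_prod_of_eq_off_pair hrl (f := fun k => if x k then R (fixed (c k)) b else 1)
      (f' := fun k => if exchangeBitsInv c i hi x k then
        R (fixed (exchangeConfig c i hi true k)) b else 1)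
      (fun k hl hr => by rw [(hoff k hl hr).1, (hoff k hl hr).2])
    rw [hx b, one_mul] at key
    simp only [exchangeBitsInv, exchangeConfig_apply, hrl, if_true, if_false] at key ⊢
    set l := leftPos i hi
    set r := rightPos i hi
    have hsq := R_sq (fixed (c l)) b
    have hsq' := R_sq (fixed (c r)) b
    by_cases heq : c l = c r
    · cases hl : x l <;> cases hr : x r <;>
        simp [hl, hr, heq, conj_self, R_sq] at key ⊢
      · exact key
      · exact mul_right_cancel₀ (left_ne_zero_of_mul_eq_one hsq') (key.trans (one_mul _).symm)
      · exact mul_right_cancel₀ (left_ne_zero_of_mul_eq_one hsq') (key.trans (one_mul _).symm)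
      · exact key
    · have hf : fixed (c r) ≠ fixed (c l) := by rw [Ne, fixed_eq_iff]; exact Ne.symm heq
      obtain ⟨h1, h2⟩ := fixed_conj_ne (c r) (c l) (Ne.symm heq)
      have hfus := (R_fusion b _ _ _ hf h1.symm h2.symm).2
      cases hl : x l <;> cases hr : x r <;>
        simp [hl, hr, heq] at key ⊢
      · exact key
      · exact mul_right_cancel₀ (left_ne_zero_of_mul_eq_one hsq') (key.trans (one_mul _).symm)
      · refine mul_right_cancel₀ (left_ne_zero_of_mul_eq_one hsq) (key.trans ?_)
        rw [← hfus, ← mul_assoc, hsq']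
      · refine mul_right_cancel₀ (mul_ne_zero (left_ne_zero_of_mul_eq_one hsq)
          (left_ne_zero_of_mul_eq_one hsq')) (key.trans ?_)
        rw [← hfus]
        ring
  · simp [exchangeConfig_apply]
  · simp [exchangeConfig_apply, hrl]
  · simp [exchangeBitsInv]
  · simp [exchangeBitsInv, hrl]
  · exact add_sum_of_eq_off_pair hrl (f := fun k => if x k then f k else 0)
      (f' := fun k => if exchangeBitsInv c i hi x k then f k else 0)
      (fun k hl hr => by rw [(hoff k hl hr).2])

/-- The number of strings in a word. -/
def weight {N : ℕ} (x : Fin N → Bool) : ℕ := ∑ k, if x k then 1 else 0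

/-- Three neighbouring strings of the same type can be reduced to two strings with the help of a
pair of twists of another type. -/
theorem exists_reduction {N : ℕ} {c : Config N} {x : Fin N → Bool} (hx : Neutral c x) {h : TwoCycle}
    (h0 : 0 < N) (h1 : 1 < N) (h2 : 2 < N) (hx0 : x ⟨0, h0⟩ = true) (hx1 : x ⟨1, h1⟩ = true)
    (hx2 : x ⟨2, h2⟩ = true) (hc1 : c ⟨1, h1⟩ = c ⟨0, h0⟩) (hc2 : c ⟨2, h2⟩ = c ⟨0, h0⟩)
    (hne : c ⟨0, h0⟩ ≠ h) (hS : h ∈ S) : ∃ (c' : Config (N + 2)) (x' : Fin (N + 2) → Bool),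
      (DegreeRotatable S c' x' → DegreeRotatable S c x) ∧ Neutral c' x' ∧
        weight x' < weight x := by
  -- The auxiliary pair goes immediately to the right of the three strings.
  set i : Fin (N + 1) := ⟨3, by omega⟩ with hi
  have s0 : skip i ⟨0, h0⟩ = leftPos (N := N + 2) 0 (by omega) := by
    ext; rw [skip_val]; simp [hi, leftPos]
  have s1 : skip i ⟨1, h1⟩ = leftPos (N := N + 2) 1 (by omega) := by
    ext; rw [skip_val]; simp [hi, leftPos]
  have s2 : skip i ⟨2, h2⟩ = leftPos (N := N + 2) 2 (by omega) := by
    ext; rw [skip_val]; simp [hi, leftPos]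
  have s3 : i.castSucc = rightPos (N := N + 2) 2 (by omega) := by
    ext; simp [hi, rightPos]
  have hw : weight (insertTwo i x false) = weight x := by
    rw [weight, Fin.sum_univ_succAbove _ i.castSucc, Fin.sum_univ_succAbove _ i]
    simp only [insertTwo_castSucc, weight]
    simp only [Fin.succAbove_castSucc_self, insertTwo_succ]
    simp [← skip.eq_1, insertTwo_skip]
  have a0 : insertPair c i h (leftPos 0 (by omega)) = c ⟨0, h0⟩ := by
    rw [← s0]; exact insertTwo_skip _ _ _ _
  have a1 : insertPair c i h (leftPos 1 (by omega)) = c ⟨0, h0⟩ := by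
    rw [← s1, ← hc1]; exact insertTwo_skip _ _ _ _
  have a2 : insertPair c i h (leftPos 2 (by omega)) = c ⟨0, h0⟩ := by
    rw [← s2, ← hc2]; exact insertTwo_skip _ _ _ _
  have a3 : insertPair c i h (rightPos 2 (by omega)) = h := by
    rw [← s3]; exact insertTwo_castSucc _ _ _
  have b0 : insertTwo i x false (leftPos 0 (by omega)) = true := by
    rw [← s0, ← hx0]; exact insertTwo_skip _ _ _ _
  have b1 : insertTwo i x false (leftPos 1 (by omega)) = true := by
    rw [← s1, ← hx1]; exact insertTwo_skip _ _ _ _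
  have b2 : insertTwo i x false (leftPos 2 (by omega)) = true := by
    rw [← s2, ← hx2]; exact insertTwo_skip _ _ _ _
  have b3 : insertTwo i x false (rightPos 2 (by omega)) = false := by
    rw [← s3]; exact insertTwo_castSucc _ _ _
  have hrot := DegreeRotatable.of_insertTwo (c := c) (x := x) i hS
  have hn := hx.insertTwo i h
  rw [← hw]
  generalize insertPair c i h = d at *
  generalize insertTwo i x false = y at *
  generalize c ⟨0, h0⟩ = a at *
  have e01 : rightPos (N := N + 2) 0 (by omega) = leftPos 1 (by omega) := rfl
  have e12 : rightPos (N := N + 2) 1 (by omega) = leftPos 2 (by omega) := rfl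
  -- With `k = conj h a`, the first five twists and their bits evolve as `a a a h h` (11100), `a a h
  -- k h` (11110), `a h k k h` (10110), `a k a k h` (11010), `k h a k h` (01010). The exchanges at
  -- 2, 1, 1, 0 split one string and then merge strings twice; everything further right is
  -- untouched.
  obtain ⟨d₁, y₁, r₁, n₁, cl₁, cr₁, xl₁, xr₁, o₁, w₁⟩ := exists_exchange_step (S := S) hn 2 (by omega)
  obtain ⟨d₂, y₂, r₂, n₂, cl₂, cr₂, xl₂, xr₂, o₂, w₂⟩ := exists_exchange_step (S := S) n₁ 1 (by omega)
  obtain ⟨d₃, y₃, r₃, n₃, cl₃, cr₃, xl₃, xr₃, o₃, w₃⟩ := exists_exchange_step (S := S) n₂ 1 (by omega)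
  obtain ⟨d₄, y₄, r₄, n₄, cl₄, cr₄, xl₄, xr₄, o₄, w₄⟩ := exists_exchange_step (S := S) n₃ 0 (by omega)
  refine ⟨d₄, y₄, fun hd => hrot (r₁ (r₂ (r₃ (r₄ hd)))), n₄, ?_⟩
  have o10 := o₁ (leftPos 0 (by omega)) (by simp [leftPos]) (by simp [leftPos, rightPos])
  have o11 := o₁ (leftPos 1 (by omega)) (by simp [leftPos]) (by simp [leftPos, rightPos])
  have o20 := o₂ (leftPos 0 (by omega)) (by simp [leftPos]) (by simp [leftPos, rightPos])
  have o30 := o₃ (leftPos 0 (by omega)) (by simp [leftPos]) (by simp [leftPos, rightPos])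
  have hk := conj_ne_right hne.symm
  have f₁ : y₁ (leftPos 2 (by omega)) = true := by rw [xl₁, a2, a3, b2, b3]; simp [hne]
  have g₁ : y₁ (rightPos 2 (by omega)) = true := by rw [xr₁, b2]
  rw [a1, b1] at o11
  rw [a0, b0] at o10
  rw [e12, cl₁, a3] at cl₂
  rw [e12, cl₁, a3, o11.1] at cr₂
  rw [e12, cl₁, a3, f₁, o11.1, o11.2] at xl₂
  rw [e12, o11.2] at xr₂
  rw [e12, cr₂] at cl₃
  rw [e12, xr₂, xl₂] at xl₃
  rw [e12, xl₂] at xr₃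
  rw [e01, xl₃, cl₃, o30.1, o20.1, o10.1, o30.2, o20.2, o10.2] at xl₄
  rw [e01, o30.2, o20.2, o10.2] at xr₄
  have v₁ := w₁ fun _ => 1
  have v₂ := w₂ fun _ => 1
  have v₃ := w₃ fun _ => 1
  have v₄ := w₄ fun _ => 1
  rw [b2, b3, f₁, g₁] at v₁
  rw [e12, o11.2, f₁, xl₂, xr₂] at v₂
  rw [e12, xl₂, xr₂, xl₃, xr₃] at v₃
  rw [e01, xl₃, o30.2, o20.2, o10.2, xl₄, xr₄] at v₄
  simp [hne, hk.symm] at v₁ v₂ v₃ v₄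
  simp only [weight]
  simp only [Finset.sum_boole]
  simp only [Nat.cast_id]
  omega

/-- Lexicographic induction on the number of strings and the sum of their positions. The outer
induction must leave the number of twists free, because shortening a run adds twists; the inner one
keeps it fixed. -/
theorem degreeRotatable_of_neutral {g h : TwoCycle} (hgh : g ≠ h) (hg : g ∈ S) (hh : h ∈ S) {N : ℕ}
    (c : Config N) (x : Fin N → Bool) (hx : Neutral c x) : DegreeRotatable S c x := by
  obtain ⟨m, hm⟩ : ∃ m, weight x = m := ⟨_, rfl⟩
  induction m using Nat.strong_induction_on generalizing N c x with
  | _ m ih =>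
  obtain ⟨t, ht⟩ : ∃ t, (∑ k, if x k then (k : ℕ) else 0) = t := ⟨_, rfl⟩
  induction t using Nat.strong_induction_on generalizing c x with
  | _ t ih' =>
  -- A string with a gap on its left moves one place to the left: the number of strings stays, the
  -- sum of positions drops by one.
  by_cases hA : ∃ (i : ℕ) (hi : i + 1 < N), x (leftPos i hi) = false ∧ x (rightPos i hi) = true
  · obtain ⟨i, hi, hl, hr⟩ := hA
    obtain ⟨c', x', hrot, hn, -, -, hl', hr', -, hw⟩ := exists_exchange_step (S := S) hx i hi
    have w1 := hw fun _ => 1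
    have w2 := hw fun k => (k : ℕ)
    simp [hl, hr, hl', hr'] at w1 w2
    refine hrot (ih' _ ?_ c' x' hn ?_ rfl)
    · rw [← ht]
      simp only [leftPos, rightPos] at w2
      omega
    · rw [← hm]
      simpa [weight] using w1
  -- Two neighbouring strings of different types merge into one, so the number of strings drops.
  by_cases hB : ∃ (i : ℕ) (hi : i + 1 < N), x (leftPos i hi) = true ∧ x (rightPos i hi) = true ∧
      c (leftPos i hi) ≠ c (rightPos i hi)
  · obtain ⟨i, hi, hl, hr, hne⟩ := hB
    obtain ⟨c', x', hrot, hn, -, -, hl', hr', -, hw⟩ := exists_exchange_step (S := S) hx i hi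
    have w1 := hw fun _ => 1
    simp [hl, hr, hl', hr', hne] at w1
    refine hrot (ih _ ?_ c' x' hn rfl)
    rw [← hm]
    simp only [weight, Finset.sum_boole, Nat.cast_id]
    omega
  -- Now the strings form an initial segment of a single type. Length 0 is trivial, length 1
  -- contradicts neutrality, length 2 is a neighbouring pair, and longer runs need an auxiliary
  -- pair.
  have hdown : ∀ i (hi : i + 1 < N), x ⟨i, by omega⟩ = false → ∀ j (hj : j < N), i ≤ j →
      x ⟨j, hj⟩ = false := by
    intro i hi h0 j hj hij
    induction j, hij using Nat.le_induction with
    | base => exact h0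
    | succ j hij ihj =>
      by_contra h1
      exact hA ⟨j, hj, ihj (by omega), eq_true_of_ne_false h1⟩
  have heq : ∀ i (hi : i + 1 < N), x ⟨i, by omega⟩ = true → x ⟨i + 1, hi⟩ = true →
      c ⟨i + 1, hi⟩ = c ⟨i, by omega⟩ := by
    intro i hi h0 h1
    by_contra hne
    exact hB ⟨i, hi, h0, h1, fun e => hne e.symm⟩
  have hfalse : ∀ i (hi : i < N), x ⟨i, hi⟩ = false → ∀ j (hj : j < N), i ≤ j →
      x ⟨j, hj⟩ = false := by
    intro i hi h0 j hj hij
    rcases Nat.lt_or_ge (i + 1) N with h | h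
    · exact hdown i h h0 j hj hij
    · obtain rfl : i = j := by omega
      exact h0
  rcases Nat.eq_zero_or_pos N with h0 | h0
  · subst h0
    rw [show x = fun _ => false from funext fun k => k.elim0]
    exact DegreeRotatable.zero c
  cases hx0 : x ⟨0, h0⟩
  · rw [show x = fun _ => false from funext fun k => hfalse 0 h0 hx0 k k.2 (Nat.zero_le _)]
    exact DegreeRotatable.zero c
  by_cases hx1 : ∃ h1 : 1 < N, x ⟨1, h1⟩ = true
  swap
  · refine absurd hx ?_
    rw [show x = single ⟨0, h0⟩ from funext fun k => ?_]
    · exact not_neutral_single c _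
    · by_cases hk : k = ⟨0, h0⟩
      · rw [hk, hx0]; simp [single]
      · have hk1 : 1 ≤ (k : ℕ) := Nat.pos_of_ne_zero fun e => hk (Fin.ext e)
        have h1 : 1 < N := by omega
        rw [show x k = false from hfalse 1 h1 (by simpa using fun e => hx1 ⟨h1, e⟩) k k.2 hk1]
        simp [single, hk]
  obtain ⟨h1, hx1⟩ := hx1
  have hc1 := heq 0 h1 hx0 hx1
  by_cases hx2 : ∃ h2 : 2 < N, x ⟨2, h2⟩ = true
  swap
  · rw [show x = vxor (single (leftPos 0 h1)) (single (rightPos 0 h1)) from funext fun k => ?_]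
    · exact DegreeRotatable.pair hc1.symm
    · by_cases hk : k = leftPos 0 h1
      · rw [hk]
        refine hx0.trans ?_
        simp [vxor, single, leftPos, rightPos]
      by_cases hk' : k = rightPos 0 h1
      · rw [hk']
        refine hx1.trans ?_
        simp [vxor, single, leftPos, rightPos]
      have hk2 : 2 ≤ (k : ℕ) := by
        simp only [leftPos, rightPos, Fin.ext_iff] at hk hk'
        omega
      have h2 : 2 < N := by omega
      rw [show x k = false from hfalse 2 h2 (by simpa using fun e => hx2 ⟨h2, e⟩) k k.2 hk2]
      simp [vxor, single, hk, hk']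
  obtain ⟨h2, hx2⟩ := hx2
  have hc2 := (heq 1 h2 hx1 hx2).trans hc1
  -- Exchanges may have produced a run of the third type, which need not belong to `S`; only the
  -- auxiliary pair is nucleated, and one of `g`, `h` always differs from the run.
  obtain ⟨a, ha, hne⟩ : ∃ a ∈ S, c ⟨0, h0⟩ ≠ a := by
    by_cases e : c ⟨0, h0⟩ = g
    · exact ⟨h, hh, e ▸ hgh⟩
    · exact ⟨g, hg, e⟩
  obtain ⟨c', x', hrot, hn, hw⟩ := exists_reduction (S := S) hx h0 h1 h2 hx0 hx1 hx2 hc1 hc2 hne ha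
  exact hrot (ih _ (hm ▸ hw) c' x' hn rfl)

/-! ### Products of commuting families -/

section ListProd
variable {M : Type*} [Monoid M]

theorem commute_ofFn_prod {n : ℕ} {a : M} {f : Fin n → M} (h : ∀ j, Commute a (f j)) :
    Commute a (List.ofFn f).prod := by
  refine Commute.list_prod_right _ _ fun x hx => ?_
  obtain ⟨j, rfl⟩ := List.mem_ofFn.1 hx
  exact h j

theorem ofFn_prod_mul {n : ℕ} {f g : Fin n → M} (h : ∀ j k, j ≠ k → Commute (f j) (g k)) :
    (List.ofFn f).prod * (List.ofFn g).prod = (List.ofFn fun j => f j * g j).prod := by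
  induction n with
  | zero => simp
  | succ n ih =>
    simp only [List.ofFn_succ, List.prod_cons]
    rw [← ih (f := fun j => f j.succ) (g := fun j => g j.succ)
      (fun j k hjk => h _ _ fun e => hjk (Fin.succ_injective _ e))]
    have : Commute (List.ofFn fun j : Fin n => f j.succ).prod (g 0) :=
      (commute_ofFn_prod fun j => (h j.succ 0 (Fin.succ_ne_zero j)).symm).symm
    rw [mul_assoc, ← mul_assoc _ (g 0), this.eq]
    simp only [mul_assoc]

theorem ofFn_prod_removeNth {n : ℕ} (j : Fin (n + 1)) {f : Fin (n + 1) → M}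
    (h : ∀ k l, k ≠ l → Commute (f k) (f l)) :
    (List.ofFn f).prod = f j * (List.ofFn (j.removeNth f)).prod := by
  induction n with
  | zero =>
    obtain rfl : j = 0 := by ext; omega
    simp
  | succ n ih =>
    refine Fin.cases ?_ (fun j => ?_) j
    · simp only [List.ofFn_succ, List.prod_cons]
      rfl
    · rw [List.ofFn_succ, List.prod_cons, ih j fun k l hkl =>
        h _ _ fun e => hkl (Fin.succ_injective _ e), ← mul_assoc,
        (h 0 j.succ (Fin.succ_ne_zero j).symm).eq, mul_assoc]
      congr 1
      rw [List.ofFn_succ, List.prod_cons]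
      congr 3
      ext k
      simp [Fin.removeNth]

end ListProd

theorem ofFn_prod_smul {n N : ℕ} (z : Fin n → ℂ) (f : Fin n → Op N) :
    (List.ofFn fun j => z j • f j).prod = (∏ j, z j) • (List.ofFn f).prod := by
  induction n with
  | zero => simp
  | succ n ih =>
    simp only [List.ofFn_succ, List.prod_cons]
    rw [ih, Fin.prod_univ_succ, smul_mul_smul_comm]

theorem ofFn_prod_conjTranspose {n N : ℕ} {f : Fin n → Op N}
    (h : ∀ j k, j ≠ k → Commute (f j) (f k)) :
    (List.ofFn f).prodᴴ = (List.ofFn fun j => (f j)ᴴ).prod := by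
  induction n with
  | zero => simp
  | succ n ih =>
    simp only [List.ofFn_succ, List.prod_cons]
    rw [← ih (fun j k hjk => h _ _ fun e => hjk (Fin.succ_injective _ e)),
      ← Matrix.conjTranspose_mul, (commute_ofFn_prod fun j : Fin n =>
        h 0 j.succ (Fin.succ_ne_zero j).symm).eq]

theorem pairOp_commute_stringOp {N : ℕ} {c : Config N} {i j m : Fin N} (h : c i = c j)
    (hm : (m < i ∧ m < j) ∨ (i < m ∧ j < m)) : Commute (pairOp c i j) (stringOp c m) := by
  rcases hm with hk | hk
  · have := stringOp_pairOp_of_lt (c := c) hk.1 hk.2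
    rw [h, R_sq, one_smul] at this
    exact this.symm
  · have := pairOp_stringOp_of_lt (c := c) hk.1 hk.2
    rw [h, R_sq, one_smul] at this
    exact this

/-! ### The operators of one block -/

section Block
variable {n : ℕ} (τ : Fin n → TwoCycle)

theorem pos_val (j : Fin n) (k : Fin 4) : (pos j k : ℕ) = 4 * j + k := rfl

theorem blocks_pos (j : Fin n) (k : Fin 4) : blocks τ (pos j k) = τ j := by
  unfold blocks
  congr 1
  ext
  simp only [pos_val]
  omega

theorem pos_lt_pos (j : Fin n) {k l : Fin 4} (h : k < l) : pos j k < pos j l := by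
  rw [Fin.lt_def, pos_val, pos_val]
  rw [Fin.lt_def] at h
  omega

theorem pos_lt_pos_of_lt {i j : Fin n} (h : i < j) (k l : Fin 4) : pos i k < pos j l := by
  rw [Fin.lt_def, pos_val, pos_val]
  rw [Fin.lt_def] at h
  omega

/-- The operators of the strings between two twists of the block `j`. -/
def blockOp (j : Fin n) (k l : Fin 4) : Op (4 * n) := pairOp (blocks τ) (pos j k) (pos j l)

/-- The algebra of the neutral strings within the block `j`. -/
def blockAlg (j : Fin n) : Subalgebra ℂ (Op (4 * n)) :=
  Algebra.adjoin ℂ {W | ∃ k l, W = blockOp τ j k l}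

theorem blockOp_mem (j : Fin n) (k l : Fin 4) : blockOp τ j k l ∈ blockAlg τ j :=
  Algebra.subset_adjoin ⟨k, l, rfl⟩

/-- Two strings of one block carry the same fermion and lie on the same side of the other block, so
their phases with an outside string cancel. Hence blocks commute whatever their types are. -/
theorem blockOp_commute_stringOp {j k : Fin n} (hjk : j ≠ k) (a b e : Fin 4) :
    Commute (blockOp τ j a b) (stringOp (blocks τ) (pos k e)) := by
  refine pairOp_commute_stringOp (by rw [blocks_pos, blocks_pos]) ?_
  rcases hjk.lt_or_gt with h | h
  · exact Or.inr ⟨pos_lt_pos_of_lt h _ _, pos_lt_pos_of_lt h _ _⟩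
  · exact Or.inl ⟨pos_lt_pos_of_lt h _ _, pos_lt_pos_of_lt h _ _⟩

theorem blockAlg_commute {j k : Fin n} (hjk : j ≠ k) {V W : Op (4 * n)} (hV : V ∈ blockAlg τ j)
    (hW : W ∈ blockAlg τ k) : Commute V W := by
  refine Algebra.commute_of_mem_adjoin_of_forall_mem_commute (s := _) (R := ℂ) hW ?_
  rintro _ ⟨a, b, rfl⟩
  refine (Algebra.commute_of_mem_adjoin_of_forall_mem_commute hV ?_).symm
  rintro _ ⟨d, e, rfl⟩
  refine Commute.symm ?_
  exact ((blockOp_commute_stringOp τ hjk d e a).mul_right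
    (blockOp_commute_stringOp τ hjk d e b)).smul_right _

/-- The projection of the block `j` on its zero state. -/
def blockProj (j : Fin n) : Op (4 * n) :=
  chargeProj (blocks τ) (pos j 0) (pos j 1) false * chargeProj (blocks τ) (pos j 2) (pos j 3) false

theorem chargeProj_mem (j : Fin n) (k l : Fin 4) (q : Bool) :
    chargeProj (blocks τ) (pos j k) (pos j l) q ∈ blockAlg τ j :=
  Subalgebra.smul_mem _ (add_mem (one_mem _) (Subalgebra.smul_mem _ (blockOp_mem τ j k l) _)) _

theorem blockProj_mem (j : Fin n) : blockProj τ j ∈ blockAlg τ j :=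
  mul_mem (chargeProj_mem τ _ _ _ _) (chargeProj_mem τ _ _ _ _)

theorem blockOp_sq (j : Fin n) {k l : Fin 4} (h : k < l) :
    blockOp τ j k l * blockOp τ j k l = 1 := pairOp_sq (pos_lt_pos j h)

theorem blockOp_conjTranspose (j : Fin n) {k l : Fin 4} (h : k < l) :
    (blockOp τ j k l)ᴴ = blockOp τ j k l := pairOp_conjTranspose (pos_lt_pos j h)

theorem stringOp_anticomm (j : Fin n) {k l : Fin 4} (h : k < l) :
    stringOp (blocks τ) (pos j l) * stringOp (blocks τ) (pos j k) =
      -(stringOp (blocks τ) (pos j k) * stringOp (blocks τ) (pos j l)) := by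
  rw [stringOp_comm' (pos_lt_pos j h), blocks_pos, blocks_pos, R_self, neg_one_smul]

theorem stringOp_anticomm_left (j : Fin n) {k l : Fin 4} (h : k < l) (W : Op (4 * n)) :
    stringOp (blocks τ) (pos j l) * (stringOp (blocks τ) (pos j k) * W) =
      -(stringOp (blocks τ) (pos j k) * (stringOp (blocks τ) (pos j l) * W)) := by
  rw [← mul_assoc, stringOp_anticomm τ j h, neg_mul, mul_assoc]

theorem blockX_mul_blockZ (j : Fin n) :
    blockOp τ j 0 2 * blockOp τ j 0 1 = -(blockOp τ j 0 1 * blockOp τ j 0 2) := by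
  have h01 := stringOp_anticomm_left τ j (show (0 : Fin 4) < 1 by decide)
  have h02 := stringOp_anticomm_left τ j (show (0 : Fin 4) < 2 by decide)
  have h12 := stringOp_anticomm τ j (show (1 : Fin 4) < 2 by decide)
  simp only [blockOp, pairOp, smul_mul_smul_comm, mul_assoc, h01, h02, h12, stringOp_sq_left,
    blocks_pos, mul_neg, neg_neg, smul_neg]

theorem blockX_mul_blockZ' (j : Fin n) :
    blockOp τ j 0 2 * blockOp τ j 2 3 = -(blockOp τ j 2 3 * blockOp τ j 0 2) := by
  have h02 := stringOp_anticomm_left τ j (show (0 : Fin 4) < 2 by decide)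
  have h03 := stringOp_anticomm_left τ j (show (0 : Fin 4) < 3 by decide)
  have h23 := stringOp_anticomm τ j (show (2 : Fin 4) < 3 by decide)
  simp only [blockOp, pairOp, smul_mul_smul_comm, mul_assoc, h02, h03, h23, stringOp_sq_left,
    blocks_pos, mul_neg, neg_neg, smul_neg]

theorem blockZ_commute_blockZ' (j : Fin n) : Commute (blockOp τ j 0 1) (blockOp τ j 2 3) := by
  have h02 := stringOp_anticomm_left τ j (show (0 : Fin 4) < 2 by decide)
  have h03 := stringOp_anticomm_left τ j (show (0 : Fin 4) < 3 by decide)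
  have h13 := stringOp_anticomm τ j (show (1 : Fin 4) < 3 by decide)
  have h12' := stringOp_anticomm_left τ j (show (1 : Fin 4) < 2 by decide)
  simp only [Commute, SemiconjBy, blockOp, pairOp, smul_mul_smul_comm, mul_assoc, h02, h03,
    h13, h12', blocks_pos, mul_neg, neg_neg]

theorem blockZ_mul_blockProj (j : Fin n) : blockOp τ j 0 1 * blockProj τ j = blockProj τ j := by
  rw [blockProj, ← mul_assoc]
  congr 1
  have := blockOp_sq τ j (show (0 : Fin 4) < 1 by decide)
  simp only [chargeProj, if_false, Bool.false_eq_true, one_smul, mul_smul_comm, mul_add, mul_one]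
  change (1 / 2 : ℂ) • (blockOp τ j 0 1 + blockOp τ j 0 1 * blockOp τ j 0 1) =
    (1 / 2 : ℂ) • (1 + blockOp τ j 0 1)
  rw [this, add_comm]

theorem chargeProj_conjTranspose {N : ℕ} {c : Config N} {i j : Fin N} (h : i < j) (q : Bool) :
    (chargeProj c i j q)ᴴ = chargeProj c i j q := by
  cases q <;> simp [chargeProj, pairOp_conjTranspose h]

theorem chargeProj_commute (j : Fin n) (q q' : Bool) :
    Commute (chargeProj (blocks τ) (pos j 0) (pos j 1) q)
      (chargeProj (blocks τ) (pos j 2) (pos j 3) q') :=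
  commute_chargeProj (commute_chargeProj (blockZ_commute_blockZ' τ j).symm q').symm q

theorem blockProj_conjTranspose (j : Fin n) : (blockProj τ j)ᴴ = blockProj τ j := by
  rw [blockProj, Matrix.conjTranspose_mul,
    chargeProj_conjTranspose (pos_lt_pos j (by decide)),
    chargeProj_conjTranspose (pos_lt_pos j (by decide)), (chargeProj_commute τ j _ _).eq]

end Block

/-! ### Logical operators -/

section Logical
variable {n : ℕ} (τ : Fin n → TwoCycle)

theorem zeroProj_eq : zeroProj τ = (List.ofFn fun j => blockProj τ j).prod := rfl

theorem logicalX_eq (a : Fin n → Bool) :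
    logicalX τ a = (List.ofFn fun j => if a j then blockOp τ j 0 2 else 1).prod := rfl

/-- The logical operators `Z^b`. -/
def logicalZ (b : Fin n → Bool) : Op (4 * n) :=
  (List.ofFn fun j => if b j then blockOp τ j 0 1 else 1).prod

theorem ite_mem_blockAlg (a : Bool) (j : Fin n) (k l : Fin 4) :
    (if a then blockOp τ j k l else 1) ∈ blockAlg τ j := by
  split_ifs
  · exact blockOp_mem τ j k l
  · exact one_mem _

/-- The sign `(-1)^(a · b)`. -/
def dotSign (b a : Fin n → Bool) : ℂ := ∏ j with b j = true ∧ a j = true, (-1 : ℂ)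

theorem dotSign_eq (b a : Fin n → Bool) : dotSign b a = ∏ j, if b j && a j then (-1 : ℂ) else 1 := by
  simp only [dotSign, Finset.prod_filter, Bool.and_eq_true]

theorem dotSign_vxor_right (b a a' : Fin n → Bool) :
    dotSign b (vxor a a') = dotSign b a * dotSign b a' := by
  simp only [dotSign_eq, ← Finset.prod_mul_distrib]
  refine Finset.prod_congr rfl fun j _ => ?_
  unfold vxor
  cases b j <;> cases a j <;> cases a' j <;> simp

theorem dotSign_vxor_left (b b' a : Fin n → Bool) :
    dotSign (vxor b b') a = dotSign b a * dotSign b' a := by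
  simp only [dotSign_eq, ← Finset.prod_mul_distrib]
  refine Finset.prod_congr rfl fun j _ => ?_
  unfold vxor
  cases b j <;> cases a j <;> cases b' j <;> simp

theorem dotSign_sq (b a : Fin n → Bool) : dotSign b a * dotSign b a = 1 := by
  rw [dotSign_eq, ← Finset.prod_mul_distrib]
  refine Finset.prod_eq_one fun j _ => ?_
  split_ifs <;> simp

theorem dotSign_star (b a : Fin n → Bool) : star (dotSign b a) = dotSign b a := by
  rw [dotSign, star_prod]
  simp

theorem logicalX_mul (a a' : Fin n → Bool) :
    logicalX τ a * logicalX τ a' = logicalX τ (vxor a a') := by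
  rw [logicalX_eq, logicalX_eq, ofFn_prod_mul fun j k hjk =>
    blockAlg_commute τ hjk (ite_mem_blockAlg τ _ _ _ _) (ite_mem_blockAlg τ _ _ _ _), logicalX_eq]
  congr 2
  ext1 j
  unfold vxor
  have := blockOp_sq τ j (show (0 : Fin 4) < 2 by decide)
  cases a j <;> cases a' j <;> simp [this]

theorem logicalX_conjTranspose (a : Fin n → Bool) : (logicalX τ a)ᴴ = logicalX τ a := by
  rw [logicalX_eq, ofFn_prod_conjTranspose fun j k hjk =>
    blockAlg_commute τ hjk (ite_mem_blockAlg τ _ _ _ _) (ite_mem_blockAlg τ _ _ _ _)]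
  congr 2
  ext1 j
  split_ifs
  · exact blockOp_conjTranspose τ j (by decide)
  · simp

theorem logicalZ_sq (b : Fin n → Bool) : logicalZ τ b * logicalZ τ b = 1 := by
  rw [logicalZ, ofFn_prod_mul fun j k hjk =>
    blockAlg_commute τ hjk (ite_mem_blockAlg τ _ _ _ _) (ite_mem_blockAlg τ _ _ _ _)]
  refine (congrArg (fun f => (List.ofFn f).prod) (funext fun j => ?_)).trans
    (show (List.ofFn fun _ : Fin n => (1 : Op (4 * n))).prod = 1 by simp [List.ofFn_const])
  have := blockOp_sq τ j (show (0 : Fin 4) < 1 by decide)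
  split_ifs <;> simp [this]

theorem logicalZ_conjTranspose (b : Fin n → Bool) : (logicalZ τ b)ᴴ = logicalZ τ b := by
  rw [logicalZ, ofFn_prod_conjTranspose fun j k hjk =>
    blockAlg_commute τ hjk (ite_mem_blockAlg τ _ _ _ _) (ite_mem_blockAlg τ _ _ _ _)]
  congr 2
  ext1 j
  split_ifs
  · exact blockOp_conjTranspose τ j (by decide)
  · simp

theorem zeroProj_conjTranspose : (zeroProj τ)ᴴ = zeroProj τ := by
  rw [zeroProj_eq, ofFn_prod_conjTranspose fun j k hjk =>
    blockAlg_commute τ hjk (blockProj_mem τ _) (blockProj_mem τ _)]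
  simp only [blockProj_conjTranspose]

theorem logicalZ_mul_logicalX (b a : Fin n → Bool) :
    logicalZ τ b * logicalX τ a = dotSign b a • (logicalX τ a * logicalZ τ b) := by
  rw [logicalX_eq, logicalZ, ofFn_prod_mul fun j k hjk =>
    blockAlg_commute τ hjk (ite_mem_blockAlg τ _ _ _ _) (ite_mem_blockAlg τ _ _ _ _),
    ofFn_prod_mul fun j k hjk =>
    blockAlg_commute τ hjk (ite_mem_blockAlg τ _ _ _ _) (ite_mem_blockAlg τ _ _ _ _),
    dotSign_eq, ← ofFn_prod_smul]
  congr 2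
  ext1 j
  have := blockX_mul_blockZ τ j
  cases a j <;> cases b j <;> simp [this]

theorem logicalZ_mul_zeroProj (b : Fin n → Bool) : logicalZ τ b * zeroProj τ = zeroProj τ := by
  rw [logicalZ, zeroProj_eq, ofFn_prod_mul fun j k hjk =>
    blockAlg_commute τ hjk (ite_mem_blockAlg τ _ _ _ _) (blockProj_mem τ _)]
  congr 2
  ext1 j
  split_ifs
  · exact blockZ_mul_blockProj τ j
  · exact one_mul _

/-- The action of `X^a Z^b` on the encoded states. -/
theorem logicalXZ_mul_state (a b x : Fin n → Bool) :
    logicalX τ a * logicalZ τ b * (logicalX τ x * zeroProj τ) =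
      dotSign b x • (logicalX τ (vxor a x) * zeroProj τ) := by
  rw [mul_assoc, ← mul_assoc (logicalZ τ b), logicalZ_mul_logicalX, smul_mul_assoc, mul_smul_comm,
    mul_assoc, logicalZ_mul_zeroProj, ← mul_assoc, logicalX_mul]

/-! ### Encoding -/

theorem pauliXZ_apply (a b x y : Fin n → Bool) :
    pauliXZ a b x y = if x = vxor a y then dotSign b y else 0 := rfl

theorem encode_add (A B : QubitOp n) : encode τ (A + B) = encode τ A + encode τ B := by
  simp [encode, add_smul, Finset.sum_add_distrib]

theorem encode_smul (z : ℂ) (A : QubitOp n) : encode τ (z • A) = z • encode τ A := by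
  simp only [encode, Matrix.smul_apply, smul_eq_mul, Finset.smul_sum, smul_smul]
  refine Finset.sum_congr rfl fun a _ => Finset.sum_congr rfl fun b _ => ?_
  congr 1; ring

theorem encode_conjTranspose (A : QubitOp n) : (encode τ A)ᴴ = encode τ Aᴴ := by
  simp only [encode, Matrix.conjTranspose_smul, Matrix.conjTranspose_sum, Matrix.conjTranspose_mul,
    Matrix.conjTranspose_conjTranspose, zeroProj_conjTranspose, Matrix.conjTranspose_apply]
  rw [Finset.sum_comm]
  simp [mul_assoc]

/-- `logicalXZ_mul_state` says that the logical operators permute the encoded basis vectors with the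
signs of the Pauli matrices; the sum only has to be reindexed by the shift `a`. -/
theorem encode_pauliXZ_mul (a b : Fin n → Bool) (A : QubitOp n) :
    encode τ (pauliXZ a b * A) = logicalX τ a * logicalZ τ b * encode τ A := by
  simp only [encode, mul_smul_comm, Finset.mul_sum]
  congr 1
  rw [← Function.Bijective.sum_comp (e := vxor a)
    (Function.Involutive.bijective (vxor_cancel_left a))]
  refine Finset.sum_congr rfl fun x _ => Finset.sum_congr rfl fun y _ => ?_
  rw [← mul_assoc, logicalXZ_mul_state, smul_mul_assoc, smul_smul, mul_comm (A x y)]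
  congr 1
  rw [Matrix.mul_apply, Finset.sum_eq_single x]
  · rw [pauliXZ_apply, if_pos rfl]
  · intro z _ hz
    rw [pauliXZ_apply, if_neg, zero_mul]
    intro h
    apply hz
    rw [← vxor_cancel_left a z, ← h, vxor_cancel_left]
  · simp

theorem pauliXZ_mul (a b a' b' : Fin n → Bool) :
    pauliXZ a b * pauliXZ a' b' = dotSign b a' • pauliXZ (vxor a a') (vxor b b') := by
  ext x y
  rw [Matrix.mul_apply, Finset.sum_eq_single (vxor a' y)]
  · rw [Matrix.smul_apply, pauliXZ_apply, pauliXZ_apply, pauliXZ_apply, if_pos rfl, vxor_assoc,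
      dotSign_vxor_right, dotSign_vxor_left]
    split_ifs <;> simp; ring
  · intro z _ hz
    rw [pauliXZ_apply (a := a'), if_neg hz, mul_zero]
  · simp

theorem pauliXZ_conjTranspose (a b : Fin n → Bool) :
    (pauliXZ a b)ᴴ = dotSign b a • pauliXZ a b := by
  ext x y
  rw [Matrix.conjTranspose_apply, Matrix.smul_apply, pauliXZ_apply, pauliXZ_apply]
  by_cases h : x = vxor a y
  · rw [if_pos h, if_pos (by rw [h, vxor_cancel_left]), dotSign_star, h, dotSign_vxor_right,
      smul_eq_mul]
  · rw [if_neg h, if_neg fun h' => h (by rw [h', vxor_cancel_left]), star_zero, smul_zero]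

theorem pauliXZ_zero : pauliXZ (fun _ : Fin n => false) (fun _ => false) = 1 := by
  ext x y
  rw [pauliXZ_apply, false_vxor, Matrix.one_apply]
  simp [dotSign]

/-- Pauli matrices and logical operators obey the same commutation signs, so the phase that makes
`X^a Z^b` a self-adjoint involution on qubits does so on the twists as well. -/
theorem exists_logical_of_isPauli {P : QubitOp n} (hP : IsPauli P) (h1 : P * P = 1) :
    Pᴴ = P ∧ ∃ (z : ℂ) (a b : Fin n → Bool), P = z • pauliXZ a b ∧
      (z • (logicalX τ a * logicalZ τ b)) * (z • (logicalX τ a * logicalZ τ b)) = 1 ∧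
      (z • (logicalX τ a * logicalZ τ b))ᴴ = z • (logicalX τ a * logicalZ τ b) := by
  obtain ⟨k, a, b, rfl⟩ := hP
  have hz : Complex.I ^ k * Complex.I ^ k * dotSign b a = 1 := by
    rw [smul_mul_smul_comm, pauliXZ_mul, vxor_self, vxor_self, pauliXZ_zero, smul_smul] at h1
    have := congrFun (congrFun h1 fun _ => false) fun _ => false
    simpa using this
  have hstar : star (Complex.I ^ k) * dotSign b a = Complex.I ^ k := by
    have h2 : star (Complex.I ^ k) * Complex.I ^ k = 1 := by
      rw [star_pow, ← mul_pow]
      simp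
    calc star (Complex.I ^ k) * dotSign b a
        = star (Complex.I ^ k) * dotSign b a * (Complex.I ^ k * Complex.I ^ k * dotSign b a) := by
          rw [hz, mul_one]
      _ = (star (Complex.I ^ k) * Complex.I ^ k) * Complex.I ^ k *
            (dotSign b a * dotSign b a) := by ring
      _ = Complex.I ^ k := by rw [h2, dotSign_sq, one_mul, mul_one]
  refine ⟨?_, Complex.I ^ k, a, b, rfl, ?_, ?_⟩
  · rw [Matrix.conjTranspose_smul, pauliXZ_conjTranspose, smul_smul, hstar]
  · rw [smul_mul_smul_comm, mul_assoc, ← mul_assoc (logicalZ τ b), logicalZ_mul_logicalX,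
      smul_mul_assoc, mul_smul_comm, mul_assoc, logicalZ_sq, mul_one, logicalX_mul, vxor_self,
      smul_smul, hz, one_smul]
    simp [logicalX, List.ofFn_const]
  · rw [Matrix.conjTranspose_smul, Matrix.conjTranspose_mul, logicalX_conjTranspose,
      logicalZ_conjTranspose, logicalZ_mul_logicalX, smul_smul, hstar]

/-- Protocols are only controlled on the string algebra; encoded states belong to it, being built
from pair operators. -/
theorem exists_encode_eq_ev (A : QubitOp n) : ∃ p, ev (stringOp (blocks τ)) p = encode τ A := by
  have hpair : ∀ i j, pairOp (blocks τ) i j ∈ (ev (stringOp (blocks τ))).range := fun i j =>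
    ⟨sqrtR (fixed (blocks τ i)) (fixed (blocks τ j)) •
      (FreeAlgebra.ι ℂ i * FreeAlgebra.ι ℂ j), by simp [pairOp]⟩
  have hblock : ∀ j, blockAlg τ j ≤ (ev (stringOp (blocks τ))).range := fun j =>
    Algebra.adjoin_le (by rintro _ ⟨k, l, rfl⟩; exact hpair _ _)
  have hprod : ∀ f : Fin n → Op (4 * n), (∀ j, f j ∈ blockAlg τ j) →
      (List.ofFn f).prod ∈ (ev (stringOp (blocks τ))).range := fun f hf =>
    list_prod_mem fun W hW => by
      obtain ⟨j, rfl⟩ := List.mem_ofFn.1 hW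
      exact hblock j (hf j)
  suffices encode τ A ∈ (ev (stringOp (blocks τ))).range from this
  refine Subalgebra.smul_mem _ (sum_mem fun a _ => sum_mem fun b _ => Subalgebra.smul_mem _ ?_ _) _
  rw [logicalX_conjTranspose]
  exact mul_mem (mul_mem (hprod _ fun j => ite_mem_blockAlg τ _ _ _ _)
    (hprod _ fun j => blockProj_mem τ j)) (hprod _ fun j => ite_mem_blockAlg τ _ _ _ _)

/-- The factors are strings between twists of equal type, hence neutral, and neutrality and
homogeneity pass to products. -/
theorem exists_neutral_logical (a b : Fin n → Bool) : ∃ w x,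
    ev (stringOp (blocks τ)) w = logicalX τ a * logicalZ τ b ∧ Neutral (blocks τ) x ∧
      Shift x (logicalX τ a * logicalZ τ b) := by
  have hmul : ∀ V W : Op (4 * n), (∃ w x, ev (stringOp (blocks τ)) w = V ∧ Neutral (blocks τ) x ∧
      Shift x V) → (∃ w x, ev (stringOp (blocks τ)) w = W ∧ Neutral (blocks τ) x ∧ Shift x W) →
      ∃ w x, ev (stringOp (blocks τ)) w = V * W ∧ Neutral (blocks τ) x ∧ Shift x (V * W) := by
    rintro V W ⟨v, x, rfl, hx, hV⟩ ⟨w, y, rfl, hy, hW⟩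
    exact ⟨v * w, vxor x y, map_mul _ _ _, hx.vxor hy, hV.mul hW⟩
  have hlist : ∀ l : List (Op (4 * n)), (∀ V ∈ l, ∃ w x, ev (stringOp (blocks τ)) w = V ∧
      Neutral (blocks τ) x ∧ Shift x V) →
      ∃ w x, ev (stringOp (blocks τ)) w = l.prod ∧ Neutral (blocks τ) x ∧ Shift x l.prod := by
    intro l hl
    induction l with
    | nil => exact ⟨1, _, map_one _, neutral_false _, Shift.one⟩
    | cons V l ih =>
      rw [List.prod_cons]
      exact hmul _ _ (hl V (List.mem_cons_self ..)) (ih fun W hW => hl W (List.mem_cons_of_mem _ hW))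
  have hite : ∀ (a : Bool) (j : Fin n) (k l : Fin 4), ∃ w x, ev (stringOp (blocks τ)) w =
      (if a then blockOp τ j k l else 1) ∧ Neutral (blocks τ) x ∧
      Shift x (if a then blockOp τ j k l else 1) := by
    intro a j k l
    split_ifs
    · exact ⟨sqrtR (fixed (blocks τ (pos j k))) (fixed (blocks τ (pos j l))) •
        (FreeAlgebra.ι ℂ (pos j k) * FreeAlgebra.ι ℂ (pos j l)), _, by simp [blockOp, pairOp],
        neutral_pair (by rw [blocks_pos, blocks_pos]), shift_pairOp⟩
    · exact ⟨1, _, map_one _, neutral_false _, Shift.one⟩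
  refine hmul _ _ (hlist _ fun V hV => ?_) (hlist _ fun V hV => ?_)
  · obtain ⟨j, rfl⟩ := List.mem_ofFn.1 hV
    exact hite _ _ _ _
  · obtain ⟨j, rfl⟩ := List.mem_ofFn.1 hV
    exact hite _ _ _ _

end Logical

/-! ### Channels on encoded qubits -/

/-- The channel `F` on encoded qubits can be implemented. -/
def Channel (S : Set TwoCycle) {n m : ℕ} (τ : Fin n → TwoCycle) (σ : Fin m → TwoCycle)
    (F : QubitOp n → QubitOp m) : Prop :=
  ∃ P : Protocol S (blocks σ) (blocks τ), ∀ A, P.total (encode τ A) = encode σ (F A)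

variable {S : Set TwoCycle}

theorem Channel.id {n : ℕ} (τ : Fin n → TwoCycle) : Channel S τ τ fun A => A :=
  ⟨.done, fun _ => Protocol.total_done _⟩

theorem Channel.comp {n m k : ℕ} {τ : Fin n → TwoCycle} {σ : Fin m → TwoCycle}
    {υ : Fin k → TwoCycle} {F : QubitOp n → QubitOp m} {G : QubitOp m → QubitOp k}
    (hG : Channel S σ υ G) (hF : Channel S τ σ F) : Channel S τ υ fun A => G (F A) := by
  obtain ⟨P, hP⟩ := hF
  obtain ⟨Q, hQ⟩ := hG
  exact ⟨P.bind Q, fun A => by rw [Protocol.total_bind, hP, hQ]⟩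

theorem Channel.implementable {n m : ℕ} {τ : Fin n → TwoCycle} {σ : Fin m → TwoCycle}
    {F : QubitOp n → QubitOp m} (h : Channel S τ σ F) :
    Implementable S τ σ fun (_ : Unit) A => F A := by
  obtain ⟨P, hP⟩ := h
  refine ⟨P, fun _ => (), fun ω A => ?_⟩
  rw [← hP A, Protocol.total]
  simp

theorem channel_rotate {g h : TwoCycle} (hgh : g ≠ h) (hg : g ∈ S) (hh : h ∈ S) {n : ℕ}
    (τ : Fin n → TwoCycle) {P : QubitOp n} (hP : IsPauli P) (h1 : P * P = 1) :
    Channel S τ τ (rotate P) := by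
  obtain ⟨hPs, z, a, b, hPz, hsq, hstar⟩ := exists_logical_of_isPauli τ hP h1
  obtain ⟨w, x, hw, hx, hsx⟩ := exists_neutral_logical τ a b
  have hzw : ev (stringOp (blocks τ)) (z • w) = z • (logicalX τ a * logicalZ τ b) := by
    rw [map_smul, hw]
  obtain ⟨Q, hQ⟩ := degreeRotatable_of_neutral hgh hg hh _ x hx (z • w)
    (hzw ▸ hsx.smul z) (by rw [hzw, hsq])
  refine ⟨Q, fun A => ?_⟩
  obtain ⟨p, hp⟩ := exists_encode_eq_ev τ A
  rw [← hp, hQ, hp, hzw]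
  set W := z • (logicalX τ a * logicalZ τ b) with hW
  have hl : ∀ A, encode τ (P * A) = W * encode τ A := fun A => by
    rw [hPz, smul_mul_assoc, encode_smul, encode_pauliXZ_mul, hW, smul_mul_assoc]
  -- Right multiplication follows from left multiplication by taking adjoints, as `P` and `W` are
  -- self-adjoint.
  have hr : ∀ A, encode τ (A * P) = encode τ A * W := fun A => by
    rw [← Matrix.conjTranspose_conjTranspose (A * P), Matrix.conjTranspose_mul, hPs,
      ← encode_conjTranspose, hl, Matrix.conjTranspose_mul, hstar, encode_conjTranspose,
      Matrix.conjTranspose_conjTranspose]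
  have hneg : ∀ A, encode τ (-A) = -encode τ A := fun A => by
    rw [← neg_one_smul ℂ, encode_smul, neg_one_smul]
  simp only [rotate, mul_add, one_mul, mul_one, smul_mul_assoc, mul_smul_comm,
    sub_eq_add_neg, add_mul, neg_mul, encode_smul, encode_add, hneg, hl, hr]

/-! ### Generation of the Clifford group -/

section Pauli
variable {n : ℕ}

/-- The Pauli operator `X` on the qubit `k`. -/
def pauliX (k : Fin n) : QubitOp n := pauliXZ (single k) fun _ => false

/-- The Pauli operator `Z` on the qubit `k`. -/
def pauliZ (k : Fin n) : QubitOp n := pauliXZ (fun _ => false) (single k)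

theorem IsPauli.mul {P Q : QubitOp n} (hP : IsPauli P) (hQ : IsPauli Q) : IsPauli (P * Q) := by
  obtain ⟨k, a, b, rfl⟩ := hP
  obtain ⟨k', a', b', rfl⟩ := hQ
  have hs : dotSign b a' = 1 ∨ dotSign b a' = -1 := by
    have := dotSign_sq b a'
    exact mul_self_eq_one_iff.1 this
  rw [smul_mul_smul_comm, pauliXZ_mul, smul_smul]
  rcases hs with h | h <;> rw [h]
  · exact ⟨k + k', _, _, by rw [pow_add, mul_one]⟩
  · exact ⟨k + k' + 2, _, _, by rw [pow_add, pow_add, Complex.I_sq]⟩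

theorem IsPauli.smul_I {P : QubitOp n} (hP : IsPauli P) : IsPauli (Complex.I • P) := by
  obtain ⟨k, a, b, rfl⟩ := hP
  exact ⟨k + 1, a, b, by rw [smul_smul, pow_succ']⟩

theorem isPauli_pauliX (k : Fin n) : IsPauli (pauliX k) :=
  ⟨0, single k, fun _ => false, by simp [pauliX]⟩

theorem isPauli_pauliZ (k : Fin n) : IsPauli (pauliZ k) :=
  ⟨0, fun _ => false, single k, by simp [pauliZ]⟩

/-- `P` and `Q` commute up to the factor `s`. -/
def CommSign (s : ℂ) (P Q : QubitOp n) : Prop := P * Q = s • (Q * P)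

theorem CommSign.mul_left {s t : ℂ} {P Q V : QubitOp n} (hP : CommSign s P V)
    (hQ : CommSign t Q V) : CommSign (s * t) (P * Q) V := by
  unfold CommSign at *
  rw [mul_assoc, hQ, mul_smul_comm, ← mul_assoc, hP, smul_mul_assoc, smul_smul, mul_assoc,
    mul_comm t]

theorem CommSign.smul_left {s : ℂ} {P V : QubitOp n} (hP : CommSign s P V) (z : ℂ) :
    CommSign s (z • P) V := by
  unfold CommSign at *
  rw [smul_mul_assoc, hP, mul_smul_comm, smul_comm]

theorem CommSign.symm {s : ℂ} {P V : QubitOp n} (hP : CommSign s P V) (hs : s * s = 1) :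
    CommSign s V P := by
  unfold CommSign at *
  rw [hP, smul_smul, hs, one_smul]

theorem CommSign.conj {s : ℂ} {P V U : QubitOp n} (hU : Uᴴ * U = 1) (hP : CommSign s P V) :
    CommSign s (U * P * Uᴴ) (U * V * Uᴴ) := by
  have key : ∀ P V : QubitOp n, U * P * Uᴴ * (U * V * Uᴴ) = U * (P * V) * Uᴴ := fun P V => by
    calc U * P * Uᴴ * (U * V * Uᴴ) = U * P * (Uᴴ * U) * V * Uᴴ := by simp only [mul_assoc]
      _ = _ := by rw [hU, mul_one]; simp only [mul_assoc]
  unfold CommSign at *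
  rw [key, key, hP, mul_smul_comm, smul_mul_assoc]

theorem IsPauli.commSign {P Q : QubitOp n} (hP : IsPauli P) (hQ : IsPauli Q) :
    CommSign 1 P Q ∨ CommSign (-1) P Q := by
  obtain ⟨k, a, b, rfl⟩ := hP
  obtain ⟨k', a', b', rfl⟩ := hQ
  have hs : dotSign b a' * dotSign b' a = 1 ∨ dotSign b a' * dotSign b' a = -1 := by
    refine mul_self_eq_one_iff.1 ?_
    rw [mul_mul_mul_comm, dotSign_sq, dotSign_sq, one_mul]
  have key : CommSign (dotSign b a' * dotSign b' a) (Complex.I ^ k • pauliXZ a b)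
      (Complex.I ^ k' • pauliXZ a' b') := by
    unfold CommSign
    rw [smul_mul_smul_comm, smul_mul_smul_comm, pauliXZ_mul, pauliXZ_mul, vxor_comm a', vxor_comm b',
      smul_smul, smul_smul, smul_smul]
    congr 1
    linear_combination (-(Complex.I ^ k * Complex.I ^ k' * dotSign b a')) * dotSign_sq b' a
  rcases hs with h | h <;> rw [h] at key
  · exact Or.inl key
  · exact Or.inr key

theorem dotSign_false_left (a : Fin n → Bool) : dotSign (fun _ => false) a = 1 := by
  simp [dotSign]

theorem dotSign_false_right (b : Fin n → Bool) : dotSign b (fun _ => false) = 1 := by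
  simp [dotSign]

theorem dotSign_single_left (j : Fin n) (a : Fin n → Bool) :
    dotSign (single j) a = if a j then -1 else 1 := by
  rw [dotSign_eq, Finset.prod_eq_single j]
  · simp [single]
  · intro k _ hk; simp [single, hk]
  · simp

theorem pauliX_sq (k : Fin n) : pauliX k * pauliX k = 1 := by
  rw [pauliX, pauliXZ_mul, vxor_self, vxor_self, pauliXZ_zero, dotSign_false_left, one_smul]

theorem pauliZ_sq (k : Fin n) : pauliZ k * pauliZ k = 1 := by
  rw [pauliZ, pauliXZ_mul, vxor_self, vxor_self, pauliXZ_zero, dotSign_false_right, one_smul]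

theorem commSign_pauliX_pauliX (j k : Fin n) : CommSign 1 (pauliX j) (pauliX k) := by
  unfold CommSign
  rw [pauliX, pauliX, pauliXZ_mul, pauliXZ_mul, vxor_comm (single j)]
  simp only [dotSign_false_left, one_smul]

theorem commSign_pauliZ_pauliZ (j k : Fin n) : CommSign 1 (pauliZ j) (pauliZ k) := by
  unfold CommSign
  rw [pauliZ, pauliZ, pauliXZ_mul, pauliXZ_mul, vxor_comm (single j)]
  simp only [dotSign_false_right, one_smul]

theorem commSign_pauliZ_pauliX (j k : Fin n) :
    CommSign (if j = k then -1 else 1) (pauliZ j) (pauliX k) := by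
  unfold CommSign
  rw [pauliZ, pauliX, pauliXZ_mul, pauliXZ_mul, false_vxor, vxor_false, false_vxor, vxor_false,
    dotSign_false_left, dotSign_single_left, one_smul]
  simp [single]

theorem commSign_pauliZ_pauliX_self (k : Fin n) : CommSign (-1) (pauliZ k) (pauliX k) := by
  simpa using commSign_pauliZ_pauliX k k

theorem commSign_pauliZ_pauliX_of_ne {j k : Fin n} (h : j ≠ k) :
    CommSign 1 (pauliZ j) (pauliX k) := by
  simpa [h] using commSign_pauliZ_pauliX j k

theorem commSign_pauliX_pauliZ_of_ne {j k : Fin n} (h : j ≠ k) :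
    CommSign 1 (pauliX j) (pauliZ k) :=
  (commSign_pauliZ_pauliX_of_ne h.symm).symm (one_mul 1)

/-- The Pauli group acts irreducibly. -/
theorem eq_smul_one_of_commSign {A : QubitOp n} (hX : ∀ j, CommSign 1 A (pauliX j))
    (hZ : ∀ j, CommSign 1 A (pauliZ j)) : ∃ z : ℂ, A = z • (1 : QubitOp n) := by
  have hmulX : ∀ (a b : Fin n → Bool) (x y : Fin n → Bool),
      (A * pauliXZ a b) x y = A x (vxor a y) * dotSign b y := by
    intro a b x y
    rw [Matrix.mul_apply, Finset.sum_eq_single (vxor a y)]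
    · rw [pauliXZ_apply, if_pos rfl]
    · intro z _ hz
      rw [pauliXZ_apply, if_neg hz, mul_zero]
    · simp
  have hXmul : ∀ (a b : Fin n → Bool) (x y : Fin n → Bool),
      (pauliXZ a b * A) x y = dotSign b (vxor a x) * A (vxor a x) y := by
    intro a b x y
    rw [Matrix.mul_apply, Finset.sum_eq_single (vxor a x)]
    · rw [pauliXZ_apply, if_pos (vxor_cancel_left a x).symm]
    · intro z _ hz
      rw [pauliXZ_apply, if_neg, zero_mul]
      intro h
      exact hz (by rw [h, vxor_cancel_left])
    · simp
  -- Commuting with `Z_j` kills the entries whose indices differ in the bit `j`.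
  have hoff : ∀ x y, x ≠ y → A x y = 0 := by
    intro x y hxy
    obtain ⟨j, hj⟩ := Function.ne_iff.1 hxy
    have := congrFun (congrFun (hZ j) x) y
    rw [one_smul, pauliZ, hmulX, hXmul, false_vxor, false_vxor, dotSign_single_left,
      dotSign_single_left] at this
    cases hx : x j <;> cases hy : y j <;> simp [hx, hy] at this hj
    · linear_combination (-1 / 2 : ℂ) * this
    · linear_combination (1 / 2 : ℂ) * this
  -- Commuting with `X_j` equates diagonal entries that differ in the bit `j`; switching bits on one
  -- at a time connects all of them.
  have hdiag : ∀ s : Finset (Fin n), A (fun j => decide (j ∈ s)) (fun j => decide (j ∈ s)) =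
      A (fun _ => false) fun _ => false := by
    intro s
    induction s using Finset.induction_on with
    | empty => simp
    | insert j s hj ih =>
      have := congrFun (congrFun (hX j) (fun k => decide (k ∈ insert j s)))
        (fun k => decide (k ∈ s))
      have hv : vxor (single j) (fun k => decide (k ∈ s)) = fun k => decide (k ∈ insert j s) := by
        ext k
        by_cases hk : k = j
        · subst hk; simp [vxor, single, hj]
        · simp [vxor, single, hk]
      rw [one_smul, pauliX, hmulX, hXmul, hv, ← hv, vxor_cancel_left, hv, dotSign_false_left,
        one_mul, mul_one, ih] at this
      exact this
  refine ⟨A (fun _ => false) fun _ => false, ?_⟩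
  ext x y
  rw [Matrix.smul_apply, Matrix.one_apply]
  split_ifs with h
  · subst h
    have := hdiag (Finset.univ.filter fun j => x j = true)
    simp at this
    simp [this]
  · simp [hoff x y h]

/-! ### Quarter-turn gates of Pauli involutions -/

/-- `exp(-iπ(P - 1)/4)` for an involution `P`. -/
def gate (P : QubitOp n) : QubitOp n :=
  ((1 + Complex.I) / 2) • (1 : QubitOp n) + ((1 - Complex.I) / 2) • P

/-- The gate is `(1 + i)/2` times `1 - iP`, and the squared modulus of this factor is the `1 / 2` in
`rotate`. -/
theorem gate_conj {P : QubitOp n} (hP : Pᴴ = P) (A : QubitOp n) :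
    gate P * A * (gate P)ᴴ = rotate P A := by
  have hI : Complex.I * Complex.I = -1 := Complex.I_mul_I
  simp only [gate, rotate, Matrix.conjTranspose_add, Matrix.conjTranspose_smul,
    Matrix.conjTranspose_one, hP, add_mul, mul_add, sub_mul, one_mul, mul_one,
    smul_mul_assoc, mul_smul_comm, smul_smul, smul_add, smul_sub]
  have e1 : star ((1 + Complex.I) / 2) = (1 - Complex.I) / 2 := by
    simp [sub_eq_add_neg]
  have e2 : star ((1 - Complex.I) / 2) = (1 + Complex.I) / 2 := by
    simp
  rw [e1, e2]
  linear_combination (norm := module) ((-1 / 4 : ℂ) * hI) • A + ((1 / 4 : ℂ) * hI) • (P * A * P) +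
    ((1 / 4 : ℂ) * hI) • (P * A) + ((1 / 4 : ℂ) * hI) • (A * P)

theorem gate_unitary {P : QubitOp n} (hP : Pᴴ = P) (h1 : P * P = 1) : (gate P)ᴴ * gate P = 1 := by
  refine mul_eq_one_comm.1 ?_
  have := gate_conj hP 1
  rw [mul_one] at this
  rw [this, rotate]
  simp only [mul_one, sub_mul, mul_add, one_mul, smul_mul_assoc, mul_smul_comm, h1]
  linear_combination (norm := module) ((-1 / 2 : ℂ) * Complex.I_mul_I) • (1 : QubitOp n)

variable (n) in
/-- The monoid generated by the gates of Pauli operators. -/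
def gateMonoid : Submonoid (QubitOp n) :=
  Submonoid.closure {T | ∃ P, IsPauli P ∧ P * P = 1 ∧ T = gate P}

theorem IsPauli.conjTranspose_eq {P : QubitOp n} (hP : IsPauli P) (h1 : P * P = 1) : Pᴴ = P := by
  obtain ⟨k, a, b, rfl⟩ := hP
  have hz : Complex.I ^ k * Complex.I ^ k * dotSign b a = 1 := by
    rw [smul_mul_smul_comm, pauliXZ_mul, vxor_self, vxor_self, pauliXZ_zero, smul_smul] at h1
    have := congrFun (congrFun h1 fun _ => false) fun _ => false
    simpa using this
  rw [Matrix.conjTranspose_smul, pauliXZ_conjTranspose, smul_smul]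
  congr 1
  have h2 : star (Complex.I ^ k) * Complex.I ^ k = 1 := by
    rw [star_pow, ← mul_pow]
    simp
  linear_combination (-star (Complex.I ^ k) * dotSign b a) * hz +
    (Complex.I ^ k * dotSign b a * dotSign b a) * h2 + Complex.I ^ k * dotSign_sq b a

theorem rotate_of_commSign {P Q : QubitOp n} (h1 : P * P = 1) (h : CommSign 1 P Q) :
    rotate P Q = Q := by
  unfold CommSign at h
  rw [one_smul] at h
  simp only [rotate, sub_mul, mul_add, one_mul, mul_one, smul_mul_assoc, mul_smul_comm, h,
    mul_assoc, h1]
  linear_combination (norm := module) ((-1 / 2 : ℂ) * Complex.I_mul_I) • Q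

theorem rotate_of_anticomm {P Q : QubitOp n} (h1 : P * P = 1) (h : CommSign (-1) P Q) :
    rotate P Q = (-Complex.I) • (P * Q) := by
  have h' : Q * P = -(P * Q) := by rw [h, neg_one_smul, neg_neg]
  have h2 : P * (P * Q) = Q := by rw [← mul_assoc, h1, one_mul]
  simp only [rotate, sub_mul, mul_add, one_mul, mul_one, smul_mul_assoc, mul_smul_comm, h',
    mul_assoc, mul_neg, h2]
  linear_combination (norm := module) ((1 / 2 : ℂ) * Complex.I_mul_I) • Q

/-- Conjugation with `T` fixes every operator in `K`. -/
def Fixes (T : QubitOp n) (K : Set (QubitOp n)) : Prop := ∀ Q ∈ K, T * Q * Tᴴ = Q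

theorem conj_conj_mul (T T' Q : QubitOp n) :
    T * T' * Q * (T * T')ᴴ = T * (T' * Q * T'ᴴ) * Tᴴ := by
  rw [Matrix.conjTranspose_mul]
  simp only [mul_assoc]

theorem Fixes.mul {T T' : QubitOp n} {K : Set (QubitOp n)} (h : Fixes T K) (h' : Fixes T' K) :
    Fixes (T * T') K := fun Q hQ => by
  rw [conj_conj_mul, h' Q hQ, h Q hQ]

/-- For anticommuting involutions `u`, `v`, the product `i v u` is again an involution, and its
quarter turn takes `u` to `-i (i v u) u = v`. It fixes everything that commutes with `v u`. -/
theorem exists_gate {u v : QubitOp n} (hu : IsPauli u) (hv : IsPauli v) (hu1 : u * u = 1)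
    (hv1 : v * v = 1) (huv : CommSign (-1) v u) {K : Set (QubitOp n)}
    (hK : ∀ Q ∈ K, CommSign 1 (v * u) Q) :
    ∃ T ∈ gateMonoid n, T * u * Tᴴ = v ∧ Fixes T K := by
  have hvu : v * u = -(u * v) := by rw [huv, neg_one_smul]
  have hP1 : Complex.I • (v * u) * Complex.I • (v * u) = 1 := by
    rw [smul_mul_smul_comm, Complex.I_mul_I]
    nth_rewrite 1 [hvu]
    rw [neg_mul, mul_assoc, ← mul_assoc v, hv1, one_mul, hu1, neg_smul, one_smul, neg_neg]
  have hP : IsPauli (Complex.I • (v * u)) := (hv.mul hu).smul_I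
  refine ⟨gate (Complex.I • (v * u)), Submonoid.subset_closure ⟨_, hP, hP1, rfl⟩, ?_, ?_⟩
  · rw [gate_conj (hP.conjTranspose_eq hP1), rotate_of_anticomm hP1, smul_mul_assoc, mul_assoc,
      hu1, mul_one, smul_smul, neg_mul, Complex.I_mul_I, neg_neg, one_smul]
    refine CommSign.smul_left ?_ _
    have : CommSign 1 u u := by simp [CommSign]
    simpa using huv.mul_left this
  · intro Q hQ
    rw [gate_conj (hP.conjTranspose_eq hP1), rotate_of_commSign hP1 ((hK Q hQ).smul_left _)]

/-- When `u` and `v` commute, no single quarter turn of this kind is available; a Pauli involution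
`w` that anticommutes with both serves as a stopover. -/
theorem exists_gate_pair {u v w : QubitOp n} (hu : IsPauli u) (hv : IsPauli v) (hw : IsPauli w)
    (hu1 : u * u = 1) (hv1 : v * v = 1) (hw1 : w * w = 1) (hwu : CommSign (-1) w u)
    (hvw : CommSign (-1) v w) {K : Set (QubitOp n)} (hK : ∀ Q ∈ K, CommSign 1 (w * u) Q)
    (hK' : ∀ Q ∈ K, CommSign 1 (v * w) Q) :
    ∃ T ∈ gateMonoid n, T * u * Tᴴ = v ∧ Fixes T K := by
  obtain ⟨T, hT, h1, h2⟩ := exists_gate hu hw hu1 hw1 hwu hK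
  obtain ⟨T', hT', h1', h2'⟩ := exists_gate hw hv hw1 hv1 hvw hK'
  exact ⟨T' * T, mul_mem hT' hT, by rw [conj_conj_mul, h1, h1'], h2'.mul h2⟩

theorem gateMonoid_induction {p : QubitOp n → Prop} (h1 : p 1)
    (hg : ∀ P, IsPauli P → P * P = 1 → p (gate P)) (hm : ∀ S T, p S → p T → p (S * T))
    {T : QubitOp n} (hT : T ∈ gateMonoid n) : p T := by
  refine Submonoid.closure_induction ?_ h1 (fun x y _ _ hx hy => hm x y hx hy) hT
  rintro _ ⟨P, hP, hP1, rfl⟩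
  exact hg P hP hP1

/-- Unitaries that map Pauli operators to Pauli operators. -/
def PreservesPauli (U : QubitOp n) : Prop :=
  Uᴴ * U = 1 ∧ ∀ P, IsPauli P → IsPauli (U * P * Uᴴ)

theorem PreservesPauli.mul {U V : QubitOp n} (hU : PreservesPauli U) (hV : PreservesPauli V) :
    PreservesPauli (U * V) := by
  refine ⟨?_, fun P hP => ?_⟩
  · rw [Matrix.conjTranspose_mul, mul_assoc, ← mul_assoc _ U, hU.1, one_mul, hV.1]
  · rw [conj_conj_mul]
    exact hU.2 _ (hV.2 P hP)

theorem preservesPauli_of_mem_gateMonoid {T : QubitOp n} (hT : T ∈ gateMonoid n) :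
    PreservesPauli T := by
  refine gateMonoid_induction ⟨by simp, fun P hP => by simpa using hP⟩ (fun P hP hP1 => ?_)
    (fun S T hS hT => hS.mul hT) hT
  have hs := hP.conjTranspose_eq hP1
  refine ⟨gate_unitary hs hP1, fun Q hQ => ?_⟩
  rw [gate_conj hs]
  rcases hP.commSign hQ with h | h
  · rwa [rotate_of_commSign hP1 h]
  · rw [rotate_of_anticomm hP1 h]
    have := (hP.mul hQ).smul_I.smul_I.smul_I
    rwa [smul_smul, smul_smul, Complex.I_mul_I, neg_one_mul] at this

theorem conj_sq {U P : QubitOp n} (hU : Uᴴ * U = 1) (hP : P * P = 1) :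
    U * P * Uᴴ * (U * P * Uᴴ) = 1 := by
  calc U * P * Uᴴ * (U * P * Uᴴ) = U * P * (Uᴴ * U) * P * Uᴴ := by simp only [mul_assoc]
    _ = U * (P * P) * Uᴴ := by rw [hU, mul_one]; simp only [mul_assoc]
    _ = 1 := by rw [hP, mul_one, mul_eq_one_comm.1 hU]

/-! ### Elimination of a Clifford unitary, one qubit at a time -/

/-- The Pauli operators `X` and `Z` on the first `k` qubits. -/
def pauliSet (n k : ℕ) : Set (QubitOp n) :=
  {Q | ∃ j : Fin n, (j : ℕ) < k ∧ (Q = pauliX j ∨ Q = pauliZ j)}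

theorem commSign_pauliX_pauliSet {k : Fin n} {Q : QubitOp n} {m : ℕ} (hm : m ≤ k)
    (hQ : Q ∈ pauliSet n m) : CommSign 1 (pauliX k) Q := by
  obtain ⟨j, hj, rfl | rfl⟩ := hQ
  · exact commSign_pauliX_pauliX _ _
  · exact commSign_pauliX_pauliZ_of_ne (by rintro rfl; omega)

theorem commSign_pauliZ_pauliSet {k : Fin n} {Q : QubitOp n} {m : ℕ} (hm : m ≤ k)
    (hQ : Q ∈ pauliSet n m) : CommSign 1 (pauliZ k) Q := by
  obtain ⟨j, hj, rfl | rfl⟩ := hQ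
  · exact commSign_pauliZ_pauliX_of_ne (by rintro rfl; omega)
  · exact commSign_pauliZ_pauliZ _ _

/-- The image `u` of `X_k` commutes with the earlier Pauli operators, which are already fixed. It is
moved to `X_k` directly if the two anticommute, and otherwise through a stopover that also commutes
with the earlier ones: `Z_k`, or `Z_k` times a Pauli operator on a later qubit. -/
theorem exists_gate_pauliX {U : QubitOp n} (hU : PreservesPauli U) (k : Fin n)
    (hfix : Fixes U (pauliSet n k)) :
    ∃ T ∈ gateMonoid n, Fixes (T * U) (pauliSet n k) ∧
      T * U * pauliX k * (T * U)ᴴ = pauliX k := by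
  set u := U * pauliX k * Uᴴ with hu
  have huP : IsPauli u := hU.2 _ (isPauli_pauliX k)
  have hu1 : u * u = 1 := conj_sq hU.1 (pauliX_sq k)
  have huK : ∀ Q ∈ pauliSet n k, CommSign 1 u Q := fun Q hQ => by
    have := (commSign_pauliX_pauliSet le_rfl hQ).conj hU.1
    rwa [hfix Q hQ] at this
  have hone : (1 : ℂ) * 1 = 1 := one_mul 1
  have hneg : (-1 : ℂ) * -1 = 1 := by norm_num
  have hXK := fun Q (hQ : Q ∈ pauliSet n k) => commSign_pauliX_pauliSet le_rfl hQ
  have hZK := fun Q (hQ : Q ∈ pauliSet n k) => commSign_pauliZ_pauliSet le_rfl hQ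
  have hZX := commSign_pauliZ_pauliX_self k
  suffices ∃ T ∈ gateMonoid n, T * u * Tᴴ = pauliX k ∧ Fixes T (pauliSet n k) by
    obtain ⟨T, hT, h1, h2⟩ := this
    exact ⟨T, hT, h2.mul hfix, by rw [conj_conj_mul, ← hu, h1]⟩
  rcases (isPauli_pauliX k).commSign huP with hX | hX
  · rcases (isPauli_pauliZ k).commSign huP with hZ | hZ
    · obtain ⟨r, hrP, hr1, hru, hrZ, hrX, hrK⟩ : ∃ r : QubitOp n, IsPauli r ∧ r * r = 1 ∧
          CommSign (-1) r u ∧ CommSign 1 r (pauliZ k) ∧ CommSign 1 r (pauliX k) ∧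
          ∀ Q ∈ pauliSet n k, CommSign 1 r Q := by
        -- If no such `r` existed, `u` would commute with all `X_j` and `Z_j` and be a scalar; then
        -- `X_k` would be a scalar as well, although it anticommutes with `Z_k`.
        by_contra hno
        have hcX : ∀ j, CommSign 1 u (pauliX j) := by
          intro j
          by_cases hj : (j : ℕ) < k
          · exact huK _ ⟨j, hj, Or.inl rfl⟩
          by_cases hjk : j = k
          · exact hjk ▸ hX.symm hone
          rcases (isPauli_pauliX j).commSign huP with h | h
          · exact h.symm hone
          · exact absurd ⟨pauliX j, isPauli_pauliX j, pauliX_sq j, h,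
              commSign_pauliX_pauliZ_of_ne hjk, commSign_pauliX_pauliX _ _, fun Q hQ =>
              commSign_pauliX_pauliSet (not_lt.1 hj) hQ⟩ hno
        have hcZ : ∀ j, CommSign 1 u (pauliZ j) := by
          intro j
          by_cases hj : (j : ℕ) < k
          · exact huK _ ⟨j, hj, Or.inr rfl⟩
          by_cases hjk : j = k
          · exact hjk ▸ hZ.symm hone
          rcases (isPauli_pauliZ j).commSign huP with h | h
          · exact h.symm hone
          · exact absurd ⟨pauliZ j, isPauli_pauliZ j, pauliZ_sq j, h,
              commSign_pauliZ_pauliZ _ _, commSign_pauliZ_pauliX_of_ne hjk, fun Q hQ =>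
              commSign_pauliZ_pauliSet (not_lt.1 hj) hQ⟩ hno
        obtain ⟨z, hz⟩ := eq_smul_one_of_commSign hcX hcZ
        have hXz : pauliX k = z • (1 : QubitOp n) := by
          calc pauliX k = (Uᴴ * U) * pauliX k * (Uᴴ * U) := by rw [hU.1, one_mul, mul_one]
            _ = Uᴴ * u * U := by rw [hu]; simp only [mul_assoc]
            _ = z • 1 := by rw [hz, mul_smul_comm, mul_one, smul_mul_assoc, hU.1]
        have h2 : pauliZ k * pauliX k = 0 := by
          have h3 : pauliX k * pauliZ k = pauliZ k * pauliX k := by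
            rw [hXz]; simp
          have h4 : pauliZ k * pauliX k = -(pauliZ k * pauliX k) := by
            nth_rewrite 1 [hZX]
            rw [h3, neg_one_smul]
          have h6 : (2 : ℂ) • (pauliZ k * pauliX k) = 0 := by
            rw [two_smul]; exact add_eq_zero_iff_eq_neg.2 h4
          exact (smul_eq_zero.1 h6).resolve_left two_ne_zero
        have h5 : (1 : QubitOp n) = 0 := by
          rw [← pauliX_sq k, ← one_mul (pauliX k * pauliX k), ← pauliZ_sq k, mul_assoc,
            ← mul_assoc (pauliZ k) (pauliX k), h2, zero_mul, mul_zero]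
        exact one_ne_zero h5
      have hwu : CommSign (-1) (pauliZ k * r) u := by simpa using hZ.mul_left hru
      have hwX : CommSign (-1) (pauliZ k * r) (pauliX k) := by simpa using hZX.mul_left hrX
      have hwK : ∀ Q ∈ pauliSet n k, CommSign 1 (pauliZ k * r) Q := fun Q hQ => by
        simpa using (hZK Q hQ).mul_left (hrK Q hQ)
      refine exists_gate_pair huP (isPauli_pauliX k) ((isPauli_pauliZ k).mul hrP) hu1 (pauliX_sq k)
        ?_ hwu (hwX.symm hneg) (fun Q hQ => ?_) (fun Q hQ => ?_)
      · have : r * pauliZ k = pauliZ k * r := by rw [hrZ, one_smul]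
        rw [mul_assoc, ← mul_assoc r, this, mul_assoc, hr1, mul_one, pauliZ_sq]
      · simpa using (hwK Q hQ).mul_left (huK Q hQ)
      · simpa using (hXK Q hQ).mul_left (hwK Q hQ)
    · refine exists_gate_pair huP (isPauli_pauliX k) (isPauli_pauliZ k) hu1 (pauliX_sq k)
        (pauliZ_sq k) hZ (hZX.symm hneg) (fun Q hQ => ?_) (fun Q hQ => ?_)
      · simpa using (hZK Q hQ).mul_left (huK Q hQ)
      · simpa using (hXK Q hQ).mul_left (hZK Q hQ)
  · refine exists_gate huP (isPauli_pauliX k) hu1 (pauliX_sq k) hX (fun Q hQ => ?_)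
    simpa using (hXK Q hQ).mul_left (huK Q hQ)

/-- The image `u` of `Z_k` and `Z_k` itself both anticommute with `X_k`, so their product commutes
with it, and the quarter turn leaves `X_k` in place. -/
theorem exists_gate_pauliZ {U : QubitOp n} (hU : PreservesPauli U) (k : Fin n)
    (hfix : Fixes U (pauliSet n k)) (hfixX : U * pauliX k * Uᴴ = pauliX k) :
    ∃ T ∈ gateMonoid n, Fixes (T * U) (pauliSet n (k + 1)) := by
  set u := U * pauliZ k * Uᴴ with hu
  have huP : IsPauli u := hU.2 _ (isPauli_pauliZ k)
  have hu1 : u * u = 1 := conj_sq hU.1 (pauliZ_sq k)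
  have hone : (1 : ℂ) * 1 = 1 := one_mul 1
  have hneg : (-1 : ℂ) * -1 = 1 := by norm_num
  have hZX := commSign_pauliZ_pauliX_self k
  have huX : CommSign (-1) u (pauliX k) := by
    have := hZX.conj hU.1
    rwa [hfixX] at this
  have huK : ∀ Q ∈ pauliSet n k, CommSign 1 u Q := fun Q hQ => by
    have := (commSign_pauliZ_pauliSet le_rfl hQ).conj hU.1
    rwa [hfix Q hQ] at this
  have hXK := fun Q (hQ : Q ∈ pauliSet n k) => commSign_pauliX_pauliSet le_rfl hQ
  have hZK := fun Q (hQ : Q ∈ pauliSet n k) => commSign_pauliZ_pauliSet le_rfl hQ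
  suffices ∃ T ∈ gateMonoid n, T * u * Tᴴ = pauliZ k ∧
      Fixes T (insert (pauliX k) (pauliSet n k)) by
    obtain ⟨T, hT, h1, h2⟩ := this
    refine ⟨T, hT, ?_⟩
    rintro Q ⟨j, hj, hQ⟩
    rw [conj_conj_mul]
    rcases Nat.lt_succ_iff_lt_or_eq.1 hj with hjk | hjk
    · have hQ' : Q ∈ pauliSet n k := ⟨j, hjk, hQ⟩
      rw [hfix Q hQ', h2 Q (Set.mem_insert_of_mem _ hQ')]
    · obtain rfl : j = k := Fin.ext hjk
      rcases hQ with rfl | rfl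
      · rw [hfixX, h2 _ (Set.mem_insert _ _)]
      · exact h1
  have hXX : CommSign 1 (pauliX k) (pauliX k) := commSign_pauliX_pauliX k k
  rcases (isPauli_pauliZ k).commSign huP with hZ | hZ
  -- If `u` and `Z_k` commute, the stopover is `Y_k` up to sign; it anticommutes with `u`, with
  -- `Z_k` and also with `X_k`, so both products still commute with `X_k`.
  · set w := Complex.I • (pauliX k * pauliZ k) with hw
    have hwP : IsPauli w := ((isPauli_pauliX k).mul (isPauli_pauliZ k)).smul_I
    have hwX : CommSign (-1) w (pauliX k) := by
      have := (hXX.mul_left hZX).smul_left Complex.I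
      simpa using this
    have hwZ : CommSign (-1) w (pauliZ k) := by
      have := ((hZX.symm hneg).mul_left (commSign_pauliZ_pauliZ k k)).smul_left Complex.I
      simpa using this
    have hwu : CommSign (-1) w u := by
      have := ((huX.symm hneg).mul_left hZ).smul_left Complex.I
      simpa using this
    have hwK : ∀ Q ∈ pauliSet n k, CommSign 1 w Q := fun Q hQ => by
      have := ((hXK Q hQ).mul_left (hZK Q hQ)).smul_left Complex.I
      simpa using this
    refine exists_gate_pair huP (isPauli_pauliZ k) hwP hu1 (pauliZ_sq k)
      ?_ hwu (hwZ.symm hneg) ?_ ?_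
    · have h3 : pauliX k * pauliZ k = -(pauliZ k * pauliX k) := by
        rw [hZX.symm hneg, neg_one_smul]
      rw [hw, smul_mul_smul_comm, Complex.I_mul_I]
      nth_rewrite 1 [h3]
      rw [neg_mul, mul_assoc, ← mul_assoc (pauliX k), pauliX_sq, one_mul, pauliZ_sq, neg_smul,
        one_smul, neg_neg]
    · rintro Q (rfl | hQ)
      · simpa using hwX.mul_left huX
      · simpa using (hwK Q hQ).mul_left (huK Q hQ)
    · rintro Q (rfl | hQ)
      · simpa using hZX.mul_left hwX
      · simpa using (hZK Q hQ).mul_left (hwK Q hQ)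
  · refine exists_gate huP (isPauli_pauliZ k) hu1 (pauliZ_sq k) hZ ?_
    rintro Q (rfl | hQ)
    · simpa using hZX.mul_left huX
    · simpa using (hZK Q hQ).mul_left (huK Q hQ)

theorem exists_gate_fixes {U : QubitOp n} (hU : PreservesPauli U) (k : ℕ) (hk : k ≤ n) :
    ∃ T ∈ gateMonoid n, Fixes (T * U) (pauliSet n k) := by
  induction k with
  | zero => exact ⟨1, one_mem _, by rintro Q ⟨j, hj, -⟩; exact absurd hj (Nat.not_lt_zero _)⟩
  | succ k ih =>
    obtain ⟨T, hT, h1⟩ := ih (Nat.le_of_succ_le hk)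
    have hTU := (preservesPauli_of_mem_gateMonoid hT).mul hU
    obtain ⟨T', hT', h2, h3⟩ := exists_gate_pauliX hTU ⟨k, hk⟩ h1
    have hTU' := (preservesPauli_of_mem_gateMonoid hT').mul hTU
    obtain ⟨T'', hT'', h4⟩ := exists_gate_pauliZ hTU' ⟨k, hk⟩ h2 h3
    refine ⟨T'' * (T' * T), mul_mem hT'' (mul_mem hT' hT), ?_⟩
    simpa only [mul_assoc] using h4

/-- Clifford unitaries are generated by the gates of Pauli operators, up to phases. -/
theorem exists_gate_of_isClifford {U : QubitOp n} (hU : IsClifford U) :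
    ∃ T ∈ gateMonoid n, ∀ A, U * A * Uᴴ = T * A * Tᴴ := by
  have hU1 : Uᴴ * U = 1 := (Matrix.mem_unitaryGroup_iff').1 hU.1
  have hU2 : U * Uᴴ = 1 := mul_eq_one_comm.1 hU1
  -- The elimination is run on the inverse of `U`, so that the gates found multiply to `U` itself up
  -- to a phase and need not be inverted.
  have hU' : PreservesPauli Uᴴ := by
    refine ⟨by rwa [Matrix.conjTranspose_conjTranspose], fun P hP => ?_⟩
    rw [hU.2, Matrix.conjTranspose_conjTranspose,
      show U * (Uᴴ * P * U) * Uᴴ = (U * Uᴴ) * P * (U * Uᴴ) by simp only [mul_assoc], hU2, one_mul,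
      mul_one]
    exact hP
  obtain ⟨T, hT, hfix⟩ := exists_gate_fixes hU' n le_rfl
  have hW := ((preservesPauli_of_mem_gateMonoid hT).mul hU').1
  have hcomm : ∀ Q ∈ pauliSet n n, CommSign 1 (T * Uᴴ) Q := fun Q hQ => by
    unfold CommSign
    nth_rewrite 2 [← hfix Q hQ]
    rw [one_smul, mul_assoc _ _ (T * Uᴴ), hW, mul_one]
  obtain ⟨z, hz⟩ := eq_smul_one_of_commSign (A := T * Uᴴ)
    (fun j => hcomm _ ⟨j, j.2, Or.inl rfl⟩) (fun j => hcomm _ ⟨j, j.2, Or.inr rfl⟩)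
  have hzz : z * star z = 1 := by
    rw [hz, Matrix.conjTranspose_smul, Matrix.conjTranspose_one, smul_mul_smul_comm, one_mul] at hW
    have := congrFun (congrFun hW fun _ => false) fun _ => false
    simpa [mul_comm] using this
  have hTU : T = z • U := by
    rw [← mul_one T, ← hU1, ← mul_assoc, hz, smul_mul_assoc, one_mul]
  refine ⟨T, hT, fun A => ?_⟩
  rw [hTU, Matrix.conjTranspose_smul, smul_mul_assoc, smul_mul_assoc, mul_smul_comm, smul_smul, hzz,
    one_smul]

end Pauli

variable {S : Set TwoCycle}

theorem channel_gateMonoid {g h : TwoCycle} (hgh : g ≠ h) (hg : g ∈ S) (hh : h ∈ S) {n : ℕ}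
    (τ : Fin n → TwoCycle) {T : QubitOp n} (hT : T ∈ gateMonoid n) :
    Channel S τ τ fun A => T * A * Tᴴ := by
  refine gateMonoid_induction (p := fun T => Channel S τ τ fun A => T * A * Tᴴ) ?_
    (fun P hP hP1 => ?_) (fun V W hV hW => ?_) hT
  · simpa using Channel.id τ
  · simp only [gate_conj (hP.conjTranspose_eq hP1)]
    exact channel_rotate hgh hg hh τ hP hP1
  · simp only [conj_conj_mul]
    exact hV.comp hW

/-! ### Adding and removing a block -/

section Outer
variable {n : ℕ} (j : Fin (n + 1))

/-- The position of the first pair of the block `j` that is fused, and of the last one that is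
nucleated. -/
def outerIndex : Fin (4 * n + 2 + 1) := ⟨4 * j, by omega⟩

/-- The position of the other pair of the block `j` while the first one is absent. -/
def innerIndex : Fin (4 * n + 1) := ⟨4 * j, by omega⟩

/-- The positions outside of the block `j`. -/
def restSkip (k : Fin (4 * n)) : Fin (4 * (n + 1)) := skip (outerIndex j) (skip (innerIndex j) k)

theorem restSkip_val (k : Fin (4 * n)) :
    (restSkip j k : ℕ) = if (k : ℕ) < 4 * j then (k : ℕ) else k + 4 := by
  have h1 : (restSkip j k : ℕ) = _ := skip_val (outerIndex j) (skip (innerIndex j) k)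
  have h2 := skip_val (innerIndex j) k
  have h3 : (outerIndex j : ℕ) = 4 * j := rfl
  have h4 : (innerIndex j : ℕ) = 4 * j := rfl
  rw [h3] at h1
  rw [h4] at h2
  split_ifs at * <;> omega

theorem succAbove_val (k : Fin n) :
    (j.succAbove k : ℕ) = if (k : ℕ) < j then (k : ℕ) else k + 1 := by
  simp only [Fin.succAbove, Fin.lt_def, Fin.val_castSucc]
  split_ifs <;> simp

theorem restSkip_pos (k : Fin n) (a : Fin 4) : restSkip j (pos k a) = pos (j.succAbove k) a := by
  ext
  rw [restSkip_val, pos_val, pos_val, succAbove_val]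
  split_ifs <;> omega

theorem skip_innerIndex_castSucc : skip (outerIndex j) (innerIndex j).castSucc = pos j 2 := by
  ext
  rw [skip_val, pos_val]
  simp [outerIndex, innerIndex]

theorem skip_innerIndex_succ : skip (outerIndex j) (innerIndex j).succ = pos j 3 := by
  ext
  rw [skip_val, pos_val]
  simp [outerIndex, innerIndex]

variable (τ : Fin (n + 1) → TwoCycle)

/-- The configuration of `n + 1` blocks with the first two twists of the block `j` removed. -/
def midConfig : Config (4 * n + 2) := removePair (N := 4 * n + 2) (blocks τ) (outerIndex j)

theorem removePair_midConfig :
    removePair (midConfig j τ) (innerIndex j) = blocks (j.removeNth τ) := by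
  ext1 k
  change τ _ = τ _
  congr 1
  ext
  have h := restSkip_val j k
  change (restSkip j k : ℕ) / 4 = _
  rw [h, succAbove_val]
  dsimp only
  split_ifs <;> omega

theorem midConfig_eq :
    midConfig j τ (innerIndex j).castSucc = midConfig j τ (innerIndex j).succ := by
  change blocks τ (skip (outerIndex j) _) = blocks τ (skip (outerIndex j) _)
  rw [skip_innerIndex_castSucc, skip_innerIndex_succ, blocks_pos, blocks_pos]

theorem blocks_outerIndex_eq :
    (blocks τ : Config (4 * n + 2 + 2)) (outerIndex j).castSucc =
      (blocks τ : Config (4 * n + 2 + 2)) (outerIndex j).succ :=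
  (blocks_pos τ j 0).trans (blocks_pos τ j 1).symm

/-- The polynomial algebra of the strings outside of the block `j`. -/
def restPoly : FreeAlgebra ℂ (Fin (4 * n)) →ₐ[ℂ] FreeAlgebra ℂ (Fin (4 * (n + 1))) :=
  (skipPoly (outerIndex j)).comp (skipPoly (innerIndex j))

@[simp] theorem restPoly_ι (k : Fin (4 * n)) :
    restPoly j (FreeAlgebra.ι ℂ k) = FreeAlgebra.ι ℂ (restSkip j k) := by
  simp [restPoly, skipPoly, restSkip]

/-- The operator `V'` of the strings outside of the block `j` becomes `V` in the presence of this
block. -/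
def Lifts (V' : Op (4 * n)) (V : Op (4 * (n + 1))) : Prop :=
  ∃ p, ev (stringOp (blocks (j.removeNth τ))) p = V' ∧ ev (stringOp (blocks τ)) (restPoly j p) = V

variable {j τ}

theorem Lifts.one : Lifts j τ 1 1 := ⟨1, map_one _, by rw [map_one, map_one]⟩

theorem Lifts.mul {V' W' : Op (4 * n)} {V W : Op (4 * (n + 1))} (hV : Lifts j τ V' V)
    (hW : Lifts j τ W' W) : Lifts j τ (V' * W') (V * W) := by
  obtain ⟨p, rfl, rfl⟩ := hV
  obtain ⟨q, rfl, rfl⟩ := hW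
  exact ⟨p * q, map_mul _ _ _, by rw [map_mul, map_mul]⟩

theorem Lifts.add {V' W' : Op (4 * n)} {V W : Op (4 * (n + 1))} (hV : Lifts j τ V' V)
    (hW : Lifts j τ W' W) : Lifts j τ (V' + W') (V + W) := by
  obtain ⟨p, rfl, rfl⟩ := hV
  obtain ⟨q, rfl, rfl⟩ := hW
  exact ⟨p + q, map_add _ _ _, by rw [map_add, map_add]⟩

theorem Lifts.smul {V' : Op (4 * n)} {V : Op (4 * (n + 1))} (hV : Lifts j τ V' V) (z : ℂ) :
    Lifts j τ (z • V') (z • V) := by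
  obtain ⟨p, rfl, rfl⟩ := hV
  exact ⟨z • p, map_smul _ _ _, by rw [map_smul, map_smul]⟩

theorem Lifts.sum {ι : Type*} (s : Finset ι) {f' : ι → Op (4 * n)} {f : ι → Op (4 * (n + 1))}
    (h : ∀ k, Lifts j τ (f' k) (f k)) : Lifts j τ (∑ k ∈ s, f' k) (∑ k ∈ s, f k) := by
  classical
  induction s using Finset.induction_on with
  | empty => exact ⟨0, by simp, by simp⟩
  | insert a s ha ih =>
    rw [Finset.sum_insert ha, Finset.sum_insert ha]
    exact (h a).add ih

theorem Lifts.ofFn_prod {m : ℕ} {f' : Fin m → Op (4 * n)} {f : Fin m → Op (4 * (n + 1))}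
    (h : ∀ k, Lifts j τ (f' k) (f k)) : Lifts j τ (List.ofFn f').prod (List.ofFn f).prod := by
  induction m with
  | zero => simpa using Lifts.one
  | succ m ih =>
    rw [List.ofFn_succ, List.ofFn_succ, List.prod_cons, List.prod_cons]
    exact (h 0).mul (ih fun k => h k.succ)

variable (j τ)

theorem lifts_blockOp (k : Fin n) (a b : Fin 4) :
    Lifts j τ (blockOp (j.removeNth τ) k a b) (blockOp τ (j.succAbove k) a b) := by
  refine ⟨sqrtR (fixed (τ (j.succAbove k))) (fixed (τ (j.succAbove k))) •
    (FreeAlgebra.ι ℂ (pos k a) * FreeAlgebra.ι ℂ (pos k b)), ?_, ?_⟩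
  · rw [blockOp, pairOp, blocks_pos, blocks_pos, map_smul, map_mul, ev_ι, ev_ι]
    rfl
  · rw [blockOp, pairOp, blocks_pos, blocks_pos]
    simp only [map_smul, map_mul, restPoly_ι, ev_ι, restSkip_pos]

theorem lifts_blockProj (k : Fin n) :
    Lifts j τ (blockProj (j.removeNth τ) k) (blockProj τ (j.succAbove k)) :=
  (((Lifts.one.add ((lifts_blockOp j τ k 0 1).smul _))).smul _).mul
    (((Lifts.one.add ((lifts_blockOp j τ k 2 3).smul _))).smul _)

/-- The logical operators `X^a` on all qubits except for `j`. -/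
def restX (a : Fin n → Bool) : Op (4 * (n + 1)) :=
  (List.ofFn fun k => if a k then blockOp τ (j.succAbove k) 0 2 else 1).prod

/-- The projection onto the state `|0…0⟩` of all qubits except for `j`. -/
def restProj : Op (4 * (n + 1)) := (List.ofFn fun k => blockProj τ (j.succAbove k)).prod

/-- The encoding of all qubits except for `j`. -/
def restEncode (A : QubitOp n) : Op (4 * (n + 1)) :=
  ((4 : ℂ) ^ n)⁻¹ • ∑ a, ∑ b, A a b • (restX j τ a * restProj j τ * restX j τ b)

theorem lifts_restX (a : Fin n → Bool) : Lifts j τ (logicalX (j.removeNth τ) a) (restX j τ a) := by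
  rw [logicalX_eq]
  refine Lifts.ofFn_prod fun k => ?_
  split_ifs
  · exact lifts_blockOp j τ k 0 2
  · exact Lifts.one

theorem lifts_restEncode (A : QubitOp n) :
    Lifts j τ (encode (j.removeNth τ) A) (restEncode j τ A) := by
  refine Lifts.smul (Lifts.sum _ fun a => Lifts.sum _ fun b => Lifts.smul ?_ _) _
  rw [logicalX_conjTranspose]
  exact ((lifts_restX j τ a).mul (Lifts.ofFn_prod (lifts_blockProj j τ))).mul (lifts_restX j τ b)

theorem logicalX_insertNth (s : Bool) (a : Fin n → Bool) :
    logicalX τ (j.insertNth s a) = (if s then blockOp τ j 0 2 else 1) * restX j τ a := by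
  rw [logicalX_eq, ofFn_prod_removeNth j fun k l hkl =>
    blockAlg_commute τ hkl (ite_mem_blockAlg τ _ _ _ _) (ite_mem_blockAlg τ _ _ _ _), restX]
  congr 1
  · simp
  · congr 2
    ext1 k
    simp [Fin.removeNth]

theorem zeroProj_eq_mul : zeroProj τ = blockProj τ j * restProj j τ := by
  rw [zeroProj_eq, ofFn_prod_removeNth j fun k l hkl =>
    blockAlg_commute τ hkl (blockProj_mem τ _) (blockProj_mem τ _), restProj]
  rfl

theorem sum_insertNth {β : Type*} [AddCommMonoid β] (f : (Fin (n + 1) → Bool) → β) :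
    ∑ x, f x = ∑ s : Bool, ∑ a : Fin n → Bool, f (j.insertNth s a) := by
  rw [← Fintype.sum_prod_type' fun s a => f (j.insertNth (α := fun _ => Bool) s a)]
  exact ((Fin.insertNthEquiv (fun _ => Bool) j).sum_comp f).symm

variable {j} in
theorem commute_restX {V : Op (4 * (n + 1))} (hV : V ∈ blockAlg τ j) (a : Fin n → Bool) :
    Commute V (restX j τ a) :=
  commute_ofFn_prod fun k => blockAlg_commute τ (Fin.succAbove_ne j k).symm hV
    (ite_mem_blockAlg τ _ _ _ _)

variable {j} in
theorem commute_restProj {V : Op (4 * (n + 1))} (hV : V ∈ blockAlg τ j) :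
    Commute V (restProj j τ) :=
  commute_ofFn_prod fun k => blockAlg_commute τ (Fin.succAbove_ne j k).symm hV
    (blockProj_mem τ _)

/-- The matrix element of the qubit `j` in an operator on `n + 1` qubits. -/
def slice (s t : Bool) (A : QubitOp (n + 1)) : QubitOp n :=
  Matrix.of fun a b => A (j.insertNth s a) (j.insertNth t b)

/-- The encoded matrix unit `|s⟩⟨t|` of the qubit `j`, up to normalization. -/
def blockUnit (s t : Bool) : Op (4 * (n + 1)) :=
  (if s then blockOp τ j 0 2 else 1) * blockProj τ j * (if t then blockOp τ j 0 2 else 1)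

/-- Operators of the block `j` commute with those of the other blocks and can be collected on the
left; `1 / 4` is the normalization of this one block. -/
theorem encode_eq_sum_slice (A : QubitOp (n + 1)) :
    encode τ A = (1 / 4 : ℂ) • ∑ s : Bool, ∑ t : Bool,
      blockUnit j τ s t * restEncode j τ (slice j s t A) := by
  have key : ∀ s t a b, logicalX τ (j.insertNth s a) * zeroProj τ *
      (logicalX τ (j.insertNth t b))ᴴ =
      blockUnit j τ s t * (restX j τ a * restProj j τ * restX j τ b) := by
    intro s t a b
    rw [logicalX_conjTranspose, logicalX_insertNth, logicalX_insertNth, zeroProj_eq_mul j τ,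
      blockUnit]
    have h1 := commute_restX τ (blockProj_mem τ j) a
    have h2 := commute_restX τ (ite_mem_blockAlg τ t j 0 2) a
    have h3 := commute_restProj τ (ite_mem_blockAlg τ t j 0 2)
    generalize (if t then blockOp τ j 0 2 else 1) = xt at *
    generalize (if s then blockOp τ j 0 2 else 1) = xs at *
    calc xs * restX j τ a * (blockProj τ j * restProj j τ) * (xt * restX j τ b)
        = xs * (restX j τ a * blockProj τ j) * (restProj j τ * xt) * restX j τ b := by
          simp only [mul_assoc]
      _ = xs * blockProj τ j * (restX j τ a * xt) * restProj j τ * restX j τ b := by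
          rw [← h1.eq, ← h3.eq]; simp only [mul_assoc]
      _ = _ := by rw [← h2.eq]; simp only [mul_assoc]
  simp only [encode, restEncode, mul_smul_comm, Finset.mul_sum, slice, Matrix.of_apply]
  rw [sum_insertNth j]
  simp only [sum_insertNth j (fun b => A _ b • _), key, Finset.smul_sum, smul_smul]
  refine Finset.sum_congr rfl fun s _ => ?_
  rw [Finset.sum_comm]
  refine Finset.sum_congr rfl fun t _ => Finset.sum_congr rfl fun a _ =>
    Finset.sum_congr rfl fun b _ => ?_
  congr 1
  rw [pow_succ]
  field_simp

/-! ### Charge projections within a block -/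

theorem mul_chargeProj_of_anticomm {N : ℕ} {c : Config N} {k l : Fin N} {W : Op N}
    (h : W * pairOp c k l = -(pairOp c k l * W)) (q : Bool) :
    W * chargeProj c k l q = chargeProj c k l (!q) * W := by
  cases q <;> simp [chargeProj, mul_add, add_mul, h]

/-- The logical `X` flips the charges of both pairs. Hence the state `|s⟩` of the block has charge
`s` in each of them, and projecting the first pair also fixes the second. -/
theorem chargeProj_mul_blockUnit (q s t : Bool) :
    chargeProj (blocks τ) (pos j 0) (pos j 1) q * blockUnit j τ s t *
      chargeProj (blocks τ) (pos j 0) (pos j 1) q = if s = q ∧ t = q then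
        chargeProj (blocks τ) (pos j 0) (pos j 1) q * chargeProj (blocks τ) (pos j 2) (pos j 3) q
      else 0 := by
  have hx := blockOp_sq τ j (show (0 : Fin 4) < 2 by decide)
  have hp := mul_chargeProj_of_anticomm (blockX_mul_blockZ τ j)
  have hr := mul_chargeProj_of_anticomm (blockX_mul_blockZ' τ j)
  have hpp := chargeProj_mul_chargeProj (c := blocks τ)
    (pos_lt_pos j (show (0 : Fin 4) < 1 by decide))
  have hpr := fun q q' => (chargeProj_commute τ j q q').eq
  unfold blockUnit blockProj
  generalize blockOp τ j 0 2 = x at *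
  generalize chargeProj (blocks τ) (pos j 0) (pos j 1) = p at *
  generalize chargeProj (blocks τ) (pos j 2) (pos j 3) = r at *
  have hpp' : ∀ q q' W, p q * (p q' * W) = if q = q' then p q * W else 0 := fun q q' W => by
    rw [← mul_assoc, hpp]; split_ifs <;> simp
  have hp' : ∀ q W, x * (p q * W) = p (!q) * (x * W) := fun q W => by
    rw [← mul_assoc, hp, mul_assoc]
  have hr' : ∀ q W, x * (r q * W) = r (!q) * (x * W) := fun q W => by
    rw [← mul_assoc, hr, mul_assoc]
  have hrp : ∀ q q', r q * p q' = p q' * r q := fun q q' => (hpr q' q).symm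
  have hrp' : ∀ q q' W, r q * (p q' * W) = p q' * (r q * W) := fun q q' W => by
    rw [← mul_assoc, hrp, mul_assoc]
  cases q <;> cases s <;> cases t <;>
    simp [mul_assoc, hpp', hp, hp', hr, hrp, hrp', hx]

end Outer

/-! ### Preparation and measurement in the computational basis -/

section Computational
variable {S : Set TwoCycle} {n : ℕ} (j : Fin (n + 1)) (τ : Fin (n + 1) → TwoCycle)

/-- The projection on a charge of two twists of type `a` as a polynomial. -/
def chargePoly {N : ℕ} (a : TwoCycle) (k l : Fin N) (q : Bool) : FreeAlgebra ℂ (Fin N) :=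
  (1 / 2 : ℂ) • (1 + (if q then (-1 : ℂ) else 1) • sqrtR (fixed a) (fixed a) •
    (FreeAlgebra.ι ℂ k * FreeAlgebra.ι ℂ l))

theorem ev_chargePoly {N : ℕ} {c : Config N} {a : TwoCycle} {k l : Fin N} (hk : c k = a)
    (hl : c l = a) (q : Bool) : ev (stringOp c) (chargePoly a k l q) = chargeProj c k l q := by
  rw [chargeProj, pairOp, hk, hl]
  simp only [chargePoly, map_smul, map_add, map_one, map_mul, ev_ι]

theorem ev_skipPoly_chargePoly (q : Bool) :
    ev (stringOp (blocks τ)) (skipPoly (outerIndex j)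
      (chargePoly (τ j) (innerIndex j).castSucc (innerIndex j).succ q)) =
      chargeProj (blocks τ) (pos j 2) (pos j 3) q := by
  rw [← ev_chargePoly (blocks_pos τ j 2) (blocks_pos τ j 3)]
  congr 1
  simp only [chargePoly, map_smul, map_add, map_one, map_mul, skipPoly, FreeAlgebra.lift_ι_apply,
    skip_innerIndex_castSucc, skip_innerIndex_succ]

theorem ev_chargePoly_midConfig (q : Bool) :
    ev (stringOp (midConfig j τ)) (chargePoly (τ j) (innerIndex j).castSucc (innerIndex j).succ q) =
      chargeProj (midConfig j τ) (innerIndex j).castSucc (innerIndex j).succ q := by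
  refine ev_chargePoly ?_ ?_ q
  · change blocks τ (skip (outerIndex j) _) = _
    rw [skip_innerIndex_castSucc, blocks_pos]
  · change blocks τ (skip (outerIndex j) _) = _
    rw [skip_innerIndex_succ, blocks_pos]

/-- The last two twists of the block are nucleated first and the first two are placed to their left.
Both pairs have vacuum charge, which is the encoded `|0⟩`; the two factors `1 / 2` give the
normalization of the block. -/
theorem exists_nucleate_block (hS : τ j ∈ S) :
    ∃ P : Protocol S (blocks τ) (blocks (j.removeNth τ)), ∀ A,
      P.total (encode (j.removeNth τ) A) =
        (1 / 4 : ℂ) • (blockProj τ j * restEncode j τ A) := by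
  have H := exists_nucleate (S := S) (midConfig_eq j τ) (by
    change blocks τ (skip (outerIndex j) _) ∈ S
    rwa [skip_innerIndex_castSucc, blocks_pos])
  rw [removePair_midConfig] at H
  obtain ⟨P₁, h₁⟩ := H
  obtain ⟨P₂, h₂⟩ := exists_nucleate (S := S) (blocks_outerIndex_eq j τ) (by
    change blocks τ (pos j 0) ∈ S
    rwa [blocks_pos])
  refine ⟨P₁.bind P₂, fun A => ?_⟩
  obtain ⟨p, hp, hp'⟩ := lifts_restEncode j τ A
  have e : (1 / 2 : ℂ) • (chargeProj (midConfig j τ) (innerIndex j).castSucc (innerIndex j).succ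
      false * ev (stringOp (midConfig j τ)) (skipPoly (innerIndex j) p)) =
      ev (stringOp (midConfig j τ)) ((1 / 2 : ℂ) • (chargePoly (τ j) (innerIndex j).castSucc
        (innerIndex j).succ false * skipPoly (innerIndex j) p)) := by
    rw [map_smul, map_mul, ev_chargePoly_midConfig]
  refine (Protocol.total_bind (d := midConfig j τ) P₁ P₂ _).trans ?_
  rw [← hp, h₁, e]
  refine (h₂ _).trans ?_
  rw [map_smul, map_smul, map_mul, map_mul, ← hp']
  change (1 / 2 : ℂ) • (_ * ((1 / 2 : ℂ) • (ev (stringOp (blocks τ)) _ * _))) = _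
  rw [ev_skipPoly_chargePoly, mul_smul_comm, smul_smul, ← mul_assoc]
  norm_num
  rfl

theorem restEncode_zero : restEncode j τ 0 = 0 := by
  simp [restEncode]

theorem slice_prepare (p : Axis) (q s t : Bool) (A : QubitOp n) :
    slice j s t (prepare j p q A) = p.proj q s t • A := by
  ext x y
  simp [slice, prepare]

theorem channel_prepare_zero (hS : τ j ∈ S) :
    Channel S (j.removeNth τ) τ fun A => prepare j .Z false A := by
  obtain ⟨P, hP⟩ := exists_nucleate_block j τ hS
  refine ⟨P, fun A => ?_⟩
  rw [hP, encode_eq_sum_slice j]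
  simp [slice_prepare, Axis.proj, Axis.pauli, blockUnit, restEncode_zero]
  norm_num

/-- The projection inside `fuseMap` is idempotent, so the state may be projected beforehand; this
brings `chargeProj_mul_blockUnit` to bear. -/
theorem fuseMap_eq_conj {N : ℕ} (c : Config (N + 2)) (i : Fin (N + 1)) (q : Bool)
    (ρ : Op (N + 2)) : fuseMap c i q ρ =
      fuseMap c i q (chargeProj c i.castSucc i.succ q * ρ * chargeProj c i.castSucc i.succ q) := by
  have h : chargeProj c i.castSucc i.succ q * chargeProj c i.castSucc i.succ q =
      chargeProj c i.castSucc i.succ q := by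
    rw [chargeProj_mul_chargeProj (castSucc_lt_succ' i), if_pos rfl]
  unfold fuseMap
  congr 1
  simp only [mul_assoc, h]
  simp only [← mul_assoc, h]

theorem fuseMap_zero {N : ℕ} (c : Config (N + 2)) (i : Fin (N + 1)) (q : Bool) :
    fuseMap c i q 0 = 0 := by
  simp [fuseMap, transport]

/-- Fusion of both pairs of the block `j`, with outcomes `q` and `q'`. -/
def fuseBlock (q q' : Bool) (ρ : Op (4 * (n + 1))) : Op (4 * n) :=
  fuseMap (midConfig j τ) (innerIndex j) q' (fuseMap (N := 4 * n + 2) (blocks τ) (outerIndex j) q ρ)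

theorem fuseBlock_add (q q' : Bool) (ρ σ : Op (4 * (n + 1))) :
    fuseBlock j τ q q' (ρ + σ) = fuseBlock j τ q q' ρ + fuseBlock j τ q q' σ := by
  unfold fuseBlock
  rw [fuseMap_add (N := 4 * n + 2)]
  exact fuseMap_add ..

theorem fuseBlock_smul (q q' : Bool) (z : ℂ) (ρ : Op (4 * (n + 1))) :
    fuseBlock j τ q q' (z • ρ) = z • fuseBlock j τ q q' ρ := by
  unfold fuseBlock
  rw [fuseMap_smul (N := 4 * n + 2)]
  exact fuseMap_smul ..

/-- Each fusion contributes a factor `2`. The outcomes must agree because the block has trivial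
total charge, and coherences between `|0⟩` and `|1⟩` are removed by the first projection. -/
theorem fuseBlock_blockUnit (q q' s t : Bool) (A : QubitOp n) :
    fuseBlock j τ q q' (blockUnit j τ s t * restEncode j τ A) =
      if s = q ∧ t = q ∧ q = q' then (4 : ℂ) • encode (j.removeNth τ) A else 0 := by
  obtain ⟨p, hp, hp'⟩ := lifts_restEncode j τ A
  have hc : Commute (chargeProj (blocks τ) (pos j 0) (pos j 1) q) (restEncode j τ A) := by
    rw [← hp']
    exact chargeProj_comm_skip (N := 4 * n + 2) (outerIndex j) (blocks_outerIndex_eq j τ) q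
      (skipPoly (innerIndex j) p)
  have h1 : chargeProj (blocks τ) (pos j 0) (pos j 1) q *
      (blockUnit j τ s t * restEncode j τ A) * chargeProj (blocks τ) (pos j 0) (pos j 1) q =
      if s = q ∧ t = q then chargeProj (blocks τ) (pos j 0) (pos j 1) q *
        ev (stringOp (blocks τ)) (skipPoly (outerIndex j) (chargePoly (τ j)
          (innerIndex j).castSucc (innerIndex j).succ q * skipPoly (innerIndex j) p)) else 0 := by
    rw [mul_assoc, mul_assoc, ← hc.eq, ← mul_assoc, ← mul_assoc, chargeProj_mul_blockUnit]
    split_ifs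
    · rw [map_mul, map_mul, mul_assoc, ← hp']
      congr 2
      exact (ev_skipPoly_chargePoly j τ q).symm
    · exact zero_mul _
  have h2 : fuseMap (N := 4 * n + 2) (blocks τ) (outerIndex j) q
      (blockUnit j τ s t * restEncode j τ A) = if s = q ∧ t = q then
        (2 : ℂ) • (chargeProj (midConfig j τ) (innerIndex j).castSucc (innerIndex j).succ q *
          ev (stringOp (midConfig j τ)) (skipPoly (innerIndex j) p)) else 0 := by
    rw [fuseMap_eq_conj]
    refine (congrArg _ h1).trans ?_
    split_ifs
    · refine (fuseMap_chargeProj (N := 4 * n + 2) (outerIndex j) (blocks_outerIndex_eq j τ)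
        q q _).trans ?_
      rw [if_pos rfl, map_mul]
      congr 2
      exact ev_chargePoly_midConfig j τ q
    · exact fuseMap_zero _ _ _
  rw [fuseBlock, h2]
  by_cases hst : s = q ∧ t = q
  · rw [if_pos hst, fuseMap_smul, fuseMap_chargeProj _ (midConfig_eq j τ)]
    by_cases hq : q = q'
    · rw [if_pos hq.symm, if_pos ⟨hst.1, hst.2, hq⟩, removePair_midConfig, hp, smul_smul]
      norm_num
    · rw [if_neg (Ne.symm hq), if_neg fun h => hq h.2.2, smul_zero]
  · rw [if_neg hst, if_neg fun h => hst ⟨h.1, h.2.1⟩, fuseMap_zero]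

/-- Fusion of both pairs of the block `j`, where the second outcome is `ω`. -/
def readBlock (ω : Bool) (ρ : Op (4 * (n + 1))) : Op (4 * n) :=
  fuseBlock j τ false ω ρ + fuseBlock j τ true ω ρ

theorem readBlock_add (ω : Bool) (ρ σ : Op (4 * (n + 1))) :
    readBlock j τ ω (ρ + σ) = readBlock j τ ω ρ + readBlock j τ ω σ := by
  rw [readBlock, fuseBlock_add, fuseBlock_add, readBlock, readBlock]
  abel

theorem readBlock_encode (ω : Bool) (A : QubitOp (n + 1)) :
    readBlock j τ ω (encode τ A) = encode (j.removeNth τ) (slice j ω ω A) := by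
  rw [encode_eq_sum_slice j]
  simp only [Fintype.sum_bool, readBlock, fuseBlock_smul, fuseBlock_add, fuseBlock_blockUnit]
  cases ω <;> simp [smul_smul]

theorem exists_fuse_block : ∃ Q : Protocol S (blocks (j.removeNth τ)) (blocks τ), ∀ ρ, Q.run ρ =
    [([false, false], fuseBlock j τ false false ρ), ([false, true], fuseBlock j τ false true ρ),
      ([true, false], fuseBlock j τ true false ρ), ([true, true], fuseBlock j τ true true ρ)] := by
  rw [← removePair_midConfig]
  exact ⟨.fuse (N := 4 * n + 2) (outerIndex j) (blocks_outerIndex_eq j τ) fun _ =>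
    .fuse (innerIndex j) (midConfig_eq j τ) fun _ => .done, fun ρ => rfl⟩

theorem Channel.measure {F : QubitOp (n + 1) → QubitOp (n + 1)} (hF : Channel S τ τ F) :
    Implementable S τ (j.removeNth τ) fun (q : Bool) A => slice j q q (F A) := by
  obtain ⟨P, hP⟩ := hF
  obtain ⟨Q, hQ⟩ := exists_fuse_block (S := S) j τ
  -- The last outcome of the record is the charge of the second pair of the block. Reading it alone
  -- is correct, since branches in which the two pairs disagree carry the zero state. The default is
  -- never used, as every record ends with these two fusions.
  refine ⟨P.bind Q, fun l => l.getLastD false, fun ω A => ?_⟩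
  rw [← readBlock_encode j τ, ← hP, Protocol.run_bind, Protocol.total]
  induction P.run (encode τ A) with
  | nil =>
    have := readBlock_add j τ ω 0 0
    simp only [add_zero, left_eq_add] at this
    simp [this]
  | cons b l ih =>
    rw [List.flatMap_cons, List.map_append, List.sum_append, ih, List.map_cons, List.sum_cons,
      readBlock_add, hQ]
    congr 1
    cases ω <;> simp [readBlock, List.getLastD_eq_getLast?]

end Computational

/-! ### Single-qubit gates -/

section Local
variable {n : ℕ} (j : Fin (n + 1))

/-- An operator on the qubit `j`. -/
def localOp (v : Matrix Bool Bool ℂ) : QubitOp (n + 1) :=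
  Matrix.of fun x y => if j.removeNth x = j.removeNth y then v (x j) (y j) else 0

theorem localOp_mul_apply (v : Matrix Bool Bool ℂ) (A : QubitOp (n + 1)) (q : Bool)
    (x : Fin n → Bool) (y : Fin (n + 1) → Bool) :
    (localOp j v * A) (j.insertNth q x) y = ∑ t : Bool, v q t * A (j.insertNth t x) y := by
  rw [Matrix.mul_apply, sum_insertNth j]
  simp [localOp]

theorem mul_localOp_apply (v : Matrix Bool Bool ℂ) (A : QubitOp (n + 1)) (q : Bool)
    (x : Fin (n + 1) → Bool) (y : Fin n → Bool) :
    (A * (localOp j v)ᴴ) x (j.insertNth q y) =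
      ∑ s : Bool, A x (j.insertNth s y) * star (v q s) := by
  rw [Matrix.mul_apply, sum_insertNth j]
  simp [localOp, Matrix.conjTranspose_apply, apply_ite]

theorem slice_localOp_conj (v : Matrix Bool Bool ℂ) (A : QubitOp (n + 1)) (q q' : Bool) :
    slice j q q' (localOp j v * A * (localOp j v)ᴴ) =
      ∑ s : Bool, ∑ t : Bool, (v q t * star (v q' s)) • slice j t s A := by
  ext x y
  simp only [slice, Matrix.of_apply, mul_localOp_apply, localOp_mul_apply, Matrix.sum_apply,
    Matrix.smul_apply, Finset.sum_mul, smul_eq_mul]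
  refine Finset.sum_congr rfl fun s _ => Finset.sum_congr rfl fun t _ => ?_
  ring

theorem ext_slice {A B : QubitOp (n + 1)} (h : ∀ s t, slice j s t A = slice j s t B) : A = B := by
  ext x y
  have := congrFun (congrFun (h (x j) (y j)) (j.removeNth x)) (j.removeNth y)
  simpa [slice] using this

theorem measure_eq (p : Axis) (q : Bool) (A : QubitOp (n + 1)) :
    measure j p q A = ∑ s : Bool, ∑ t : Bool, p.proj q s t • slice j t s A := by
  ext x y
  simp [measure, slice, Matrix.sum_apply]

theorem localOp_one : localOp j 1 = 1 := by
  ext x y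
  rw [localOp, Matrix.of_apply, Matrix.one_apply, Matrix.one_apply]
  by_cases h : x = y
  · simp [h]
  · rw [if_neg h]
    split_ifs with h1 h2
    · refine absurd ?_ h
      rw [← Fin.insertNth_self_removeNth j x, ← Fin.insertNth_self_removeNth j y, h1, h2]
    · rfl
    · rfl

theorem localOp_add (u v : Matrix Bool Bool ℂ) :
    localOp j (u + v) = localOp j u + localOp j v := by
  ext x y
  simp only [localOp, Matrix.of_apply, Matrix.add_apply]
  split_ifs <;> simp

theorem localOp_smul (z : ℂ) (v : Matrix Bool Bool ℂ) :
    localOp j (z • v) = z • localOp j v := by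
  ext x y
  simp only [localOp, Matrix.of_apply, Matrix.smul_apply]
  split_ifs <;> simp

theorem vxor_single_insertNth (t : Bool) (b : Fin n → Bool) :
    vxor (single j) (j.insertNth t b) = j.insertNth (α := fun _ => Bool) (!t) b := by
  ext k
  refine Fin.succAboveCases j ?_ (fun k => ?_) k
  · simp [vxor, single]
  · simp [vxor, single, Fin.succAbove_ne]

theorem localOp_X : localOp j Axis.X.pauli = pauliX j := by
  refine ext_slice j fun s t => ?_
  ext a b
  simp only [slice, Matrix.of_apply, pauliX, pauliXZ_apply, dotSign_false_left, localOp,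
    Axis.pauli, vxor_single_insertNth, Fin.insertNth_inj]
  cases s <;> cases t <;> simp

theorem localOp_Y :
    localOp j Axis.Y.pauli = Complex.I • pauliXZ (single j) (single j) := by
  refine ext_slice j fun s t => ?_
  ext a b
  simp only [slice, Matrix.of_apply, Matrix.smul_apply, pauliXZ_apply, dotSign_single_left,
    localOp, Axis.pauli, vxor_single_insertNth, Fin.insertNth_inj]
  cases s <;> cases t <;> simp

/-! ### Change of axis for preparation and measurement -/

/-- The gate of a single-qubit Pauli operator. -/
def localGate (v : Matrix Bool Bool ℂ) : Matrix Bool Bool ℂ :=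
  ((1 + Complex.I) / 2) • (1 : Matrix Bool Bool ℂ) + ((1 - Complex.I) / 2) • v

theorem localOp_localGate (v : Matrix Bool Bool ℂ) :
    localOp j (localGate v) = gate (localOp j v) := by
  rw [localGate, gate, localOp_add, localOp_smul, localOp_smul, localOp_one]

/-- The square of the quarter turn `exp(-iπ(P - 1)/4)` is the half turn `P` itself. -/
theorem pauliX_mem_gateMonoid : pauliX j ∈ gateMonoid (n + 1) := by
  have h : gate (pauliX j) ∈ gateMonoid (n + 1) :=
    Submonoid.subset_closure ⟨_, isPauli_pauliX j, pauliX_sq j, rfl⟩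
  convert mul_mem h h
  simp only [gate, add_mul, mul_add, one_mul, mul_one, smul_mul_smul_comm, pauliX_sq]
  linear_combination (norm := module) ((-1 / 2 : ℂ) * Complex.I_mul_I) • (1 : QubitOp (n + 1)) +
    ((1 / 2 : ℂ) * Complex.I_mul_I) • pauliX j

theorem localGate_mem {p : Axis} (hp : p ≠ .Z) (q : Bool) :
    localOp j (localGate ((if q then (-1 : ℂ) else 1) • p.pauli)) ∈ gateMonoid (n + 1) := by
  have key : IsPauli (localOp j p.pauli) ∧ localOp j p.pauli * localOp j p.pauli = 1 := by
    cases p with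
    | X => rw [localOp_X]; exact ⟨isPauli_pauliX j, pauliX_sq j⟩
    | Y =>
      rw [localOp_Y]
      refine ⟨IsPauli.smul_I ⟨0, _, _, by rw [pow_zero, one_smul]⟩, ?_⟩
      rw [smul_mul_smul_comm, pauliXZ_mul, vxor_self, pauliXZ_zero, Complex.I_mul_I,
        dotSign_single_left]
      simp [single]
    | Z => exact absurd rfl hp
  refine Submonoid.subset_closure ⟨localOp j ((if q then (-1 : ℂ) else 1) • p.pauli), ?_, ?_,
    localOp_localGate j _⟩
  · rw [localOp_smul]
    cases q
    · simpa using key.1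
    · have := key.1.smul_I.smul_I
      rw [smul_smul, Complex.I_mul_I] at this
      simpa using this
  · rw [localOp_smul, smul_mul_smul_comm, key.2]
    cases q <;> simp

/-- All eigenstates are reached from `|0⟩`: a quarter turn about `±Y` leads to the `X` axis, one
about `∓X` to the `Y` axis, and the half turn `X` gives `|1⟩`. -/
theorem exists_prepare (p : Axis) (q : Bool) : ∃ T ∈ gateMonoid (n + 1), ∀ A : QubitOp n,
    prepare j p q A = T * prepare j .Z false A * Tᴴ := by
  have key : ∃ v : Matrix Bool Bool ℂ, localOp j v ∈ gateMonoid (n + 1) ∧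
      ∀ a b, p.proj q a b = v a false * star (v b false) := by
    cases p with
    | X =>
      refine ⟨_, localGate_mem j (p := .Y) (by simp) q, fun a b => ?_⟩
      cases q <;> cases a <;> cases b <;>
        apply Complex.ext <;> simp [localGate, Axis.proj, Axis.pauli] <;> norm_num
    | Y =>
      -- The sign is flipped because the quarter turn about `+X` takes `Z` to `-Y`.
      refine ⟨_, localGate_mem j (p := .X) (by simp) (!q), fun a b => ?_⟩
      cases q <;> cases a <;> cases b <;>
        apply Complex.ext <;> simp [localGate, Axis.proj, Axis.pauli] <;> norm_num
    | Z =>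
      cases q
      · refine ⟨1, by rw [localOp_one]; exact one_mem _, fun a b => ?_⟩
        cases a <;> cases b <;> simp [Axis.proj, Axis.pauli] <;> norm_num
      · refine ⟨Axis.X.pauli, by rw [localOp_X]; exact pauliX_mem_gateMonoid j, fun a b => ?_⟩
        cases a <;> cases b <;> simp [Axis.proj, Axis.pauli] <;> norm_num
  obtain ⟨v, hv, h⟩ := key
  refine ⟨_, hv, fun A => ext_slice j fun a b => ?_⟩
  rw [slice_localOp_conj, slice_prepare, h]
  simp only [slice_prepare, Fintype.sum_bool]
  have h2 : (2⁻¹ * (1 + 1) : ℂ) = 1 := by norm_num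
  simp [Axis.proj, Axis.pauli, h2]

/-- The measured axis is turned into `Z` before the block is fused. The quarter turns are inverse to
those that prepare the `+1` eigenstates, and they must be the same for both outcomes. -/
theorem exists_measure (p : Axis) : ∃ T ∈ gateMonoid (n + 1), ∀ (q : Bool) (A : QubitOp (n + 1)),
    measure j p q A = slice j q q (T * A * Tᴴ) := by
  have key : ∃ v : Matrix Bool Bool ℂ, localOp j v ∈ gateMonoid (n + 1) ∧
      ∀ q s t, p.proj q s t = v q t * star (v q s) := by
    cases p with
    | X =>
      refine ⟨_, localGate_mem j (p := .Y) (by simp) true, fun q a b => ?_⟩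
      cases q <;> cases a <;> cases b <;>
        apply Complex.ext <;> simp [localGate, Axis.proj, Axis.pauli] <;> norm_num
    | Y =>
      refine ⟨_, localGate_mem j (p := .X) (by simp) false, fun q a b => ?_⟩
      cases q <;> cases a <;> cases b <;>
        apply Complex.ext <;> simp [localGate, Axis.proj, Axis.pauli] <;> norm_num
    | Z =>
      refine ⟨1, by rw [localOp_one]; exact one_mem _, fun q a b => ?_⟩
      cases q <;> cases a <;> cases b <;> simp [Axis.proj, Axis.pauli] <;> norm_num
  obtain ⟨v, hv, h⟩ := key
  refine ⟨_, hv, fun q A => ?_⟩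
  rw [slice_localOp_conj, measure_eq]
  simp only [h]

end Local

end ThreeFermion

end

theorem mainTheorem1 (g h : ThreeFermion.TwoCycle) (hgh : g ≠ h) :
    -- Clifford unitaries on any number of qubits, each one `g`-encoded or `h`-encoded
    (∀ (n : ℕ) (τ : Fin n → ThreeFermion.TwoCycle), (∀ j, τ j = g ∨ τ j = h) →
      ∀ U : ThreeFermion.QubitOp n, ThreeFermion.IsClifford U →
        ThreeFermion.Implementable {g, h} τ τ (fun (_ : Unit) A => U * A * U.conjTranspose)) ∧
    -- preparation of an additional qubit in an eigenstate of a Pauli operator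
    (∀ (n : ℕ) (τ : Fin (n + 1) → ThreeFermion.TwoCycle), (∀ j, τ j = g ∨ τ j = h) →
      ∀ (j : Fin (n + 1)) (p : ThreeFermion.Axis) (q : Bool),
        ThreeFermion.Implementable {g, h} (j.removeNth τ) τ
          (fun (_ : Unit) A => ThreeFermion.prepare j p q A)) ∧
    -- measurement of a Pauli operator on one of the qubits
    (∀ (n : ℕ) (τ : Fin (n + 1) → ThreeFermion.TwoCycle), (∀ j, τ j = g ∨ τ j = h) →
      ∀ (j : Fin (n + 1)) (p : ThreeFermion.Axis),
        ThreeFermion.Implementable {g, h} τ (j.removeNth τ)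
          (fun (q : Bool) A => ThreeFermion.measure j p q A)) := by
  have hS : ∀ {n : ℕ} {τ : Fin n → ThreeFermion.TwoCycle}, (∀ j, τ j = g ∨ τ j = h) →
      ∀ j, τ j ∈ ({g, h} : Set ThreeFermion.TwoCycle) := fun hτ j => hτ j
  have hg : g ∈ ({g, h} : Set ThreeFermion.TwoCycle) := Or.inl rfl
  have hh : h ∈ ({g, h} : Set ThreeFermion.TwoCycle) := Or.inr rfl
  refine ⟨fun n τ _ U hU => ?_, fun n τ hτ j p q => ?_, fun n τ _ j p => ?_⟩
  · obtain ⟨T, hT, hUT⟩ := ThreeFermion.exists_gate_of_isClifford hU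
    simp only [hUT]
    exact (ThreeFermion.channel_gateMonoid hgh hg hh τ hT).implementable
  · obtain ⟨T, hT, h⟩ := ThreeFermion.exists_prepare j p q
    simp only [h]
    exact ((ThreeFermion.channel_gateMonoid hgh hg hh τ hT).comp
      (ThreeFermion.channel_prepare_zero j τ (hS hτ j))).implementable
  · obtain ⟨T, hT, h⟩ := ThreeFermion.exists_measure j p
    simp only [h]
    exact (ThreeFermion.channel_gateMonoid hgh hg hh τ hT).measure j
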